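/- Let $K$ be a non-archimedean local field with algebraic closure $\overline{K}$ and absolute value $|\cdot|$ (extended to $\overline{K}$), let $d\ge 1$ and $0\le r\le d-1$, and let $0<\varepsilon<1$ with $\varepsilon\in|\overline{K}|$. Let $\mathbf{G}=\mathrm{GL}_{d+1,K}$ act on $\mathbb{P}^d_K=\mathrm{Proj}\,K[X_0,\dots,X_d]$ by $(g,z)\mapsto z\cdot g^{-1}$ (row vectors), and let $\mathcal{E}$ be a $\mathbf{G}$-equivariant vector bundle on $\mathbb{P}^d_K$, i.e. a locally free sheaf of finite rank with an isomorphism $\Phi\colon\sigma^*\mathcal{E}\cong\mathrm{pr}_2^*\mathcal{E}$ on $\mathbf{G}\times\mathbb{P}^d_K$ (where $\sigma$ denotes the action) satisfying the cocycle condition $\mathrm{pr}_{23}^*\Phi\circ(\mathrm{id}\times\sigma)^*\Phi=(m\times\mathrm{id})^*\Phi$, where $m$ is the multiplication of $\mathbf{G}$. For $I\subset\{0,\dots,d\}$ let $U_I=\bigcap_{i\in I}D_+(X_i)$ and let $U_{I,\varepsilon}\subset U_I^{\mathrm{rig}}$ be the affinoid subdomain (for $I\neq\emptyset$) of all $[z_0:\dots:z_d]$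 with $\varepsilon|z_j|\le|z_i|$ for all $i\in I$ and $j=0,\dots,d$. The sections of (the analytification of) $\mathcal{E}$ on $U_{I,\varepsilon}$ form a finite module $\mathcal{E}(U_{I,\varepsilon})$ over the affinoid algebra $\mathcal{O}(U_{I,\varepsilon})$, hence a $K$-Banach space; endow $\mathcal{E}(U_I)\subset\mathcal{E}(U_{I,\varepsilon})$ with the subspace topology. Consider the Čech complex of the covering $\mathcal{U}$ of $\mathbb{P}^d_K\setminus\mathbb{P}^r_K=\bigcup_{i=r+1}^{d}D_+(X_i)$, where $\mathbb{P}^r_K=V_+(X_{r+1},\dots,X_d)$; that is, $$C^q(\mathcal{U},\mathcal{E})=\bigoplus_{(i_0,\dots,i_q)\in\{r+1,\dots,d\}^{q+1}}\mathcal{E}(U_{\{i_0,\dots,i_q\}}),\qquad (d^qf)_{(j_0,\dots,j_{q+1})}=\sum_{k=0}^{q+1}(-1)^k f_{(j_0,\dots,\widehat{j_k},\dots,j_{q+1})}\big|_{U_{\{j_0,\dots,j_{q+1}\}}},$$ with the direct sum topology. Then for every $q\ge 0$ the differential $d^q\colon C^q(\mathcal{U},\mathcal{E})\to C^{q+1}(\mathcal{U},\mathcal{E})$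 is a strict continuous homomorphism, i.e. it is continuous and the induced bijection $C^q(\mathcal{U},\mathcal{E})/\ker(d^q)\to\mathrm{im}(d^q)$ is a homeomorphism. -/

import Mathlib

open AlgebraicGeometry CategoryTheory
open scoped TensorProduct NNReal Topology

universe u

attribute [local instance] MvPolynomial.gradedAlgebra

namespace EquivCech

noncomputable section

section ProjectiveSpace

/-- The grading of `R[X₀, …, X_d]` by total degree. -/
abbrev grading (d : ℕ) (R : Type u) [CommRing R] :
    ℕ → Submodule R (MvPolynomial (Fin (d + 1)) R) :=
  MvPolynomial.homogeneousSubmodule (Fin (d + 1)) R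

/-- Projective space `ℙ^d_R = Proj R[X₀, …, X_d]`. -/
abbrev PSpace (d : ℕ) (R : Type u) [CommRing R] : Scheme.{u} :=
  Proj (grading d R)

variable {d : ℕ} {R S T : Type u} [CommRing R] [CommRing S] [CommRing T]

/-- For `φ : R → S` and `g ∈ GL_{d+1}(S)`, the ring homomorphism `R[X] → S[X]` which is `φ` on
constants and sends `X_j` to `∑ i, (g⁻¹)_{ij} X_i`. -/
def linSubst (φ : R →+* S) (g : GL (Fin (d + 1)) S) :
    MvPolynomial (Fin (d + 1)) R →+* MvPolynomial (Fin (d + 1)) S :=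
  MvPolynomial.eval₂Hom (MvPolynomial.C.comp φ)
    (fun j => ∑ i, MvPolynomial.C ((g⁻¹ : GL (Fin (d + 1)) S) i j) * MvPolynomial.X i)

theorem linSubst_C (φ : R →+* S) (g : GL (Fin (d + 1)) S) (a : R) :
    linSubst φ g (MvPolynomial.C a) = MvPolynomial.C (φ a) := by
  simp [linSubst]

theorem linSubst_X (φ : R →+* S) (g : GL (Fin (d + 1)) S) (j : Fin (d + 1)) :
    linSubst φ g (MvPolynomial.X j) =
      ∑ i, MvPolynomial.C ((g⁻¹ : GL (Fin (d + 1)) S) i j) * MvPolynomial.X i := by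
  simp [linSubst]

theorem linSubst_mem (φ : R →+* S) (g : GL (Fin (d + 1)) S) {n : ℕ}
    {p : MvPolynomial (Fin (d + 1)) R} (hp : p ∈ grading d R n) :
    linSubst φ g p ∈ grading d S n := by
  rw [MvPolynomial.mem_homogeneousSubmodule] at hp ⊢
  have h := hp.eval₂ (n := 1) (MvPolynomial.C.comp φ)
    (fun j => ∑ i, MvPolynomial.C ((g⁻¹ : GL (Fin (d + 1)) S) i j) * MvPolynomial.X i)
    (fun r => by simpa using MvPolynomial.isHomogeneous_C _ _)
    (fun j => MvPolynomial.IsHomogeneous.sum _ _ _ fun i _ =>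
      MvPolynomial.isHomogeneous_C_mul_X _ _)
  simpa [linSubst] using h

/-- `linSubst` as a homomorphism of graded rings. -/
def linSubstGraded (φ : R →+* S) (g : GL (Fin (d + 1)) S) :
    GradedRingHom (grading d R) (grading d S) where
  toRingHom := linSubst φ g
  map_mem := linSubst_mem φ g

theorem linSubst_comp (ψ : S →+* T) (h : GL (Fin (d + 1)) T) (φ : R →+* S)
    (g : GL (Fin (d + 1)) S) :
    (linSubst ψ h).comp (linSubst φ g) =
      linSubst (ψ.comp φ) (Matrix.GeneralLinearGroup.map ψ g * h) := by
  refine MvPolynomial.ringHom_ext (fun a => ?_) (fun j => ?_)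
  · simp [linSubst_C]
  · simp only [RingHom.comp_apply, linSubst_X, map_sum, map_mul, linSubst_C, mul_inv_rev,
      Units.val_mul, Matrix.mul_apply, Finset.mul_sum, Finset.sum_mul]
    rw [Finset.sum_comm]
    refine Finset.sum_congr rfl fun i _ => Finset.sum_congr rfl fun k _ => ?_
    rw [← map_inv]
    simp only [Matrix.GeneralLinearGroup.map_apply]
    ring

theorem X_eq_sum_linSubst (φ : R →+* S) (g : GL (Fin (d + 1)) S) (k : Fin (d + 1)) :
    (MvPolynomial.X k : MvPolynomial (Fin (d + 1)) S) =
      ∑ j, MvPolynomial.C (g j k) * linSubst φ g (MvPolynomial.X j) := by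
  have hg : ∀ i, ∑ j, (g⁻¹ : GL (Fin (d + 1)) S) i j * g j k = if i = k then 1 else 0 := by
    intro i
    have h := congrFun (congrFun (Units.inv_mul g) i) k
    rwa [Matrix.mul_apply, Matrix.one_apply] at h
  simp only [linSubst_X, Finset.mul_sum]
  rw [Finset.sum_comm]
  have h2 : ∀ i : Fin (d + 1), ∑ j, (MvPolynomial.C (g j k) *
      (MvPolynomial.C ((g⁻¹ : GL (Fin (d + 1)) S) i j) * MvPolynomial.X i) :
        MvPolynomial (Fin (d + 1)) S) =
      MvPolynomial.C (if i = k then 1 else 0) * MvPolynomial.X i := by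
    intro i
    rw [← hg i, map_sum, Finset.sum_mul]
    refine Finset.sum_congr rfl fun j _ => ?_
    rw [map_mul]
    ring
  simp only [h2]
  simp

theorem irrelevant_le_map_linSubst (φ : R →+* S) (g : GL (Fin (d + 1)) S) :
    HomogeneousIdeal.irrelevant (grading d S) ≤
      (HomogeneousIdeal.irrelevant (grading d R)).map (linSubstGraded φ g) := by
  have hX : ∀ k : Fin (d + 1), (MvPolynomial.X k : MvPolynomial (Fin (d + 1)) S) ∈
      ((HomogeneousIdeal.irrelevant (grading d R)).map (linSubstGraded φ g)).toIdeal := by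
    intro k
    rw [X_eq_sum_linSubst φ g k]
    refine Ideal.sum_mem _ fun j _ => Ideal.mul_mem_left _ _ ?_
    refine Ideal.mem_map_of_mem (linSubstGraded φ g) ?_
    exact HomogeneousIdeal.mem_irrelevant_of_mem _ Nat.one_pos
      ((MvPolynomial.mem_homogeneousSubmodule _ _).2 (MvPolynomial.isHomogeneous_X _ _))
  refine (HomogeneousIdeal.toIdeal_irrelevant_le _).2 fun n hn p hp => ?_
  have hp' : p.IsHomogeneous n := (MvPolynomial.mem_homogeneousSubmodule _ _).1 hp
  have hspan : p ∈ Ideal.span (MvPolynomial.X '' (Set.univ : Set (Fin (d + 1)))) := by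
    rw [MvPolynomial.mem_ideal_span_X_image]
    intro m hm
    by_contra hcon
    push Not at hcon
    have hm0 : m = 0 := by
      ext i
      exact hcon i (Set.mem_univ i)
    have hdeg := hp' (MvPolynomial.mem_support_iff.1 hm)
    rw [hm0] at hdeg
    simp at hdeg
    omega
  refine (Ideal.span_le.2 ?_) hspan
  rintro _ ⟨k, -, rfl⟩
  exact hX k

/-- The morphism `ℙ^d_S → ℙ^d_R` over `φ : R → S` given by the linear change of
coordinates `z ↦ z · g⁻¹` (row vectors). -/
def linMap (φ : R →+* S) (g : GL (Fin (d + 1)) S) : PSpace d S ⟶ PSpace d R :=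
  Proj.map (linSubstGraded φ g) (irrelevant_le_map_linSubst φ g)

theorem linMap_comp (ψ : S →+* T) (h : GL (Fin (d + 1)) T) (φ : R →+* S)
    (g : GL (Fin (d + 1)) S) :
    linMap ψ h ≫ linMap φ g =
      linMap (ψ.comp φ) (Matrix.GeneralLinearGroup.map ψ g * h) := by
  rw [linMap, linMap, linMap, ← Proj.map_comp]
  congr 1
  exact GradedRingHom.ext fun p => congrArg (fun f => f p) (linSubst_comp ψ h φ g)

end ProjectiveSpace

section EquivariantBundles

variable (K : Type u) [Field K] (d : ℕ)

/-- The coordinate ring of the algebraic group `GL_{d+1}` over `K`. -/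
abbrev GLRing : Type u :=
  Localization.Away (Matrix.det (Matrix.mvPolynomialX (Fin (d + 1)) (Fin (d + 1)) K))

/-- The coordinate ring of `GL_{d+1} × GL_{d+1}`. -/
abbrev GLRing₂ : Type u := GLRing K d ⊗[K] GLRing K d

/-- The universal invertible matrix. -/
def univGL : GL (Fin (d + 1)) (GLRing K d) :=
  Matrix.GeneralLinearGroup.mk''
    ((Matrix.mvPolynomialX (Fin (d + 1)) (Fin (d + 1)) K).map (algebraMap _ (GLRing K d))) (by
      have h := IsLocalization.Away.algebraMap_isUnit (S := GLRing K d)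
        (Matrix.det (Matrix.mvPolynomialX (Fin (d + 1)) (Fin (d + 1)) K))
      rwa [RingHom.map_det] at h)

theorem univGL_apply (i j : Fin (d + 1)) :
    univGL K d i j = algebraMap (MvPolynomial (Fin (d + 1) × Fin (d + 1)) K) (GLRing K d)
      (MvPolynomial.X (i, j)) := rfl

/-- The first projection `GL × GL → GL` on coordinate rings. -/
def inl : GLRing K d →+* GLRing₂ K d :=
  (Algebra.TensorProduct.includeLeft : GLRing K d →ₐ[K] GLRing₂ K d).toRingHom

/-- The second projection `GL × GL → GL` on coordinate rings. -/
def inr : GLRing K d →+* GLRing₂ K d :=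
  (Algebra.TensorProduct.includeRight : GLRing K d →ₐ[K] GLRing₂ K d).toRingHom

/-- The product of the two universal matrices over `GL × GL`. -/
def univMul : GL (Fin (d + 1)) (GLRing₂ K d) :=
  Matrix.GeneralLinearGroup.map (inl K d) (univGL K d) *
    Matrix.GeneralLinearGroup.map (inr K d) (univGL K d)

/-- The multiplication `GL × GL → GL`, `(g, h) ↦ g h`, on coordinate rings. -/
def comul : GLRing K d →+* GLRing₂ K d :=
  IsLocalization.Away.lift (S := GLRing K d)
    (Matrix.det (Matrix.mvPolynomialX (Fin (d + 1)) (Fin (d + 1)) K))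
    (g := MvPolynomial.eval₂Hom (algebraMap K (GLRing₂ K d)) fun ij => univMul K d ij.1 ij.2) (by
      rw [RingHom.map_det]
      convert (Matrix.isUnit_iff_isUnit_det _).1 (univMul K d).isUnit using 2
      ext i j
      simp [Matrix.mvPolynomialX])

theorem map_comul_univGL :
    Matrix.GeneralLinearGroup.map (comul K d) (univGL K d) = univMul K d := by
  ext i j
  rw [Matrix.GeneralLinearGroup.map_apply, univGL_apply, comul, IsLocalization.Away.lift_eq]
  exact MvPolynomial.eval₂_X _ _ _

theorem comul_comp_algebraMap :
    (comul K d).comp (algebraMap K (GLRing K d)) = algebraMap K (GLRing₂ K d) := by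
  ext a
  rw [RingHom.comp_apply, IsScalarTower.algebraMap_apply K
    (MvPolynomial (Fin (d + 1) × Fin (d + 1)) K) (GLRing K d), MvPolynomial.algebraMap_eq]
  simp [comul]

theorem inl_comp_algebraMap :
    (inl K d).comp (algebraMap K (GLRing K d)) = algebraMap K (GLRing₂ K d) :=
  (Algebra.TensorProduct.includeLeft : GLRing K d →ₐ[K] GLRing₂ K d).comp_algebraMap

theorem inr_comp_algebraMap :
    (inr K d).comp (algebraMap K (GLRing K d)) = algebraMap K (GLRing₂ K d) :=
  (Algebra.TensorProduct.includeRight : GLRing K d →ₐ[K] GLRing₂ K d).comp_algebraMap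

/-- `GL × ℙ^d`, realised as projective space over the coordinate ring of `GL`. -/
abbrev GP : Scheme.{u} := PSpace d (GLRing K d)

/-- `GL × GL × ℙ^d`, realised as projective space over the coordinate ring of `GL × GL`. -/
abbrev GGP : Scheme.{u} := PSpace d (GLRing₂ K d)

/-- The action `σ : GL × ℙ^d → ℙ^d`, `(g, z) ↦ z · g⁻¹`. -/
def act : GP K d ⟶ PSpace d K := linMap (algebraMap K (GLRing K d)) (univGL K d)

/-- The projection `pr₂ : GL × ℙ^d → ℙ^d`. -/
def pr₂ : GP K d ⟶ PSpace d K := linMap (algebraMap K (GLRing K d)) 1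

/-- `m × id : GL × GL × ℙ^d → GL × ℙ^d`, `(g, h, z) ↦ (g h, z)`. -/
def mulId : GGP K d ⟶ GP K d := linMap (comul K d) 1

/-- `pr₂₃ : GL × GL × ℙ^d → GL × ℙ^d`, `(g, h, z) ↦ (h, z)`. -/
def pr₂₃ : GGP K d ⟶ GP K d := linMap (inr K d) 1

/-- `id × σ : GL × GL × ℙ^d → GL × ℙ^d`, `(g, h, z) ↦ (g, σ (h, z))`. -/
def idAct : GGP K d ⟶ GP K d :=
  linMap (inl K d) (Matrix.GeneralLinearGroup.map (inr K d) (univGL K d))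

theorem mulId_act : mulId K d ≫ act K d = idAct K d ≫ act K d := by
  simp only [mulId, act, idAct, linMap_comp, map_comul_univGL, comul_comp_algebraMap,
    inl_comp_algebraMap, mul_one, univMul]

theorem mulId_pr₂ : mulId K d ≫ pr₂ K d = pr₂₃ K d ≫ pr₂ K d := by
  simp only [mulId, pr₂, pr₂₃, linMap_comp, comul_comp_algebraMap, inr_comp_algebraMap, map_one]

theorem idAct_pr₂ : idAct K d ≫ pr₂ K d = pr₂₃ K d ≫ act K d := by
  simp only [idAct, pr₂, pr₂₃, act, linMap_comp, inl_comp_algebraMap, inr_comp_algebraMap,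
    map_one, one_mul, mul_one]

/-- The canonical isomorphism `f^* g^* M ≅ f'^* g'^* M` for a commutative square
`g ∘ f = g' ∘ f'`. -/
def pullbackSquare {W X X' Y : Scheme.{u}} {f : W ⟶ X} {g : X ⟶ Y} {f' : W ⟶ X'} {g' : X' ⟶ Y}
    (h : f ≫ g = f' ≫ g') (M : Y.Modules) :
    (Scheme.Modules.pullback f).obj ((Scheme.Modules.pullback g).obj M) ≅
      (Scheme.Modules.pullback f').obj ((Scheme.Modules.pullback g').obj M) :=
  (Scheme.Modules.pullbackComp f g ≪≫ Scheme.Modules.pullbackCongr h ≪≫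
    (Scheme.Modules.pullbackComp f' g').symm).app M

/-- A sheaf of modules is a vector bundle if it is locally free of finite rank. -/
def IsVectorBundle {X : Scheme.{u}} (M : X.Modules) : Prop :=
  ∀ x : X, ∃ U : X.Opens, x ∈ U ∧ ∃ n : ℕ,
    Nonempty (M.restrict U.ι ≅
      (SheafOfModules.free (R := (U : Scheme.{u}).ringCatSheaf) (ULift.{u} (Fin n)) :
        (U : Scheme.{u}).Modules))

/-- A `GL_{d+1}`-equivariant vector bundle on `ℙ^d_K`: a vector bundle `E` together with an
isomorphism `Φ : σ^* E ≅ pr₂^* E` on `GL × ℙ^d` satisfying the cocycle condition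
`pr₂₃^* Φ ∘ (id × σ)^* Φ = (m × id)^* Φ` on `GL × GL × ℙ^d`. -/
structure EquivariantVectorBundle where
  sheaf : (PSpace d K).Modules
  isVectorBundle : IsVectorBundle sheaf
  Φ : (Scheme.Modules.pullback (act K d)).obj sheaf ≅
    (Scheme.Modules.pullback (pr₂ K d)).obj sheaf
  cocycle :
    (Scheme.Modules.pullback (idAct K d)).map Φ.hom ≫
        (pullbackSquare (idAct_pr₂ K d) sheaf).hom ≫
          (Scheme.Modules.pullback (pr₂₃ K d)).map Φ.hom =
      (pullbackSquare (mulId_act K d).symm sheaf).hom ≫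
        (Scheme.Modules.pullback (mulId K d)).map Φ.hom ≫
          (pullbackSquare (mulId_pr₂ K d) sheaf).hom

end EquivariantBundles

section Tate

variable (K : Type u) [NontriviallyNormedField K] [IsUltrametricDist K] (ι : Type) (ρ : ℝ≥0)

/-- The ring of power series in the variables `T_i`, `i ∈ ι`, with coefficients in `K` which
converge on the closed polydisc of radius `ρ`: `|a_ν| ρ^{|ν|} → 0`. -/
def Tate : Type u := MvPowerSeries.IsRestricted.subring (R := K) (fun _ : ι => (ρ : ℝ))

instance : CommRing (Tate K ι ρ) :=
  inferInstanceAs (CommRing (MvPowerSeries.IsRestricted.subring (R := K) (fun _ : ι => (ρ : ℝ))))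

variable {K ι ρ} in
/-- The underlying formal power series. -/
def Tate.toSeries (f : Tate K ι ρ) : MvPowerSeries ι K := Subtype.val f

theorem Tate.hasGaussNorm (f : Tate K ι ρ) :
    MvPowerSeries.HasGaussNorm (fun a : K => ‖a‖) (fun _ : ι => (ρ : ℝ)) f.toSeries := by
  have h : MvPowerSeries.IsRestricted (fun _ : ι => (ρ : ℝ)) f.toSeries := Subtype.property f
  exact Filter.Tendsto.bddAbove_range_of_cofinite h

/-- The Gauss norm `sup_ν |a_ν| ρ^{|ν|}`. -/
def Tate.gaussSeminorm : RingSeminorm (Tate K ι ρ) where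
  toFun f := MvPowerSeries.gaussNorm (fun a : K => ‖a‖) (fun _ : ι => (ρ : ℝ)) f.toSeries
  map_zero' := MvPowerSeries.gaussNorm_zero _ _ norm_zero
  add_le' f g := by
    have h := MvPowerSeries.gaussNorm_add_le_max (fun a : K => ‖a‖) (fun _ : ι => (ρ : ℝ))
      f.toSeries g.toSeries (fun _ => ρ.2) (fun a => norm_nonneg a)
      (fun a b => IsUltrametricDist.norm_add_le_max a b) (Tate.hasGaussNorm K ι ρ f)
      (Tate.hasGaussNorm K ι ρ g)
    have hf := MvPowerSeries.gaussNorm_nonneg (fun a : K => ‖a‖) (fun _ : ι => (ρ : ℝ))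
      f.toSeries (fun a => norm_nonneg a)
    have hg := MvPowerSeries.gaussNorm_nonneg (fun a : K => ‖a‖) (fun _ : ι => (ρ : ℝ))
      g.toSeries (fun a => norm_nonneg a)
    exact h.trans (max_le_add_of_nonneg hf hg)
  neg' f := MvPowerSeries.gaussNorm_neg _ _ (fun a => norm_neg a) _
  mul_le' f g := MvPowerSeries.gaussNorm_mul_le (fun a : K => ‖a‖) (fun _ : ι => (ρ : ℝ))
      f.toSeries g.toSeries (fun _ => ρ.2) (fun a => norm_nonneg a)
      (fun a b => norm_mul_le a b)
      (fun a b => IsUltrametricDist.norm_add_le_max a b) norm_zero (Tate.hasGaussNorm K ι ρ f)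
      (Tate.hasGaussNorm K ι ρ g)

/-- The Banach topology, defined by the Gauss norm. -/
instance : TopologicalSpace (Tate K ι ρ) :=
  (Tate.gaussSeminorm K ι ρ).toSeminormedRing.toPseudoMetricSpace.toUniformSpace.toTopologicalSpace

/-- The inclusion of the polynomials into the convergent power series. -/
def polyToTate : MvPolynomial ι K →+* Tate K ι ρ :=
  MvPolynomial.coeToMvPowerSeries.ringHom.codRestrict
    (MvPowerSeries.IsRestricted.subring (R := K) (fun _ : ι => (ρ : ℝ))) (by
      intro p
      refine tendsto_nhds_of_eventually_eq ?_
      refine (p.support.finite_toSet).subset fun t ht => ?_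
      by_contra hcon
      refine ht ?_
      have h0 : MvPolynomial.coeff t p = 0 := MvPolynomial.notMem_support_iff.1 hcon
      simp [h0])

instance : Algebra (MvPolynomial ι K) (Tate K ι ρ) := (polyToTate K ι ρ).toAlgebra

end Tate

section Opens

variable (K : Type u) [Field K] {d : ℕ}

/-- The standard open affine subscheme `U_i = D₊(X_i)` of `ℙ^d`. -/
def stdOpen (i : Fin (d + 1)) : (PSpace d K).Opens :=
  Proj.basicOpen (grading d K) (MvPolynomial.X i)

/-- `U_I = ⋂_{i ∈ I} U_i`, with `U_∅ = ℙ^d`. -/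
def stdInter (I : Finset (Fin (d + 1))) : (PSpace d K).Opens := I.inf (stdOpen K)

theorem stdInter_le {I : Finset (Fin (d + 1))} {i : Fin (d + 1)} (hi : i ∈ I) :
    stdInter K I ≤ stdOpen K i := Finset.inf_le hi

theorem stdInter_anti {I J : Finset (Fin (d + 1))} (h : I ⊆ J) :
    stdInter K J ≤ stdInter K I := Finset.inf_mono h

/-- The constant functions on an open subset of `ℙ^d`. -/
def constHom (U : (PSpace d K).Opens) : K →+* Γ(PSpace d K, U) :=
  ((PSpace d K).presheaf.map
      (homOfLE (le_top.trans (Proj.basicOpen_one (grading d K)).ge :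
        U ≤ Proj.basicOpen (grading d K) 1)).op).hom.comp <|
    (Proj.awayToSection (grading d K) 1).hom.comp <|
      (algebraMap (grading d K 0) (HomogeneousLocalization.Away (grading d K) 1)).comp
        (algebraMap K (grading d K 0))

/-- The function `X_j / X_i` on `U_i`. -/
def ratio (j i : Fin (d + 1)) : Γ(PSpace d K, stdOpen K i) :=
  (Proj.awayToSection (grading d K) (MvPolynomial.X i)).hom
    (HomogeneousLocalization.Away.mk (grading d K) (d := 1)
      ((MvPolynomial.mem_homogeneousSubmodule _ _).2 (MvPolynomial.isHomogeneous_X K i)) 1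
      (MvPolynomial.X j)
      ((MvPolynomial.mem_homogeneousSubmodule _ _).2 (MvPolynomial.isHomogeneous_X K j)))

/-- The index set of the coordinates `T_{(j,i)}`, `i ∈ I`, `j ≠ i`. -/
abbrev CoordIdx (I : Finset (Fin (d + 1))) : Type :=
  {p : Fin (d + 1) × Fin (d + 1) // p.2 ∈ I ∧ p.1 ≠ p.2}

/-- The homomorphism `K[T_{(j,i)}] → 𝒪(U_I)`, `T_{(j,i)} ↦ X_j / X_i`. For non-empty `I` it is
surjective and gives the closed immersion of `U_I` into an affine space under which `U_{I,ε}` is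
the preimage of the closed polydisc of radius `1/ε`. -/
def coordHom (I : Finset (Fin (d + 1))) :
    MvPolynomial (CoordIdx I) K →+* Γ(PSpace d K, stdInter K I) :=
  MvPolynomial.eval₂Hom (constHom K (stdInter K I)) fun p =>
    ((PSpace d K).presheaf.map (homOfLE (stdInter_le K p.2.1)).op).hom (ratio K p.1.1 p.1.2)

end Opens

section Sections

variable {K : Type u} [NontriviallyNormedField K] [IsUltrametricDist K] {d : ℕ}
variable (M : (PSpace d K).Modules) (ε : ℝ≥0)

/-- The algebraic sections of `M` on `U_I`. The unused argument `ε` selects the topology below. -/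
def AlgSec (_ε : ℝ≥0) (I : Finset (Fin (d + 1))) : Type u := Γ(M, stdInter K I)

variable (I : Finset (Fin (d + 1)))

instance : AddCommGroup (AlgSec M ε I) := inferInstanceAs (AddCommGroup Γ(M, stdInter K I))

instance : Module Γ(PSpace d K, stdInter K I) (AlgSec M ε I) :=
  inferInstanceAs (Module Γ(PSpace d K, stdInter K I) Γ(M, stdInter K I))

instance : Module (MvPolynomial (CoordIdx I) K) (AlgSec M ε I) :=
  Module.compHom _ (coordHom K I)

instance : Module K (AlgSec M ε I) := Module.compHom _ (constHom K (stdInter K I))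

/-- The sections of the analytification of `M` on the affinoid `U_{I,ε}`, i.e.
`𝒪(U_{I,ε}) ⊗_{𝒪(U_I)} M(U_I)` where
`𝒪(U_{I,ε}) = K⟨ε T_{(j,i)}⟩ ⊗_{K[T_{(j,i)}]} 𝒪(U_I)`; by transitivity of base change this is
the tensor product below. -/
def AnSec : Type u := Tate K (CoordIdx I) ε⁻¹ ⊗[MvPolynomial (CoordIdx I) K] AlgSec M ε I

instance : AddCommGroup (AnSec M ε I) :=
  inferInstanceAs
    (AddCommGroup (Tate K (CoordIdx I) ε⁻¹ ⊗[MvPolynomial (CoordIdx I) K] AlgSec M ε I))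

instance : Module (Tate K (CoordIdx I) ε⁻¹) (AnSec M ε I) :=
  inferInstanceAs (Module (Tate K (CoordIdx I) ε⁻¹)
    (Tate K (CoordIdx I) ε⁻¹ ⊗[MvPolynomial (CoordIdx I) K] AlgSec M ε I))

/-- The canonical topology of a finite module over an affinoid algebra; it is the quotient topology
for any surjection from a finite free module, and is defined by a complete module norm. -/
instance : TopologicalSpace (AnSec M ε I) :=
  moduleTopology (Tate K (CoordIdx I) ε⁻¹) (AnSec M ε I)

/-- The canonical map `M(U_I) → M(U_{I,ε})`. -/
def toAnSec (s : AlgSec M ε I) : AnSec M ε I := (1 : Tate K (CoordIdx I) ε⁻¹) ⊗ₜ s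

/-- The topology on `M(U_I)` coming from the Banach topology of `M(U_{I,ε})`. -/
instance : TopologicalSpace (AlgSec M ε I) :=
  TopologicalSpace.induced (toAnSec M ε I) inferInstance

/-- Restriction of sections from `U_I` to `U_J`, for `I ⊆ J`. -/
def resHom {I J : Finset (Fin (d + 1))} (h : I ⊆ J) : AlgSec M ε I →ₗ[K] AlgSec M ε J where
  toFun s := (M.presheaf.map (homOfLE (stdInter_anti K h)).op).hom s
  map_add' s t := map_add _ s t
  map_smul' a s := by
    have h := Scheme.Modules.map_smul M (homOfLE (stdInter_anti K h))
      (constHom K (stdInter K I) a) s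
    refine h.trans (congrArg (fun c : Γ(PSpace d K, stdInter K J) => c • _) ?_)
    simp only [constHom, RingHom.comp_apply, ← CommRingCat.comp_apply, ← Functor.map_comp]
    rfl

end Sections

section Cech

variable {K : Type u} [NontriviallyNormedField K] [IsUltrametricDist K] {d : ℕ}
variable (M : (PSpace d K).Modules) (ε : ℝ≥0) (r : ℕ)

/-- The index set `{r + 1, …, d}` of the covering `ℙ^d ∖ ℙ^r = ⋃_{i = r+1}^d U_i`. -/
abbrev CoverIdx (d r : ℕ) : Type := {i : Fin (d + 1) // r < (i : ℕ)}

/-- The set `{i_0, …, i_q}` of entries of a tuple. -/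
def tupleSet {q : ℕ} (i : Fin (q + 1) → CoverIdx d r) : Finset (Fin (d + 1)) :=
  Finset.univ.image fun k => (i k : Fin (d + 1))

theorem tupleSet_succAbove {q : ℕ} (j : Fin (q + 2) → CoverIdx d r) (k : Fin (q + 2)) :
    tupleSet r (fun l => j (k.succAbove l)) ⊆ tupleSet r j := by
  intro x hx
  simp only [tupleSet, Finset.mem_image, Finset.mem_univ, true_and] at hx ⊢
  obtain ⟨l, hl⟩ := hx
  exact ⟨_, hl⟩

/-- The Čech cochains `∏_{(i_0, …, i_q)} M(U_{i_0, …, i_q})`, with the product topology. -/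
abbrev Cochain (q : ℕ) : Type u :=
  ∀ i : Fin (q + 1) → CoverIdx d r, AlgSec M ε (tupleSet r i)

/-- The Čech differential
`(d f)(j_0, …, j_{q+1}) = ∑ k, (-1)^k f(j_0, …, ĵ_k, …, j_{q+1})|`. -/
def cechDiff (q : ℕ) : Cochain M ε r q →ₗ[K] Cochain M ε r (q + 1) :=
  LinearMap.pi fun j => ∑ k : Fin (q + 2), (-1 : K) ^ (k : ℕ) •
    (resHom M ε (tupleSet_succAbove r j k)).comp
      (LinearMap.proj fun l => j (k.succAbove l))

end Cech

end

end EquivCech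

/-!
The Čech differentials of a vector bundle on projective space are strict because every coboundary
close to zero is the coboundary of a cochain close to zero. The cochain is produced by operators
that are continuous at zero, and a homomorphism with a section of its image that is continuous at
zero is strict (`isStrictMap_of_section`).

*Reduction to Laurent polynomials.* Restriction to the torus `U_{0,…,d}` identifies the functions
on `U_I`, for non-empty `I`, with the Laurent polynomials of degree zero whose poles lie on the
hyperplanes `x_i = 0`, `i ∈ I` (`openToLaurent_injective`, `openToLaurent_mem`,
`exists_openToLaurent_eq`). The affinoid coordinates `x_j / x_i` are monomials, and every monomial
`x^ν` on `U_I` is a product of such coordinates with as many factors as `x^ν` has poles. The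
polynomials being dense in the Tate algebra, it follows that the topology on the functions on `U_I`
is given by the norm `max_ν |a_ν| ε^{-poleDeg ν}` (`canNhd_twistAlg`). This norm does not depend on
`I`, so operations on Laurent polynomials which only select monomials are continuous, whatever
open sets they relate.

A vector bundle is quasi-coherent (`IsVectorBundle.isQuasicoherent`), and its sections on the affine
open set `U_i` form a finite projective module (`finite_projective_sections`). Dual bases on the
`U_i` present the bundle as a module over the ring of Laurent polynomials with finitely many
coordinate functionals for each `i`, the transition functions being regular on the `U_{ij}`
(`LaurentSystem`, `Charts.system`). Both the regularity of a section on `U_I` and the topology on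
these sections can be tested on the coordinates of any single `i ∈ I` (`Charts.mem_sec_iff`,
`Charts.tendsto_nhds_zero_iff`).

*Strictness for Laurent systems.* Let `n` be the number of open sets. On tuples of length at least
`n`, the complex of all (not only alternating) cochains has a contraction on cocycles which uses
nothing but restrictions (`NbhdSys.exists_contraction`). On shorter tuples, all coordinates
together, multiplied by high powers `x_i^N`, embed the system into the free system `𝒪(N)^β`, and
each chart splits the embedding. For the free system a monomial occurring in a value at a tuple of
length less than `n` has no pole along some hyperplane `x_j = 0` of the covering, hence extends
over `U_j`; choosing such a `j` for each monomial gives a continuous contracting homotopy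
(`homotopy_cobd`, `tendsto_homotopy`).

Apply the homotopy to a small coboundary of the given system. The result is a small cochain of
`𝒪(N)^β` with the right coboundary, whose image in the cokernel of the embedding is a coboundary.
If that image is the coboundary of a small cochain of the cokernel, then correcting by a lift of the
latter moves the cochain into the given system (`LaurentSystem.strictAt_of_lift`). The cokernel is
again a Laurent system (`LaurentSystem.cokerSystem`), with tuples one shorter, and induction applies
(`LaurentSystem.strictAt`). In the lowest degree the image in the cokernel comes from a global
section of `𝒪(N)^β`, and a small lift exists because these sections form a finite-dimensional space
(`LaurentSystem.strictAt_one`).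
-/

set_option linter.unusedSectionVars false

namespace EquivCech

noncomputable section

/-! ### Vector bundles are quasi-coherent -/

/-- The tautological presentation of a free module, without relations. -/
def freePresentation (X : Scheme.{u}) (I : Type u) :
    SheafOfModules.Presentation (SheafOfModules.free (R := X.ringCatSheaf) I) where
  generators := SheafOfModules.free.generatingSections I
  relations.I := ULift Empty
  relations.s j := Empty.rec _ j.down
  relations.epi := Limits.IsZero.epi
    (Limits.IsZero.of_iso (Limits.isZero_zero _) (Limits.kernel.ofMono _)) _

/-- The structure sheaf of an open subscheme is the restriction of the structure sheaf. -/
def overUnitIso {X : Scheme.{u}} (U : X.Opens) :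
    (Scheme.Modules.overEquiv U).functor.obj (SheafOfModules.unit (X.ringCatSheaf.over U)) ≅
      SheafOfModules.unit (U : Scheme.{u}).ringCatSheaf := Iso.refl _

/-- On each open set of a trivializing covering the bundle has the presentation of a free module. -/
theorem IsVectorBundle.isQuasicoherent {X : Scheme.{u}} {M : X.Modules} (hM : IsVectorBundle M) :
    M.IsQuasicoherent := by
  choose U hxU n e using hM
  refine SheafOfModules.QuasicoherentData.isQuasicoherent
    (M := M) { I := (X : Type u), X := fun x => U x, coversTop := ?_, presentation := fun x => ?_ }
  · rw [Opens.coversTop_iff, TopologicalSpace.IsOpenCover]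
    exact eq_top_iff.2 fun x _ => TopologicalSpace.Opens.mem_iSup.2 ⟨x, hxU x⟩
  · let E := Scheme.Modules.overEquiv (U x)
    let P : SheafOfModules.Presentation (M.restrict (U x).ι) :=
      @SheafOfModules.Presentation.ofIsIso _ _ _ _ _ _ _ _ (e x).some.inv
        (by exact (e x).some.isIso_inv) (freePresentation _ _)
    let F : SheafOfModules.{u} (U x : Scheme.{u}).ringCatSheaf ⥤
      SheafOfModules.{u} (X.ringCatSheaf.over (U x)) := E.inverse
    have hF : Limits.PreservesColimitsOfSize.{u, u} F :=
      E.symm.toAdjunction.leftAdjoint_preservesColimits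
    let η : SheafOfModules.unit (X.ringCatSheaf.over (U x)) ≅
        E.inverse.obj (SheafOfModules.unit (U x : Scheme.{u}).ringCatSheaf) :=
      E.unitIso.app _ ≪≫ E.inverse.mapIso (overUnitIso (U x))
    let P' := P.map F η
    exact P'.ofIsIso (E.inverse.mapIso ((Scheme.Modules.overFunctorEquiv (U x)).symm.app M) ≪≫
      (E.unitIso.app (M.over (U x))).symm).hom

/-- A bundle which is trivial on `U` is trivial on every affine chart with image in `U`. -/
theorem exists_iso_free {X : Scheme.{u}} {M : X.Modules} (U : X.Opens) (n : ℕ)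
    (e : Nonempty (M.restrict U.ι ≅
      (SheafOfModules.free (R := (U : Scheme.{u}).ringCatSheaf) (ULift.{u} (Fin n)) :
        (U : Scheme.{u}).Modules)))
    {R : CommRingCat.{u}} (f : Spec R ⟶ X) [IsOpenImmersion f] (hf : f.opensRange ≤ U) :
    Nonempty (M.restrict f ≅
      (SheafOfModules.free (R := (Spec R).ringCatSheaf) (ULift.{u} (Fin n)) :
        (Spec R).Modules)) := by
  let g : Spec R ⟶ U := IsOpenImmersion.lift U.ι f (by
    simpa using (show (f.opensRange : Set X) ⊆ U from hf))
  have hg : g ≫ U.ι = f := IsOpenImmersion.lift_fac _ _ _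
  have : IsOpenImmersion (g ≫ U.ι) := by rw [hg]; infer_instance
  have : IsOpenImmersion g := IsOpenImmersion.of_comp g U.ι
  let F : SheafOfModules.{u} (U : Scheme.{u}).ringCatSheaf ⥤
    SheafOfModules.{u} (Spec R).ringCatSheaf := Scheme.Modules.restrictFunctor.{u} g
  have hF : Limits.PreservesColimitsOfSize.{u, u} F :=
    (Scheme.Modules.restrictAdjunction g).leftAdjoint_preservesColimits
  have hF' : Limits.PreservesColimitsOfShape (Discrete (ULift.{u} (Fin n))) F :=
    hF.preservesColimitsOfShape
  refine ⟨(Scheme.Modules.restrictFunctorCongr hg.symm ≪≫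
    Scheme.Modules.restrictFunctorComp g U.ι).app M ≪≫
    (Scheme.Modules.restrictFunctor g).mapIso e.some ≪≫ ?_⟩
  exact (SheafOfModules.mapFreeIso F (ULift.{u} (Fin n))
    (Scheme.Modules.restrictUnitIso g).symm).symm

/-! ### Sections over basic open subsets -/

section Localization

variable {X : Scheme.{u}}

theorem appIso_inv_fromSpec {U : X.Opens} (hU : IsAffineOpen U) (W : (Spec Γ(X, U)).Opens)
    (h : hU.fromSpec ''ᵁ W ≤ U) (r : Γ(X, U)) :
    (hU.fromSpec.appIso W).inv ((Spec Γ(X, U)).presheaf.map W.leTop.op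
      ((Scheme.ΓSpecIso Γ(X, U)).inv r)) = X.presheaf.map (homOfLE h).op r := by
  have h1 : X.presheaf.map (homOfLE h).op ≫ (hU.fromSpec.appIso W).hom =
      (Scheme.ΓSpecIso Γ(X, U)).inv ≫ (Spec Γ(X, U)).presheaf.map W.leTop.op := by
    rw [Scheme.Hom.appIso_hom', Scheme.Hom.map_appLE, Scheme.Hom.appLE, hU.fromSpec_app_self,
      Category.assoc, ← Functor.map_comp]
    rfl
  rw [← CommRingCat.comp_apply, ← CommRingCat.comp_apply, ← Category.assoc, ← h1, Category.assoc,
    Iso.hom_inv_id, Category.comp_id]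

/-- Restriction of functions. -/
abbrev resO {U V : X.Opens} (h : V ≤ U) : Γ(X, U) →+* Γ(X, V) :=
  (X.presheaf.map (homOfLE h).op).hom

/-- Restriction of sections of a sheaf of modules. -/
abbrev resM (M : X.Modules) {U V : X.Opens} (h : V ≤ U) : Γ(M, U) →+ Γ(M, V) :=
  (M.presheaf.map (homOfLE h).op).hom

theorem resM_smul (M : X.Modules) {U V : X.Opens} (h : V ≤ U) (r : Γ(X, U)) (s : Γ(M, U)) :
    resM M h (r • s) = resO h r • resM M h s :=
  Scheme.Modules.map_smul M (homOfLE h) r s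

theorem resM_resM (M : X.Modules) {U V W : X.Opens} (h : V ≤ U) (h' : W ≤ V) (s : Γ(M, U)) :
    resM M h' (resM M h s) = resM M (h'.trans h) s := by
  change (M.presheaf.map _ ≫ M.presheaf.map _) s = _
  rw [← Functor.map_comp]
  rfl

theorem resO_resO {U V W : X.Opens} (h : V ≤ U) (h' : W ≤ V) (s : Γ(X, U)) :
    resO h' (resO h s) = resO (h'.trans h) s := by
  change (X.presheaf.map _ ≫ X.presheaf.map _) s = _
  rw [← Functor.map_comp]
  rfl

/-- On an affine open set a quasi-coherent sheaf is the sheaf of a module, whose sections on basic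
open subsets are localizations. -/
theorem isLocalizing_restrict {M : X.Modules} [M.IsQuasicoherent] {U : X.Opens}
    (hU : IsAffineOpen U) :
    IsLocalizing (modulesSpecToSheaf.obj (M.restrict hU.fromSpec)) := by
  have : (M.restrict hU.fromSpec).IsQuasicoherent :=
    Scheme.Modules.isQuasicoherent_restrictFunctor hU.fromSpec M
  exact (isIso_fromTildeΓ_iff_isLocalizing _).1 inferInstance

theorem smul_restrict_fromSpec {M : X.Modules} {U : X.Opens}
    (hU : IsAffineOpen U) (W : (Spec Γ(X, U)).Opens) (h : hU.fromSpec ''ᵁ W ≤ U)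
    (r : Γ(X, U)) (s : Γ(M.restrict hU.fromSpec, W)) :
    (M.restrictAppIso hU.fromSpec W).hom (r • s) =
      resO h r • (M.restrictAppIso hU.fromSpec W).hom s := by
  rw [Scheme.Modules.smul_Spec_def]
  refine (Scheme.Modules.smul_restrictAppIso_hom_apply hU.fromSpec M W _ s).trans ?_
  exact congrArg (fun c : Γ(X, hU.fromSpec ''ᵁ W) => c • (M.restrictAppIso hU.fromSpec W).hom s)
    (appIso_inv_fromSpec hU W h r)

/-- Sections on a basic open subset of an affine open set extend up to a power of the function. -/
theorem exists_res_eq_pow_smul (M : X.Modules) [M.IsQuasicoherent] {U V : X.Opens}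
    (hU : IsAffineOpen U) (f : Γ(X, U)) (hV : V = X.basicOpen f) (h : V ≤ U) (s : Γ(M, V)) :
    ∃ (n : ℕ) (t : Γ(M, U)), resM M h t = resO h f ^ n • s := by
  have hT : hU.fromSpec ''ᵁ ⊤ = U := by
    rw [Scheme.Hom.image_top_eq_opensRange, hU.opensRange_fromSpec]
  have hD : V = hU.fromSpec ''ᵁ PrimeSpectrum.basicOpen f := by
    rw [hV, hU.fromSpec_image_basicOpen]
  subst hD
  obtain ⟨⟨t, ⟨_, n, rfl⟩⟩, ht⟩ := (isLocalizing_restrict (M := M) hU f).surj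
    ((M.restrictAppIso hU.fromSpec _).inv s)
  refine ⟨n, resM M hT.ge ((M.restrictAppIso hU.fromSpec ⊤).hom t), ?_⟩
  rw [← map_pow]
  have h2 := smul_restrict_fromSpec hU (PrimeSpectrum.basicOpen f) h (f ^ n)
    ((M.restrictAppIso hU.fromSpec _).inv s)
  have h3 : (M.restrictAppIso hU.fromSpec _).hom ((M.restrictAppIso hU.fromSpec _).inv s) = s := rfl
  rw [h3] at h2
  rw [← h2, resM_resM]
  exact (congrArg (M.restrictAppIso hU.fromSpec _).hom ht).symm

/-- A section vanishing on a basic open subset is killed by a power of the function. -/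
theorem exists_pow_smul_eq_zero (M : X.Modules) [M.IsQuasicoherent] {U V : X.Opens}
    (hU : IsAffineOpen U) (f : Γ(X, U)) (hV : V = X.basicOpen f) (h : V ≤ U) (t : Γ(M, U))
    (ht : resM M h t = 0) : ∃ n : ℕ, f ^ n • t = 0 := by
  have hT : hU.fromSpec ''ᵁ ⊤ = U := by
    rw [Scheme.Hom.image_top_eq_opensRange, hU.opensRange_fromSpec]
  have hD : V = hU.fromSpec ''ᵁ PrimeSpectrum.basicOpen f := by
    rw [hV, hU.fromSpec_image_basicOpen]
  subst hD
  have := isLocalizing_restrict (M := M) hU f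
  obtain ⟨⟨_, n, rfl⟩, hn⟩ := (IsLocalizedModule.eq_zero_iff (Submonoid.powers f)
    ((modulesSpecToSheaf.obj (M.restrict hU.fromSpec)).obj.map
      (PrimeSpectrum.basicOpen f).leTop.op).hom
      (m := (M.restrictAppIso hU.fromSpec ⊤).inv (resM M hT.le t))).1 (by
        refine (show _ = resM M h t from ?_).trans ht
        exact resM_resM M hT.le (hU.fromSpec.image_mono le_top) t)
  refine ⟨n, ?_⟩
  have h2 := smul_restrict_fromSpec hU ⊤ hT.le (f ^ n)
    ((M.restrictAppIso hU.fromSpec _).inv (resM M hT.le t))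
  have h3 : (M.restrictAppIso hU.fromSpec _).hom ((M.restrictAppIso hU.fromSpec _).inv
    (resM M hT.le t)) = (resM M hT.le t) := rfl
  rw [h3, ← resM_smul] at h2
  have h4 : resM M hT.le (f ^ n • t) = 0 := by
    rw [← h2]
    exact congrArg (M.restrictAppIso hU.fromSpec _).hom hn
  have h5 := congrArg (resM M hT.ge) h4
  rw [resM_resM, map_zero] at h5
  rw [← h5]
  exact (congrArg (fun g => g (f ^ n • t)) (M.presheaf.map_id (Opposite.op U))).symm
end Localization

/-! ### Sections over affine open subsets -/

section AffineOpen

variable {X : Scheme.{u}}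

/-- The sections over an affine open `V`, computed on `Spec Γ(X, V)`. -/
def sectionsEquivRestrict (M : X.Modules) {V : X.Opens} (hV : IsAffineOpen V) :
    Γ(M, V) ≃ₗ[Γ(X, V)] Γ(M.restrict hV.fromSpec, ⊤) :=
  have hT : hV.fromSpec ''ᵁ ⊤ = V := by
    rw [Scheme.Hom.image_top_eq_opensRange, hV.opensRange_fromSpec]
  { toFun s := (M.restrictAppIso hV.fromSpec ⊤).inv (resM M hT.le s)
    invFun s := resM M hT.ge ((M.restrictAppIso hV.fromSpec ⊤).hom s)
    map_add' s t := by simp only [map_add]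
    map_smul' r s := by
      have h2 := smul_restrict_fromSpec hV ⊤ hT.le r
        ((M.restrictAppIso hV.fromSpec _).inv (resM M hT.le s))
      rw [resM_smul]
      exact h2.symm
    left_inv s := (resM_resM M hT.le hT.ge s).trans
      (congrArg (fun g => g s) (M.presheaf.map_id (Opposite.op V)))
    right_inv s := (resM_resM M hT.ge hT.le _).trans
      (congrArg (fun g => g s) (M.presheaf.map_id (Opposite.op (hV.fromSpec ''ᵁ ⊤)))) }

theorem free_of_iso_free {R : CommRingCat.{u}} {N : (Spec R).Modules} {n : ℕ}
    (e : N ≅ (SheafOfModules.free (R := (Spec R).ringCatSheaf) (ULift.{u} (Fin n)) :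
        (Spec R).Modules)) :
    Nonempty ((ULift.{u} (Fin n) →₀ R) ≃ₗ[R] Γ(N, ⊤)) := by
  let e1 : N ≅ tilde (ModuleCat.of R (ULift.{u} (Fin n) →₀ R)) := e ≪≫ (tildeFinsupp _).symm
  let e2 := (moduleSpecΓFunctor (R := R)).mapIso e1
  exact ⟨((asIso (tilde.toOpen (ModuleCat.of R (ULift.{u} (Fin n) →₀ R)) ⊤)) ≪≫
    e2.symm).toLinearEquiv⟩

/-- Each point of an affine open set has a basic open neighbourhood with free sections. -/
theorem exists_basicOpen_free {M : X.Modules} (hM : IsVectorBundle M) {U : X.Opens}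
    (hU : IsAffineOpen U) (x : U) : ∃ f : Γ(X, U), (x : X) ∈ X.basicOpen f ∧
      Module.Free Γ(X, X.basicOpen f) Γ(M, X.basicOpen f) ∧
      Module.Finite Γ(X, X.basicOpen f) Γ(M, X.basicOpen f) := by
  obtain ⟨W, hxW, n, e⟩ := hM x
  obtain ⟨f, hf, hxf⟩ := hU.exists_basicOpen_le ⟨x, hxW⟩ x.2
  have hV : IsAffineOpen (X.basicOpen f) := hU.basicOpen f
  obtain ⟨e1⟩ := exists_iso_free W n e hV.fromSpec (by rwa [hV.opensRange_fromSpec])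
  obtain ⟨e2⟩ := free_of_iso_free e1
  let e3 := e2.trans (sectionsEquivRestrict M hV).symm
  exact ⟨f, hxf, Module.Free.of_equiv e3, Module.Finite.equiv e3⟩

section

variable (M : X.Modules) {U V : X.Opens} (h : V ≤ U)

/-- Sections on a smaller open set as a module over the functions on a larger one. -/
abbrev moduleRes : Module Γ(X, U) Γ(M, V) := Module.compHom _ (resO h)

theorem isLocalizedModule_res [M.IsQuasicoherent] (hU : IsAffineOpen U) (f : Γ(X, U))
    (hV : V = X.basicOpen f) :
    letI := moduleRes M h
    IsLocalizedModule.Away f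
      ({ resM M h with map_smul' := resM_smul M h } : Γ(M, U) →ₗ[Γ(X, U)] Γ(M, V)) := by
  let _ := moduleRes M h
  let _ := (resO h).toAlgebra
  have : IsScalarTower Γ(X, U) Γ(X, V) Γ(M, V) := IsScalarTower.of_compHom _ _ _
  subst hV
  have := hU.isLocalization_basicOpen f
  refine IsLocalizedModule.Away.mk_of_addCommGroup ?_ ?_ ?_
  · have h1 : IsUnit (algebraMap Γ(X, U) Γ(X, X.basicOpen f) f) :=
      RingedSpace.isUnit_res_basicOpen _ f
    rw [Module.End.isUnit_iff]
    have h2 := (Module.End.isUnit_iff _).1 (h1.map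
      (algebraMap _ (Module.End Γ(X, X.basicOpen f) Γ(M, X.basicOpen f))))
    exact h2
  · intro s
    obtain ⟨n, t, ht⟩ := exists_res_eq_pow_smul M hU f rfl h s
    exact ⟨n, t, by rw [← map_pow] at ht; exact ht.symm⟩
  · intro t ht
    exact exists_pow_smul_eq_zero M hU f rfl h t ht
end

/-- Finiteness and flatness are local on an affine open set; over a noetherian ring a finite flat
module is projective. -/
theorem finite_projective_sections {M : X.Modules} (hM : IsVectorBundle M) {U : X.Opens}
    (hU : IsAffineOpen U) [IsNoetherianRing Γ(X, U)] :
    Module.Finite Γ(X, U) Γ(M, U) ∧ Module.Projective Γ(X, U) Γ(M, U) := by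
  choose f hxf hfree hfin using exists_basicOpen_free hM hU
  have hqc := hM.isQuasicoherent
  have hs : Ideal.span (Set.range f) = ⊤ := by
    refine hU.self_le_iSup_basicOpen_iff.1 fun x hx => ?_
    exact TopologicalSpace.Opens.mem_iSup.2 ⟨⟨f ⟨x, hx⟩, Set.mem_range_self _⟩, hxf ⟨x, hx⟩⟩
  have hfree' : ∀ g : Set.range f, Module.Free Γ(X, X.basicOpen g.1) Γ(M, X.basicOpen g.1) := by
    rintro ⟨_, x, rfl⟩
    exact hfree x
  have hfin' : ∀ g : Set.range f, Module.Finite Γ(X, X.basicOpen g.1) Γ(M, X.basicOpen g.1) := by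
    rintro ⟨_, x, rfl⟩
    exact hfin x
  let _ : ∀ g : Set.range f, Module Γ(X, U) Γ(M, X.basicOpen g.1) :=
    fun g => moduleRes M (X.basicOpen_le g.1)
  let _ : ∀ g : Set.range f, Algebra Γ(X, U) Γ(X, X.basicOpen g.1) :=
    fun g => (resO (X.basicOpen_le g.1)).toAlgebra
  have _ : ∀ g : Set.range f,
      IsScalarTower Γ(X, U) Γ(X, X.basicOpen g.1) Γ(M, X.basicOpen g.1) :=
    fun g => IsScalarTower.of_compHom _ _ _
  have _ : ∀ g : Set.range f, IsLocalization.Away g.1 Γ(X, X.basicOpen g.1) :=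
    fun g => hU.isLocalization_basicOpen g.1
  let φ : ∀ g : Set.range f, Γ(M, U) →ₗ[Γ(X, U)] Γ(M, X.basicOpen g.1) := fun g =>
    { resM M (X.basicOpen_le g.1) with map_smul' := resM_smul M (X.basicOpen_le g.1) }
  have hφ : ∀ g : Set.range f, IsLocalizedModule.Away g.1 (φ g) := fun g =>
    isLocalizedModule_res M (X.basicOpen_le g.1) hU g.1 rfl
  have h1 : Module.Finite Γ(X, U) Γ(M, U) :=
    Module.Finite.of_localizationSpan' (Set.range f) hs (Rₚ := fun g => Γ(X, X.basicOpen g.1)) φ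
      hfin'
  have h2 : Module.Flat Γ(X, U) Γ(M, U) := by
    refine Module.flat_of_isLocalized_span _ _ (Set.range f) hs _ φ fun g => ?_
    have : Module.Flat Γ(X, U) Γ(X, X.basicOpen g.1) :=
      IsLocalization.flat _ (Submonoid.powers g.1)
    exact Module.Flat.trans Γ(X, U) Γ(X, X.basicOpen g.1) _
  have h3 := Module.finitePresentation_of_finite Γ(X, U) Γ(M, U)
  exact ⟨h1, Module.Flat.projective_of_finitePresentation⟩
end AffineOpen

/-! ### Cochains with values in a filtered group -/

section Simplicial

variable {α V : Type*} [AddCommGroup V]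

/-- The alternating sum of the faces, for arbitrary functions on tuples of length `l`. The Čech
differential in degree `q` is the case `l = q + 1`. -/
def cobd {l : ℕ} (c : (Fin l → α) → V) : (Fin (l + 1) → α) → V :=
  fun t => ∑ k : Fin (l + 1), (-1 : ℤ) ^ (k : ℕ) • c (fun i => t (k.succAbove i))

/-- Prepend an entry. -/
abbrev tcons {l : ℕ} (a : α) (t : Fin l → α) : Fin (l + 1) → α := Fin.cons (α := fun _ => α) a t

theorem cobd_add {l : ℕ} (c c' : (Fin l → α) → V) : cobd (c + c') = cobd c + cobd c' := by
  ext t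
  simp [cobd, Finset.sum_add_distrib]

theorem cobd_neg {l : ℕ} (c : (Fin l → α) → V) : cobd (-c) = -cobd c := by
  ext t
  simp [cobd]

theorem cobd_sub {l : ℕ} (c c' : (Fin l → α) → V) : cobd (c - c') = cobd c - cobd c' := by
  rw [sub_eq_add_neg, cobd_add, cobd_neg, sub_eq_add_neg]

/-- Prepending a vertex is a contracting homotopy of the full simplex. -/
theorem cobd_tcons {l : ℕ} (c : (Fin (l + 1) → α) → V) (a : α) (t : Fin (l + 1) → α) :
    cobd c (tcons a t) = c t - cobd (fun s => c (tcons a s)) t := by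
  rw [cobd, Fin.sum_univ_succ, cobd, sub_eq_add_neg, ← Finset.sum_neg_distrib]
  congr 1
  · simp [tcons]
  · refine Finset.sum_congr rfl fun k _ => ?_
    rw [Fin.val_succ, pow_succ, mul_neg_one, neg_smul]
    congr 3
    ext i
    refine Fin.cases ?_ (fun i => ?_) i <;> simp [tcons]

theorem cobd_cobd {l : ℕ} (c : (Fin l → α) → V) : cobd (cobd c) = 0 := by
  induction l with
  | zero =>
    ext t
    simp [cobd, Fin.sum_univ_two, Subsingleton.elim _ (Fin.elim0 : Fin 0 → α)]
  | succ l ih =>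
    ext t
    obtain ⟨a, s, rfl⟩ : ∃ a s, t = tcons a s :=
      ⟨t 0, fun i => t i.succ, (Fin.cons_self_tail t).symm⟩
    have h1 : (fun s => cobd c (tcons a s)) = c - cobd (fun s => c (tcons a s)) := by
      ext s
      exact cobd_tcons c a s
    rw [cobd_tcons, h1, cobd_sub, ih]
    simp

theorem cobd_map {W : Type*} [AddCommGroup W] (g : V →+ W) {l : ℕ} (c : (Fin l → α) → V) :
    cobd (fun s => g (c s)) = fun t => g (cobd c t) := by
  ext t
  simp [cobd]

end Simplicial

section NbhdSys

open Filter

variable {α V : Type*} [AddCommGroup V]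

/-- A group topology on each term of an increasing family of subgroups of `V` indexed by finite
sets, encoded by the filters on `V` generated by the neighbourhoods of zero. -/
structure NbhdSys (α V : Type*) [AddCommGroup V] where
  nhd : Finset α → Filter V
  tendsto_add : ∀ I, Tendsto (fun p : V × V => p.1 + p.2) (nhd I ×ˢ nhd I) (nhd I)
  tendsto_neg : ∀ I, Tendsto (fun v : V => -v) (nhd I) (nhd I)
  pure_le : ∀ I, pure 0 ≤ nhd I
  mono : ∀ {I J}, I ⊆ J → nhd I ≤ nhd J

namespace NbhdSys

variable {S : NbhdSys α V}

theorem tendsto_zero {X : Type*} {F : Filter X} {I : Finset α} :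
    Tendsto (fun _ : X => (0 : V)) F (S.nhd I) :=
  (tendsto_const_pure).mono_right (S.pure_le I)

theorem tendsto_add' {X : Type*} {F : Filter X} {I : Finset α} {f g : X → V}
    (hf : Tendsto f F (S.nhd I)) (hg : Tendsto g F (S.nhd I)) :
    Tendsto (fun x => f x + g x) F (S.nhd I) :=
  (S.tendsto_add I).comp (hf.prodMk hg)

theorem tendsto_neg' {X : Type*} {F : Filter X} {I : Finset α} {f : X → V}
    (hf : Tendsto f F (S.nhd I)) : Tendsto (fun x => -f x) F (S.nhd I) :=
  (S.tendsto_neg I).comp hf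

theorem tendsto_sub' {X : Type*} {F : Filter X} {I : Finset α} {f g : X → V}
    (hf : Tendsto f F (S.nhd I)) (hg : Tendsto g F (S.nhd I)) :
    Tendsto (fun x => f x - g x) F (S.nhd I) := by
  simp only [sub_eq_add_neg]
  exact tendsto_add' hf (tendsto_neg' hg)

theorem tendsto_sum {X ι : Type*} {F : Filter X} {I : Finset α} (s : Finset ι) {f : ι → X → V}
    (hf : ∀ i ∈ s, Tendsto (f i) F (S.nhd I)) :
    Tendsto (fun x => ∑ i ∈ s, f i x) F (S.nhd I) := by
  classical
  induction s using Finset.induction_on with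
  | empty => simpa using tendsto_zero
  | insert i s hi ih =>
    simp only [Finset.sum_insert hi]
    exact tendsto_add' (hf i (Finset.mem_insert_self _ _))
      (ih fun j hj => hf j (Finset.mem_insert_of_mem hj))

end NbhdSys

variable [DecidableEq α]

/-- The set of entries of a tuple. -/
abbrev entries {l : ℕ} (t : Fin l → α) : Finset α := Finset.univ.image t

theorem entries_face {l : ℕ} (t : Fin (l + 1) → α) (k : Fin (l + 1)) :
    entries (fun i => t (k.succAbove i)) ⊆ entries t := by
  intro x hx
  simp only [entries, Finset.mem_image, Finset.mem_univ, true_and] at hx ⊢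
  obtain ⟨i, hi⟩ := hx
  exact ⟨_, hi⟩

theorem entries_tcons {l : ℕ} (a : α) (t : Fin l → α) :
    entries (tcons a t) = insert a (entries t) := by
  ext x
  simp [entries, tcons, Fin.exists_fin_succ, eq_comm]

namespace NbhdSys

variable (S : NbhdSys α V) (L B : Finset α)

/-- The neighbourhoods of zero among the cochains: on tuples `t` with entries in `L`, the value at
`t` is close to zero in the group of index `B ∪ t`. The set `B` of further indices is needed to
shorten tuples by removing a fixed entry. -/
def cochainNhd (l : ℕ) : Filter ((Fin l → α) → V) :=
  ⨅ t : {t : Fin l → α // entries t ⊆ L}, comap (fun c => c t.1) (S.nhd (B ∪ entries t.1))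

variable {S L B}

theorem tendsto_eval {l : ℕ} {t : Fin l → α} (ht : entries t ⊆ L) :
    Tendsto (fun c : (Fin l → α) → V => c t) (S.cochainNhd L B l) (S.nhd (B ∪ entries t)) :=
  tendsto_iff_comap.2 (iInf_le _ (⟨t, ht⟩ : {t : Fin l → α // entries t ⊆ L}))

theorem tendsto_cochainNhd {X : Type*} {F : Filter X} {l : ℕ} {g : X → (Fin l → α) → V}
    (h : ∀ t, entries t ⊆ L → Tendsto (fun x => g x t) F (S.nhd (B ∪ entries t))) :
    Tendsto g F (S.cochainNhd L B l) :=
  tendsto_iInf.2 fun t => tendsto_comap_iff.2 (h t.1 t.2)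

theorem tendsto_cobd (l : ℕ) :
    Tendsto (cobd (l := l)) (S.cochainNhd L B l) (S.cochainNhd L B (l + 1)) := by
  refine tendsto_cochainNhd fun t ht => tendsto_sum _ fun k _ => ?_
  have h1 : Tendsto (fun c : (Fin l → α) → V => c (fun i => t (k.succAbove i)))
      (S.cochainNhd L B l) (S.nhd (B ∪ entries t)) :=
    (tendsto_eval ((entries_face t k).trans ht)).mono_right
      (S.mono (Finset.union_subset_union_right (entries_face t k)))
  rcases neg_one_pow_eq_or ℤ (k : ℕ) with h | h
  · simpa [h] using h1
  · simpa [h] using tendsto_neg' h1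

/-- On tuples of length at least the number of indices, every cocycle is a coboundary, by an
operator that only restricts and combines values and so is continuous at zero. -/
theorem exists_contraction (S : NbhdSys α V) (L : Finset α) : ∀ (B : Finset α) (l : ℕ),
    L.card ≤ l → ∃ b : ((Fin (l + 1) → α) → V) → ((Fin l → α) → V),
      Tendsto b (S.cochainNhd L B (l + 1)) (S.cochainNhd L B l) ∧
      ∀ c, (∀ t, entries t ⊆ L → cobd c t = 0) → ∀ t, entries t ⊆ L → cobd (b c) t = c t := by
  classical
  induction L using Finset.induction_on with
  | empty =>
    refine fun B l _ => ⟨fun _ => 0, tendsto_cochainNhd fun t _ => tendsto_zero, ?_⟩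
    intro c _ t ht
    have : t 0 ∈ entries t := Finset.mem_image_of_mem _ (Finset.mem_univ 0)
    exact absurd (ht this) (Finset.notMem_empty _)
  | insert a L ha ih =>
    intro B l hl
    rw [Finset.card_insert_of_notMem ha] at hl
    obtain ⟨l, rfl⟩ : ∃ m, l = m + 1 := ⟨l - 1, by omega⟩
    obtain ⟨f, hf, hf'⟩ := ih B (l + 1) (by omega)
    obtain ⟨g, hg, hg'⟩ := ih (insert a B) l (by omega)
    -- first make the cochain vanish on the tuples avoiding `a`
    let b₁ : ((Fin (l + 2) → α) → V) → ((Fin (l + 1) → α) → V) := fun c t =>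
      if entries t ⊆ L then f c t else 0
    let c₁ : ((Fin (l + 2) → α) → V) → ((Fin (l + 2) → α) → V) := fun c => c - cobd (b₁ c)
    -- then on the tuples in which `a` occurs only in front
    let b₂ : ((Fin (l + 2) → α) → V) → ((Fin (l + 1) → α) → V) := fun c t =>
      if t 0 = a ∧ entries (fun i : Fin l => t i.succ) ⊆ L then
        g (fun s => c₁ c (tcons a s)) (fun i => t i.succ) else 0
    let c₂ : ((Fin (l + 2) → α) → V) → ((Fin (l + 2) → α) → V) := fun c => c₁ c + cobd (b₂ c)
    -- `a` can now be prepended: this stays within the index set of a tuple containing `a`, and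
    -- nothing is needed on the tuples avoiding `a`
    let b₃ : ((Fin (l + 2) → α) → V) → ((Fin (l + 1) → α) → V) := fun c t =>
      if a ∈ entries t then c₂ c (tcons a t) else 0
    have hL : L ⊆ insert a L := Finset.subset_insert a L
    have hres : ∀ m, S.cochainNhd (insert a L) B m ≤ S.cochainNhd L B m := fun m =>
      tendsto_cochainNhd fun t ht => tendsto_eval (ht.trans hL)
    have hb₁ : Tendsto b₁ (S.cochainNhd (insert a L) B (l + 2))
        (S.cochainNhd (insert a L) B (l + 1)) := by
      refine tendsto_cochainNhd fun t ht => ?_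
      by_cases h : entries t ⊆ L
      · simp only [b₁, h, if_true]
        exact (tendsto_eval h).comp (hf.mono_left (hres _))
      · simp only [b₁, h, if_false]
        exact tendsto_zero
    have hc₁ : Tendsto c₁ (S.cochainNhd (insert a L) B (l + 2))
        (S.cochainNhd (insert a L) B (l + 2)) :=
      tendsto_cochainNhd fun t ht => tendsto_sub' (tendsto_eval ht)
        ((tendsto_eval ht).comp ((tendsto_cobd _).comp hb₁))
    have hb₂ : Tendsto b₂ (S.cochainNhd (insert a L) B (l + 2))
        (S.cochainNhd (insert a L) B (l + 1)) := by
      refine tendsto_cochainNhd fun t ht => ?_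
      by_cases h : t 0 = a ∧ entries (fun i : Fin l => t i.succ) ⊆ L
      · simp only [b₂, h, and_self, if_true]
        have h1 : Tendsto (fun c => fun s : Fin (l + 1) → α => c₁ c (tcons a s))
            (S.cochainNhd (insert a L) B (l + 2)) (S.cochainNhd L (insert a B) (l + 1)) := by
          refine tendsto_cochainNhd fun s hs => ?_
          have h2 : entries (tcons a s) ⊆ insert a L := by
            rw [entries_tcons]
            exact Finset.insert_subset_insert a hs
          refine ((tendsto_eval h2).comp hc₁).mono_right (S.mono ?_)
          rw [entries_tcons, Finset.union_insert, Finset.insert_union]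
        refine ((tendsto_eval h.2).comp (hg.comp h1)).mono_right (S.mono ?_)
        have h3 : t = tcons a (fun i => t i.succ) := by
          rw [← h.1]
          exact (Fin.cons_self_tail t).symm
        conv_rhs => rw [h3, entries_tcons]
        rw [Finset.union_insert, Finset.insert_union]
      · simp only [b₂, h, if_false]
        exact tendsto_zero
    have hc₂ : Tendsto c₂ (S.cochainNhd (insert a L) B (l + 2))
        (S.cochainNhd (insert a L) B (l + 2)) :=
      tendsto_cochainNhd fun t ht => tendsto_add' ((tendsto_eval ht).comp hc₁)
        ((tendsto_eval ht).comp ((tendsto_cobd _).comp hb₂))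
    have hb₃ : Tendsto b₃ (S.cochainNhd (insert a L) B (l + 2))
        (S.cochainNhd (insert a L) B (l + 1)) := by
      refine tendsto_cochainNhd fun t ht => ?_
      by_cases h : a ∈ entries t
      · simp only [b₃, h, if_true]
        have h1 : entries (tcons a t) = entries t := by
          rw [entries_tcons, Finset.insert_eq_self.2 h]
        have h2 := (tendsto_eval (S := S) (B := B) (h1.subset.trans ht)).comp hc₂
        rwa [h1] at h2
      · simp only [b₃, h, if_false]
        exact tendsto_zero
    refine ⟨fun c => b₁ c - b₂ c + b₃ c, ?_, ?_⟩
    · exact tendsto_cochainNhd fun t ht => tendsto_add' (tendsto_sub'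
        ((tendsto_eval ht).comp hb₁) ((tendsto_eval ht).comp hb₂)) ((tendsto_eval ht).comp hb₃)
    · intro c hc t ht
      have hc₁L : ∀ s, entries s ⊆ L → c₁ c s = 0 := by
        intro s hs
        have h1 : cobd (b₁ c) s = cobd (f c) s := by
          refine Finset.sum_congr rfl fun k _ => ?_
          simp only [b₁, (entries_face s k).trans hs, if_true]
        simp only [c₁, Pi.sub_apply, h1, hf' c (fun t ht => hc t (ht.trans hL)) s hs, sub_self]
      have hdc₁ : ∀ s, entries s ⊆ insert a L → cobd (c₁ c) s = 0 := by
        intro s hs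
        simp only [c₁, cobd_sub, cobd_cobd, sub_zero, hc s hs]
      have hpc₁ : ∀ s : Fin (l + 2) → α, entries s ⊆ L →
          cobd (fun s => c₁ c (tcons a s)) s = 0 := by
        intro s hs
        have h1 := hdc₁ (tcons a s) (by
          rw [entries_tcons]
          exact Finset.insert_subset_insert a hs)
        rw [cobd_tcons, hc₁L s hs, zero_sub, neg_eq_zero] at h1
        exact h1
      have hc₂L : ∀ s : Fin (l + 1) → α, entries s ⊆ L → c₂ c (tcons a s) = 0 := by
        intro s hs
        have h0 : s 0 ≠ a := by
          rintro h
          exact ha (h ▸ hs (Finset.mem_image_of_mem _ (Finset.mem_univ 0)))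
        have h1 : cobd (fun s => b₂ c (tcons a s)) s =
            cobd (g (fun s => c₁ c (tcons a s))) s := by
          refine Finset.sum_congr rfl fun k _ => ?_
          have h2 := (entries_face s k).trans hs
          simp only [b₂, tcons, Fin.cons_zero, Fin.cons_succ, true_and, h2, if_true]
        simp only [c₂, Pi.add_apply, cobd_tcons, h1, hg' _ hpc₁ s hs]
        simp [b₂, h0]
      have hdc₂ : cobd (c₂ c) (tcons a t) = 0 := by
        simp only [c₂, cobd_add, cobd_cobd, add_zero]
        refine hdc₁ _ ?_
        rw [entries_tcons]
        exact Finset.insert_subset (Finset.mem_insert_self a L) ht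
      have hb₃c : cobd (b₃ c) t = cobd (fun s => c₂ c (tcons a s)) t := by
        refine Finset.sum_congr rfl fun k _ => ?_
        by_cases h : a ∈ entries (fun i => t (k.succAbove i))
        · simp only [b₃, h, if_true]
        · have h1 : entries (fun i => t (k.succAbove i)) ⊆ L :=
            (Finset.subset_insert_iff_of_notMem h).1 ((entries_face t k).trans ht)
          simp only [b₃, h, if_false, hc₂L _ h1]
      rw [cobd_tcons, sub_eq_zero] at hdc₂
      simp only [cobd_add, cobd_sub, Pi.add_apply, Pi.sub_apply, hb₃c]
      rw [← hdc₂]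
      simp only [c₂, c₁, Pi.add_apply, Pi.sub_apply]
      abel

end NbhdSys
end NbhdSys

/-! ### The canonical topology -/

section CanonicalTopology

variable (K : Type u) [NontriviallyNormedField K] [IsUltrametricDist K] (ι : Type) (ρ : ℝ≥0)

instance : IsTopologicalRing (Tate K ι ρ) :=
  letI := (Tate.gaussSeminorm K ι ρ).toSeminormedRing
  inferInstanceAs (@IsTopologicalRing (Tate K ι ρ) _ _)

theorem Tate.nhds_zero_hasBasis :
    (𝓝 (0 : Tate K ι ρ)).HasBasis (fun δ : ℝ => 0 < δ) fun δ =>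
      {f | Tate.gaussSeminorm K ι ρ f < δ} := by
  let _ := (Tate.gaussSeminorm K ι ρ).toSeminormedRing
  refine (Metric.nhds_basis_ball (x := (0 : Tate K ι ρ))).congr (fun _ => Iff.rfl) fun δ _ => ?_
  ext f
  rw [mem_ball_zero_iff]
  rfl

variable {K ι}

/-- The polynomials of Gauss norm less than `δ`. -/
def gaussBall (δ : ℝ) : Set (MvPolynomial ι K) :=
  {p | ∀ μ, ‖p.coeff μ‖ * (ρ : ℝ) ^ μ.degree < δ}

variable {ρ}

theorem Tate.gaussSeminorm_apply (f : Tate K ι ρ) : Tate.gaussSeminorm K ι ρ f =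
    ⨆ μ, ‖MvPowerSeries.coeff μ f.toSeries‖ * (ρ : ℝ) ^ μ.degree := by
  change MvPowerSeries.gaussNorm _ _ _ = _
  simp only [MvPowerSeries.gaussNorm, Finsupp.prod, Finset.prod_pow_eq_pow_sum, Finsupp.degree]
  rfl

theorem Tate.le_gaussSeminorm (f : Tate K ι ρ) (μ : ι →₀ ℕ) :
    ‖MvPowerSeries.coeff μ f.toSeries‖ * (ρ : ℝ) ^ μ.degree ≤ Tate.gaussSeminorm K ι ρ f := by
  have h := MvPowerSeries.le_gaussNorm _ _ _ (Tate.hasGaussNorm K ι ρ f) μ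
  rw [Finsupp.prod, Finset.prod_pow_eq_pow_sum] at h
  exact h

theorem Tate.gaussSeminorm_le {f : Tate K ι ρ} {δ : ℝ}
    (h : ∀ μ, ‖MvPowerSeries.coeff μ f.toSeries‖ * (ρ : ℝ) ^ μ.degree ≤ δ) :
    Tate.gaussSeminorm K ι ρ f ≤ δ := by
  rw [Tate.gaussSeminorm_apply]
  exact ciSup_le h

theorem coeff_polyToTate (p : MvPolynomial ι K) (μ : ι →₀ ℕ) :
    MvPowerSeries.coeff μ (polyToTate K ι ρ p).toSeries = p.coeff μ :=
  MvPolynomial.coeff_coe p μ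

/-- The polynomials are dense in the Tate algebra. -/
theorem Tate.exists_poly (f : Tate K ι ρ) {δ : ℝ} (hδ : 0 < δ) :
    ∃ p : MvPolynomial ι K, Tate.gaussSeminorm K ι ρ (f - polyToTate K ι ρ p) < δ := by
  classical
  have hf : MvPowerSeries.IsRestricted (fun _ : ι => (ρ : ℝ)) f.toSeries := Subtype.property f
  have h1 := (hf.eventually (gt_mem_nhds (half_pos hδ)))
  rw [Filter.eventually_cofinite] at h1
  refine ⟨∑ μ ∈ h1.toFinset, MvPolynomial.monomial μ (MvPowerSeries.coeff μ f.toSeries), ?_⟩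
  refine (Tate.gaussSeminorm_le (δ := δ / 2) fun μ => ?_).trans_lt (half_lt_self hδ)
  have h2 : MvPowerSeries.coeff μ (f - polyToTate K ι ρ (∑ μ ∈ h1.toFinset,
      MvPolynomial.monomial μ (MvPowerSeries.coeff μ f.toSeries))).toSeries =
      if μ ∈ h1.toFinset then 0 else MvPowerSeries.coeff μ f.toSeries := by
    have h3 : MvPowerSeries.coeff μ (f - polyToTate K ι ρ (∑ μ ∈ h1.toFinset,
      MvPolynomial.monomial μ (MvPowerSeries.coeff μ f.toSeries))).toSeries =
      MvPowerSeries.coeff μ f.toSeries - MvPowerSeries.coeff μ (polyToTate K ι ρ (∑ μ ∈ h1.toFinset,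
      MvPolynomial.monomial μ (MvPowerSeries.coeff μ f.toSeries))).toSeries := map_sub _ _ _
    rw [h3, coeff_polyToTate, MvPolynomial.coeff_sum]
    simp only [MvPolynomial.coeff_monomial, Finset.sum_ite_eq']
    split_ifs <;> simp
  rw [h2]
  split_ifs with h
  · simp only [norm_zero, zero_mul]
    positivity
  · rw [Set.Finite.mem_toFinset, Set.mem_ofPred_eq, not_not] at h
    rw [Finsupp.prod, Finset.prod_pow_eq_pow_sum] at h
    exact h.le

theorem gaussSeminorm_polyToTate_lt_imp {p : MvPolynomial ι K} {δ : ℝ}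
    (h : Tate.gaussSeminorm K ι ρ (polyToTate K ι ρ p) < δ) : p ∈ gaussBall ρ δ := fun μ => by
  rw [← coeff_polyToTate (ρ := ρ)]
  exact (Tate.le_gaussSeminorm _ μ).trans_lt h

theorem gaussSeminorm_polyToTate_le {p : MvPolynomial ι K} {δ : ℝ} (h : p ∈ gaussBall ρ δ) :
    Tate.gaussSeminorm K ι ρ (polyToTate K ι ρ p) ≤ δ :=
  Tate.gaussSeminorm_le fun μ => by
    rw [coeff_polyToTate]
    exact (h μ).le

variable (K ι ρ)
variable (S : Type*) [AddCommGroup S] [Module (MvPolynomial ι K) S]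

/-- The topology induced on a module over a polynomial ring by the canonical topology of its base
change to the Tate algebra. -/
abbrev canTop : TopologicalSpace S :=
  TopologicalSpace.induced (fun s => (1 : Tate K ι ρ) ⊗ₜ[MvPolynomial ι K] s)
    (moduleTopology (Tate K ι ρ) (Tate K ι ρ ⊗[MvPolynomial ι K] S))

theorem isTopologicalAddGroup_canTop : @IsTopologicalAddGroup S (canTop K ι ρ S) _ := by
  let _ := moduleTopology (Tate K ι ρ) (Tate K ι ρ ⊗[MvPolynomial ι K] S)
  have : IsModuleTopology (Tate K ι ρ) (Tate K ι ρ ⊗[MvPolynomial ι K] S) := ⟨rfl⟩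
  have := IsModuleTopology.topologicalAddGroup (R := Tate K ι ρ)
    (Tate K ι ρ ⊗[MvPolynomial ι K] S)
  exact topologicalAddGroup_induced (TensorProduct.mk (MvPolynomial ι K) (Tate K ι ρ) S 1)

/-- The filter of neighbourhoods of zero for `canTop`. -/
def canNhd : Filter S := @nhds S (canTop K ι ρ S) 0

variable {S} {S' : Type*} [AddCommGroup S'] [Module (MvPolynomial ι K) S']

theorem continuous_canTop (f : S →ₗ[MvPolynomial ι K] S') :
    @Continuous S S' (canTop K ι ρ S) (canTop K ι ρ S') f := by
  let _ := moduleTopology (Tate K ι ρ) (Tate K ι ρ ⊗[MvPolynomial ι K] S)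
  have : IsModuleTopology (Tate K ι ρ) (Tate K ι ρ ⊗[MvPolynomial ι K] S) := ⟨rfl⟩
  let _ := moduleTopology (Tate K ι ρ) (Tate K ι ρ ⊗[MvPolynomial ι K] S')
  have : IsModuleTopology (Tate K ι ρ) (Tate K ι ρ ⊗[MvPolynomial ι K] S') := ⟨rfl⟩
  have := IsModuleTopology.toContinuousAdd (Tate K ι ρ) (Tate K ι ρ ⊗[MvPolynomial ι K] S')
  let _ := canTop K ι ρ S
  refine continuous_induced_rng.2 ?_
  have h1 := IsModuleTopology.continuous_of_linearMap (R := Tate K ι ρ) (f.baseChange (Tate K ι ρ))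
  have h2 := h1.comp (continuous_induced_dom
    (f := fun s : S => (1 : Tate K ι ρ) ⊗ₜ[MvPolynomial ι K] s))
  refine h2.congr fun s => ?_
  simp

theorem tendsto_canNhd (f : S →ₗ[MvPolynomial ι K] S') :
    Filter.Tendsto f (canNhd K ι ρ S) (canNhd K ι ρ S') := by
  let _ := canTop K ι ρ S
  let _ := canTop K ι ρ S'
  simpa [canNhd] using (continuous_canTop K ι ρ f).tendsto 0

variable {K ι ρ}

/-- The kernel of the base change to the Tate algebra of a cyclic module lies in the closure of the
ideal of relations of its generator. -/
theorem exists_relation_near (s₀ : S) {t : Tate K ι ρ}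
    (ht : t ⊗ₜ[MvPolynomial ι K] s₀ = 0) (hs₀ : ∀ s : S, ∃ p : MvPolynomial ι K, p • s₀ = s)
    {δ : ℝ} (hδ : 0 < δ) :
    ∃ a : MvPolynomial ι K, a • s₀ = 0 ∧ Tate.gaussSeminorm K ι ρ (t - polyToTate K ι ρ a) < δ := by
  let g : MvPolynomial ι K →ₗ[MvPolynomial ι K] S := LinearMap.toSpanSingleton _ S s₀
  have hex := lTensor_exact (Tate K ι ρ) (f := (LinearMap.ker g).subtype) (g := g)
    (LinearMap.exact_subtype_ker_map g) hs₀
  have h1 : g.lTensor (Tate K ι ρ) (t ⊗ₜ 1) = 0 := by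
    simpa [g] using ht
  obtain ⟨x, hx⟩ := (hex _).1 h1
  have h2 : ∀ x : Tate K ι ρ ⊗[MvPolynomial ι K] LinearMap.ker g, ∀ δ : ℝ, 0 < δ →
      ∃ a : MvPolynomial ι K, a • s₀ = 0 ∧ Tate.gaussSeminorm K ι ρ (TensorProduct.rid _ _
        ((LinearMap.ker g).subtype.lTensor (Tate K ι ρ) x) - polyToTate K ι ρ a) < δ := by
    intro x
    induction x with
    | zero => exact fun δ hδ => ⟨0, zero_smul _ _, by simpa using hδ⟩
    | add x y hx hy =>
      intro δ hδ
      obtain ⟨a, ha, ha'⟩ := hx (δ / 2) (half_pos hδ)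
      obtain ⟨b, hb, hb'⟩ := hy (δ / 2) (half_pos hδ)
      refine ⟨a + b, by rw [add_smul, ha, hb, add_zero], ?_⟩
      rw [map_add, map_add, map_add, add_sub_add_comm]
      exact (map_add_le_add _ _ _).trans_lt (by linarith)
    | tmul u a =>
      intro δ hδ
      obtain ⟨a, ha⟩ := a
      have ha0 : 0 < Tate.gaussSeminorm K ι ρ (polyToTate K ι ρ a) + 1 := by
        have := apply_nonneg (Tate.gaussSeminorm K ι ρ) (polyToTate K ι ρ a)
        linarith
      obtain ⟨q, hq⟩ := Tate.exists_poly u (div_pos hδ ha0)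
      refine ⟨a * q, ?_, ?_⟩
      · rw [mul_comm, mul_smul]
        have : a • s₀ = 0 := ha
        rw [this, smul_zero]
      · have h3 : TensorProduct.rid (MvPolynomial ι K) (Tate K ι ρ)
            ((LinearMap.ker g).subtype.lTensor (Tate K ι ρ) (u ⊗ₜ ⟨a, ha⟩)) -
            polyToTate K ι ρ (a * q) = (u - polyToTate K ι ρ q) * polyToTate K ι ρ a := by
          rw [LinearMap.lTensor_tmul, TensorProduct.rid_tmul, map_mul, Algebra.smul_def]
          change polyToTate K ι ρ a * u - _ = _
          ring
        rw [h3]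
        refine (map_mul_le_mul _ _ _).trans_lt ?_
        rw [lt_div_iff₀ ha0] at hq
        refine lt_of_le_of_lt ?_ hq
        exact mul_le_mul_of_nonneg_left (by linarith) (apply_nonneg _ _)
  obtain ⟨a, ha, ha'⟩ := h2 x δ hδ
  rw [hx, TensorProduct.rid_tmul, one_smul] at ha'
  exact ⟨a, ha, ha'⟩

/-- For a cyclic module the canonical topology is the quotient topology of the Gauss norm on
polynomials: an element of the module close to zero lifts to a small element of the Tate algebra,
which a small change makes a polynomial lift. -/
theorem mem_canNhd_iff_of_surjective (s₀ : S)
    (hs₀ : ∀ s : S, ∃ p : MvPolynomial ι K, p • s₀ = s) {U : Set S} :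
    U ∈ canNhd K ι ρ S ↔ ∃ δ : ℝ, 0 < δ ∧ ∀ p ∈ gaussBall (K := K) (ι := ι) ρ δ, p • s₀ ∈ U := by
  let _ := moduleTopology (Tate K ι ρ) (Tate K ι ρ ⊗[MvPolynomial ι K] S)
  have : IsModuleTopology (Tate K ι ρ) (Tate K ι ρ ⊗[MvPolynomial ι K] S) := ⟨rfl⟩
  have := IsModuleTopology.topologicalAddGroup (R := Tate K ι ρ)
    (Tate K ι ρ ⊗[MvPolynomial ι K] S)
  let g : Tate K ι ρ →ₗ[Tate K ι ρ] Tate K ι ρ ⊗[MvPolynomial ι K] S :=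
    LinearMap.toSpanSingleton _ _ (1 ⊗ₜ s₀)
  have hg : ∀ t, g t = t ⊗ₜ s₀ := fun t => by simp [g, TensorProduct.smul_tmul']
  have hgp : ∀ p, g (polyToTate K ι ρ p) = 1 ⊗ₜ (p • s₀) := fun p => by
    rw [hg, TensorProduct.tmul_smul, TensorProduct.smul_tmul', Algebra.smul_def, mul_one]
    rfl
  have hgs : Function.Surjective g := by
    intro x
    induction x with
    | zero => exact ⟨0, map_zero g⟩
    | add x y hx hy =>
      obtain ⟨a, rfl⟩ := hx
      obtain ⟨b, rfl⟩ := hy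
      exact ⟨a + b, map_add g a b⟩
    | tmul t s =>
      obtain ⟨p, rfl⟩ := hs₀ s
      refine ⟨p • t, ?_⟩
      rw [hg, TensorProduct.tmul_smul, TensorProduct.smul_tmul']
  have hgc : Continuous g := IsModuleTopology.continuous_of_linearMap g
  have hgo : IsOpenMap g := IsModuleTopology.isOpenMap_of_surjective hgs
  have hU : U ∈ canNhd K ι ρ S ↔ U ∈ Filter.comap (fun s => (1 : Tate K ι ρ) ⊗ₜ s)
      (𝓝 (0 : Tate K ι ρ ⊗[MvPolynomial ι K] S)) := by
    rw [canNhd, nhds_induced, TensorProduct.tmul_zero]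
  rw [hU, Filter.mem_comap]
  constructor
  · rintro ⟨N, hN, hNU⟩
    have h1 : g ⁻¹' N ∈ 𝓝 (0 : Tate K ι ρ) := hgc.tendsto 0 (by rwa [map_zero])
    obtain ⟨δ, hδ, hδN⟩ := (Tate.nhds_zero_hasBasis K ι ρ).mem_iff.1 h1
    refine ⟨δ / 2, half_pos hδ, fun p hp => hNU ?_⟩
    have h2 : polyToTate K ι ρ p ∈ g ⁻¹' N :=
      hδN ((gaussSeminorm_polyToTate_le hp).trans_lt (half_lt_self hδ))
    rwa [Set.mem_preimage, hgp] at h2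
  · rintro ⟨δ, hδ, h⟩
    refine ⟨g '' {t | Tate.gaussSeminorm K ι ρ t < δ / 2}, ?_, ?_⟩
    · have h1 := hgo.image_mem_nhds
        ((Tate.nhds_zero_hasBasis K ι ρ).mem_of_mem (half_pos hδ))
      rwa [map_zero] at h1
    · rintro s ⟨t, ht, hts⟩
      obtain ⟨p, rfl⟩ := hs₀ s
      have h1 : (t - polyToTate K ι ρ p) ⊗ₜ[MvPolynomial ι K] s₀ = 0 := by
        rw [← hg, map_sub, hts, hgp, sub_self]
      obtain ⟨a, ha, ha'⟩ := exists_relation_near s₀ h1 hs₀ (half_pos hδ)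
      have h2 : Tate.gaussSeminorm K ι ρ (polyToTate K ι ρ (p + a)) < δ := by
        have h3 : polyToTate K ι ρ (p + a) =
            t - (t - polyToTate K ι ρ p - polyToTate K ι ρ a) := by
          rw [map_add]
          abel
        rw [h3]
        have ht' : Tate.gaussSeminorm K ι ρ t < δ / 2 := ht
        exact (map_sub_le_add _ _ _).trans_lt (by linarith)
      have h4 := h _ (gaussSeminorm_polyToTate_lt_imp h2)
      rwa [add_smul, ha, add_zero] at h4

end CanonicalTopology

/-! ### Laurent polynomials -/

section Laurent

open Filter

variable (K : Type u) [Field K] (σ : Type) [Fintype σ]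

/-- Laurent polynomials in the variables `x_j`, `j ∈ σ`. -/
abbrev Laurent : Type u := AddMonoidAlgebra K (σ → ℤ)

variable {σ}

/-- The total order of the poles of the monomial `x^ν` along the coordinate hyperplanes. -/
def poleDeg (ν : σ → ℤ) : ℕ := ∑ j, (-ν j).toNat

theorem poleDeg_add_le (μ ν : σ → ℤ) : poleDeg (μ + ν) ≤ poleDeg μ + poleDeg ν := by
  rw [poleDeg, poleDeg, poleDeg, ← Finset.sum_add_distrib]
  refine Finset.sum_le_sum fun j _ => ?_
  rw [Pi.add_apply]
  omega

/-- The homogeneous Laurent polynomials of degree `N` whose poles lie on the hyperplanes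
`x_i = 0` with `i ∈ I`, i.e. the sections of `𝒪(N)` on `U_I`. -/
def twist (N : ℤ) (I : Finset σ) : Submodule K (Laurent K σ) where
  carrier := {f | ∀ ν, f.coeff ν ≠ 0 → ∑ j, ν j = N ∧ ∀ j ∉ I, 0 ≤ ν j}
  zero_mem' ν h := absurd rfl h
  add_mem' {f g} hf hg ν h := by
    rw [AddMonoidAlgebra.coeff_add, Finsupp.add_apply] at h
    by_cases h1 : f.coeff ν = 0
    · exact hg ν fun h2 => h (by rw [h1, h2, add_zero])
    · exact hf ν h1
  smul_mem' a f hf ν h := hf ν fun h1 => h (by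
    rw [AddMonoidAlgebra.coeff_smul_apply, h1, smul_zero])

variable {K}

theorem twist_mono {N : ℤ} {I J : Finset σ} (h : I ⊆ J) : twist K N I ≤ twist K N J :=
  fun _ hf ν hν => ⟨(hf ν hν).1, fun j hj => (hf ν hν).2 j fun h' => hj (h h')⟩

theorem exists_coeff_of_mul {f g : Laurent K σ} {ν : σ → ℤ} (h : (f * g).coeff ν ≠ 0) :
    ∃ μ κ, f.coeff μ ≠ 0 ∧ g.coeff κ ≠ 0 ∧ μ + κ = ν := by
  classical
  rw [AddMonoidAlgebra.coeff_mul] at h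
  by_contra! hcon
  refine h (Finset.sum_eq_zero fun μ hμ => Finset.sum_eq_zero fun κ hκ => if_neg ?_)
  exact hcon μ κ (Finsupp.mem_support_iff.1 hμ) (Finsupp.mem_support_iff.1 hκ)

theorem mul_mem_twist [DecidableEq σ] {N N' : ℤ} {I J : Finset σ} {f g : Laurent K σ}
    (hf : f ∈ twist K N I) (hg : g ∈ twist K N' J) : f * g ∈ twist K (N + N') (I ∪ J) := by
  intro ν hν
  obtain ⟨μ, κ, h1, h2, rfl⟩ := exists_coeff_of_mul hν
  refine ⟨?_, fun j hj => ?_⟩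
  · simp only [Pi.add_apply, Finset.sum_add_distrib, (hf μ h1).1, (hg κ h2).1]
  · rw [Finset.mem_union, not_or] at hj
    exact add_nonneg ((hf μ h1).2 j hj.1) ((hg κ h2).2 j hj.2)

theorem single_mem_twist {N : ℤ} {I : Finset σ} {ν : σ → ℤ} (h1 : ∑ j, ν j = N)
    (h2 : ∀ j ∉ I, 0 ≤ ν j) (a : K) : AddMonoidAlgebra.single ν a ∈ twist K N I := by
  classical
  intro μ hμ
  rw [AddMonoidAlgebra.coeff_single, Finsupp.single_apply] at hμ
  split_ifs at hμ with h
  · exact h ▸ ⟨h1, h2⟩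
  · exact absurd rfl hμ

theorem one_mem_twist (I : Finset σ) : (1 : Laurent K σ) ∈ twist K 0 I :=
  single_mem_twist (by simp) (fun _ _ => le_rfl) 1

variable (K) in
/-- The Laurent monomial `x_i^N`. -/
def xpow [DecidableEq σ] (i : σ) (N : ℤ) : Laurent K σ := AddMonoidAlgebra.single (Pi.single i N) 1

section xpow

variable [DecidableEq σ]

theorem xpow_mem_twist (i : σ) (N : ℤ) {I : Finset σ} (hi : i ∈ I) : xpow K i N ∈ twist K N I := by
  refine single_mem_twist (by simp) (fun j hj => ?_) 1
  rw [Pi.single_eq_of_ne fun h => hj (by rwa [h])]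

theorem xpow_mul_xpow (i : σ) (N N' : ℤ) : xpow K i N * xpow K i N' = xpow K i (N + N') := by
  rw [xpow, xpow, AddMonoidAlgebra.single_mul_single, ← Pi.single_add, mul_one, xpow]

theorem xpow_zero (i : σ) : xpow K i 0 = 1 := by
  rw [xpow, Pi.single_zero]
  rfl

theorem xpow_mul_xpow_neg (i : σ) (N : ℤ) : xpow K i N * xpow K i (-N) = 1 := by
  rw [xpow_mul_xpow, add_neg_cancel, xpow_zero]

theorem xpow_neg_mul_xpow (i : σ) (N : ℤ) : xpow K i (-N) * xpow K i N = 1 := by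
  rw [mul_comm, xpow_mul_xpow_neg]

/-- A high power of `x_i` cancels the pole along `x_i = 0`. -/
theorem exists_xpow_mul_mem_twist (i : σ) {I : Finset σ} {f : Laurent K σ}
    (hf : f ∈ twist K 0 (insert i I)) :
    ∃ N₀ : ℕ, ∀ N : ℕ, N₀ ≤ N → xpow K i N * f ∈ twist K N I := by
  refine ⟨f.coeff.support.sup fun ν => (-ν i).toNat, fun N hN ν hν => ?_⟩
  obtain ⟨μ, κ, h1, h2, rfl⟩ := exists_coeff_of_mul hν
  have h3 : Pi.single i (N : ℤ) = μ := by
    rw [xpow, AddMonoidAlgebra.coeff_single, Finsupp.single_apply] at h1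
    by_contra h
    exact h1 (if_neg h)
  subst h3
  refine ⟨by simp [Finset.sum_add_distrib, (hf κ h2).1], fun j hj => ?_⟩
  by_cases hji : j = i
  · subst hji
    have h4 : (-κ j).toNat ≤ N := (Finset.le_sup (f := fun ν : σ → ℤ => (-ν j).toNat)
      (Finsupp.mem_support_iff.2 h2)).trans hN
    rw [Pi.add_apply, Pi.single_eq_same]
    omega
  · rw [Pi.add_apply, Pi.single_eq_of_ne hji, zero_add]
    exact (hf κ h2).2 j (by simp [hji, hj])

end xpow

open Classical in
/-- The part of a Laurent polynomial supported in `s`. -/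
def monomialPart (s : Set (σ → ℤ)) : Laurent K σ →+ Laurent K σ :=
  AddMonoidAlgebra.coeffAddEquiv.symm.toAddMonoidHom.comp
    ((Finsupp.filterAddHom (M := K) (fun ν : σ → ℤ => ν ∈ s)).comp
      AddMonoidAlgebra.coeffAddEquiv.toAddMonoidHom)

theorem coeff_monomialPart (s : Set (σ → ℤ)) (f : Laurent K σ) (ν : σ → ℤ) [Decidable (ν ∈ s)] :
    (monomialPart s f).coeff ν = if ν ∈ s then f.coeff ν else 0 := by
  classical
  change Finsupp.filter (fun ν : σ → ℤ => ν ∈ s) f.coeff ν = _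
  rw [Finsupp.filter_apply]
  congr

end Laurent

section LaurentNhd

open Filter

variable (K : Type u) [NormedField K] [IsUltrametricDist K] {σ : Type} [Fintype σ] (ρ : ℝ≥0)

/-- The Laurent polynomials `∑ a_ν x^ν` with `|a_ν| ρ^{poleDeg ν} < δ` for all `ν`. -/
def laurentBall (δ : ℝ) : Set (Laurent K σ) :=
  {f | ∀ ν, ‖f.coeff ν‖ * (ρ : ℝ) ^ poleDeg ν < δ}

variable (σ) in
/-- The neighbourhoods of zero for the norm `max_ν |a_ν| ρ^{poleDeg ν}`. -/
def laurentNhd : Filter (Laurent K σ) := ⨅ δ : {δ : ℝ // 0 < δ}, 𝓟 (laurentBall K ρ δ)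

theorem laurentNhd_hasBasis :
    (laurentNhd K σ ρ).HasBasis (fun δ : ℝ => 0 < δ) (laurentBall K ρ) := by
  have : Nonempty {δ : ℝ // 0 < δ} := ⟨⟨1, one_pos⟩⟩
  have h := hasBasis_iInf_principal (s := fun δ : {δ : ℝ // 0 < δ} =>
    laurentBall K (σ := σ) ρ δ) (by
      intro a b
      refine ⟨⟨min a.1 b.1, lt_min a.2 b.2⟩, fun f hf ν => ?_, fun f hf ν => ?_⟩
      · exact (hf ν).trans_le (min_le_left _ _)
      · exact (hf ν).trans_le (min_le_right _ _))
  refine h.to_hasBasis (fun a _ => ⟨a.1, a.2, le_rfl⟩) fun δ hδ => ⟨⟨δ, hδ⟩, trivial, le_rfl⟩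

variable {K ρ}

theorem tendsto_add_laurentNhd : Tendsto (fun p : Laurent K σ × Laurent K σ => p.1 + p.2)
    (laurentNhd K σ ρ ×ˢ laurentNhd K σ ρ) (laurentNhd K σ ρ) := by
  refine (((laurentNhd_hasBasis K ρ).prod_self).tendsto_iff (laurentNhd_hasBasis K ρ)).2
    fun δ hδ => ⟨δ, hδ, fun p hp ν => ?_⟩
  have h1 := hp.1 ν
  have h2 := hp.2 ν
  refine lt_of_le_of_lt (mul_le_mul_of_nonneg_right
    (IsUltrametricDist.norm_add_le_max _ _) (by positivity)) ?_
  rw [max_mul_of_nonneg _ _ (by positivity)]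
  exact max_lt h1 h2

theorem tendsto_add_of_laurentNhd {X : Type*} {F : Filter X} {f g : X → Laurent K σ}
    (hf : Tendsto f F (laurentNhd K σ ρ)) (hg : Tendsto g F (laurentNhd K σ ρ)) :
    Tendsto (fun x => f x + g x) F (laurentNhd K σ ρ) :=
  Tendsto.comp (f := fun x => (f x, g x)) (g := fun p : Laurent K σ × Laurent K σ => p.1 + p.2)
    tendsto_add_laurentNhd (hf.prodMk hg)

theorem tendsto_neg_laurentNhd :
    Tendsto (fun f : Laurent K σ => -f) (laurentNhd K σ ρ) (laurentNhd K σ ρ) := by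
  refine ((laurentNhd_hasBasis K ρ).tendsto_iff (laurentNhd_hasBasis K ρ)).2
    fun δ hδ => ⟨δ, hδ, fun f hf ν => ?_⟩
  rw [AddMonoidAlgebra.coeff_neg, Finsupp.neg_apply, norm_neg]
  exact hf ν

theorem pure_le_laurentNhd : pure 0 ≤ laurentNhd K σ ρ := by
  refine (laurentNhd_hasBasis K ρ).ge_iff.2 fun δ hδ => ?_
  rw [mem_pure]
  intro ν
  simpa using hδ

theorem tendsto_monomialPart (s : Set (σ → ℤ)) :
    Tendsto (monomialPart s) (laurentNhd K σ ρ) (laurentNhd K σ ρ) := by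
  classical
  refine ((laurentNhd_hasBasis K ρ).tendsto_iff (laurentNhd_hasBasis K ρ)).2
    fun δ hδ => ⟨δ, hδ, fun f hf ν => ?_⟩
  rw [coeff_monomialPart]
  split_ifs
  · exact hf ν
  · simpa using hδ

theorem tendsto_coeff (hρ : 1 ≤ ρ) (ν : σ → ℤ) :
    Tendsto (fun f : Laurent K σ => f.coeff ν) (laurentNhd K σ ρ) (𝓝 0) := by
  refine ((laurentNhd_hasBasis K ρ).tendsto_iff Metric.nhds_basis_ball).2
    fun δ hδ => ⟨δ, hδ, fun f hf => ?_⟩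
  rw [mem_ball_zero_iff]
  refine lt_of_le_of_lt (le_mul_of_one_le_right (norm_nonneg _) ?_) (hf ν)
  exact one_le_pow₀ (by exact_mod_cast hρ)

/-- Multiplication by a fixed Laurent polynomial is continuous. -/
theorem tendsto_mul_laurentNhd (hρ : 1 ≤ ρ) (g : Laurent K σ) :
    Tendsto (fun f : Laurent K σ => f * g) (laurentNhd K σ ρ) (laurentNhd K σ ρ) := by
  induction g using AddMonoidAlgebra.induction_linear with
  | zero =>
    simp only [mul_zero]
    exact tendsto_const_pure.mono_right pure_le_laurentNhd
  | add g g' h h' =>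
    simp only [mul_add]
    exact tendsto_add_of_laurentNhd h h'
  | single κ a =>
    refine ((laurentNhd_hasBasis K ρ).tendsto_iff (laurentNhd_hasBasis K ρ)).2
      fun δ hδ => ?_
    have hρ' : (1 : ℝ) ≤ ρ := by exact_mod_cast hρ
    have hC : 0 < ‖a‖ * (ρ : ℝ) ^ poleDeg κ + 1 := by positivity
    refine ⟨δ / (‖a‖ * (ρ : ℝ) ^ poleDeg κ + 1), div_pos hδ hC, fun f hf ν => ?_⟩
    have h1 : (f * AddMonoidAlgebra.single κ a).coeff ν = f.coeff (ν - κ) * a := by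
      rw [AddMonoidAlgebra.coeff_mul_single_apply, sub_eq_add_neg]
    have h2 := hf (ν - κ)
    rw [lt_div_iff₀ hC] at h2
    rw [h1, norm_mul]
    have h3 : (ρ : ℝ) ^ poleDeg ν ≤ (ρ : ℝ) ^ poleDeg (ν - κ) * (ρ : ℝ) ^ poleDeg κ := by
      rw [← pow_add]
      refine pow_le_pow_right₀ hρ' ?_
      simpa using poleDeg_add_le (ν - κ) κ
    calc ‖f.coeff (ν - κ)‖ * ‖a‖ * (ρ : ℝ) ^ poleDeg ν
        ≤ ‖f.coeff (ν - κ)‖ * ‖a‖ * ((ρ : ℝ) ^ poleDeg (ν - κ) * (ρ : ℝ) ^ poleDeg κ) :=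
          mul_le_mul_of_nonneg_left h3 (by positivity)
      _ = ‖f.coeff (ν - κ)‖ * (ρ : ℝ) ^ poleDeg (ν - κ) * (‖a‖ * (ρ : ℝ) ^ poleDeg κ) := by ring
      _ ≤ ‖f.coeff (ν - κ)‖ * (ρ : ℝ) ^ poleDeg (ν - κ) * (‖a‖ * (ρ : ℝ) ^ poleDeg κ + 1) :=
          mul_le_mul_of_nonneg_left (by linarith) (by positivity)
      _ < δ := h2

theorem tendsto_smul_laurentNhd (hρ : 1 ≤ ρ) (e : Laurent K σ) :
    Tendsto (fun a : K => a • e) (𝓝 0) (laurentNhd K σ ρ) := by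
  have h1 : Tendsto (fun a : K => AddMonoidAlgebra.single (0 : σ → ℤ) a) (𝓝 0)
      (laurentNhd K σ ρ) := by
    classical
    refine (Metric.nhds_basis_ball.tendsto_iff (laurentNhd_hasBasis K ρ)).2
      fun δ hδ => ⟨δ, hδ, fun a ha ν => ?_⟩
    rw [mem_ball_zero_iff] at ha
    rw [AddMonoidAlgebra.coeff_single, Finsupp.single_apply]
    split_ifs with h
    · subst h
      simpa [poleDeg] using ha
    · simpa using hδ
  refine ((tendsto_mul_laurentNhd hρ e).comp h1).congr fun a => ?_
  rw [Algebra.smul_def]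
  rfl

end LaurentNhd

/-! ### Functions on the standard open sets -/

section Coordinates

open Filter

variable {d : ℕ}

/-- The exponent of the Laurent monomial obtained from a monomial in the coordinates
`T_{(j,i)} = x_j / x_i`. -/
def weight {I : Finset (Fin (d + 1))} (μ : CoordIdx I →₀ ℕ) : Fin (d + 1) → ℤ :=
  ∑ p, μ p • (Pi.single p.1.1 1 - Pi.single p.1.2 1)

theorem weight_add {I : Finset (Fin (d + 1))} (μ κ : CoordIdx I →₀ ℕ) :
    weight (μ + κ) = weight μ + weight κ := by
  simp only [weight, Finsupp.add_apply, add_smul, Finset.sum_add_distrib]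

theorem weight_single {I : Finset (Fin (d + 1))} (p : CoordIdx I) :
    weight (Finsupp.single p 1) = Pi.single p.1.1 1 - Pi.single p.1.2 1 := by
  classical
  rw [weight, Finset.sum_eq_single p]
  · simp
  · intro q _ hq
    rw [Finsupp.single_eq_of_ne hq, zero_smul]
  · exact fun h => absurd (Finset.mem_univ p) h

theorem weight_apply {I : Finset (Fin (d + 1))} (μ : CoordIdx I →₀ ℕ) (j : Fin (d + 1)) :
    weight μ j = ∑ p, (μ p : ℤ) * ((if j = p.1.1 then 1 else 0) - if j = p.1.2 then 1 else 0) := by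
  rw [weight, Finset.sum_apply]
  refine Finset.sum_congr rfl fun p _ => ?_
  rw [Pi.smul_apply, Pi.sub_apply, Pi.single_apply, Pi.single_apply, nsmul_eq_mul]

theorem poleDeg_weight_le {I : Finset (Fin (d + 1))} (μ : CoordIdx I →₀ ℕ) :
    poleDeg (weight μ) ≤ μ.degree := by
  have h1 : ∀ j : Fin (d + 1), (-weight μ j).toNat ≤ ∑ p, μ p * if j = p.1.2 then 1 else 0 := by
    intro j
    rw [Int.toNat_le, weight_apply, ← Finset.sum_neg_distrib]
    push_cast
    refine Finset.sum_le_sum fun p _ => ?_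
    rw [← mul_neg]
    refine mul_le_mul_of_nonneg_left ?_ (by positivity)
    split_ifs <;> simp
  refine (Finset.sum_le_sum fun j _ => h1 j).trans ?_
  rw [Finset.sum_comm, Finsupp.degree_eq_sum]
  refine Finset.sum_le_sum fun p _ => ?_
  rw [← Finset.mul_sum, Finset.sum_ite_eq' , if_pos (Finset.mem_univ _), mul_one]

theorem poleDeg_eq_zero {σ : Type} [Fintype σ] {ν : σ → ℤ} (h : poleDeg ν = 0) (j : σ) :
    0 ≤ ν j := by
  have := (Finset.sum_eq_zero_iff.1 h) j (Finset.mem_univ j)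
  omega

/-- Each Laurent monomial of degree zero with poles along `x_i = 0`, `i ∈ I`, comes from a
monomial in the coordinates whose degree is the order of its poles. -/
theorem exists_weight_eq {I : Finset (Fin (d + 1))} : ∀ (m : ℕ) (ν : Fin (d + 1) → ℤ),
    poleDeg ν = m → ∑ j, ν j = 0 → (∀ j ∉ I, 0 ≤ ν j) →
      ∃ μ : CoordIdx I →₀ ℕ, weight μ = ν ∧ μ.degree = m := by
  classical
  intro m
  induction m with
  | zero =>
    intro ν hν hs _
    have h1 : ν = 0 := by
      ext j
      exact (Finset.sum_eq_zero_iff_of_nonneg fun j _ => poleDeg_eq_zero hν j).1 hs j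
        (Finset.mem_univ j)
    exact ⟨0, by simp [weight, h1], by simp⟩
  | succ m ih =>
    intro ν hν hs hI
    obtain ⟨i, hi⟩ : ∃ i, ν i < 0 := by
      by_contra! h
      have : poleDeg ν = 0 := Finset.sum_eq_zero fun j _ => by
        have := h j
        omega
      omega
    obtain ⟨j, hj⟩ : ∃ j, 0 < ν j := by
      by_contra! h
      have h1 : ∑ j, ν j < 0 := Finset.sum_neg' (fun j _ => h j) ⟨i, Finset.mem_univ i, hi⟩
      omega
    have hji : j ≠ i := by
      rintro rfl
      omega
    have hiI : i ∈ I := by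
      by_contra h
      have := hI i h
      omega
    let p : CoordIdx I := ⟨(j, i), hiI, hji⟩
    let ν' : Fin (d + 1) → ℤ := ν - (Pi.single j 1 - Pi.single i 1)
    have hν'j : ∀ k, ν' k = ν k - ((if k = j then 1 else 0) - if k = i then 1 else 0) := by
      intro k
      simp only [ν', Pi.sub_apply, Pi.single_apply]
    have h1 : poleDeg ν' = m := by
      have h2 : poleDeg ν = poleDeg ν' + 1 := by
        rw [poleDeg, poleDeg, ← Finset.sum_erase_add _ _ (Finset.mem_univ i),
          ← Finset.sum_erase_add _ _ (Finset.mem_univ i), add_assoc]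
        congr 1
        · refine Finset.sum_congr rfl fun k hk => ?_
          rw [hν'j, if_neg (Finset.ne_of_mem_erase hk)]
          by_cases hkj : k = j
          · subst hkj
            simp only [if_true]
            omega
          · simp [hkj]
        · rw [hν'j, if_neg hji.symm, if_pos rfl]
          omega
      omega
    obtain ⟨μ, hμ, hμ'⟩ := ih ν' h1 (by
        simp only [ν', Pi.sub_apply, Finset.sum_sub_distrib, hs]
        simp) (by
        intro k hk
        have hki : k ≠ i := fun h => hk (h ▸ hiI)
        rw [hν'j, if_neg hki]
        have := hI k hk
        split_ifs with h
        · subst h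
          omega
        · omega)
    refine ⟨μ + Finsupp.single p 1, ?_, ?_⟩
    · rw [weight_add, hμ, weight_single]
      exact sub_add_cancel _ _
    · rw [map_add, hμ', Finsupp.degree_single]

variable (K : Type u) [Field K]

/-- The homomorphism `T_{(j,i)} ↦ x_j / x_i` to Laurent polynomials. -/
def chi (I : Finset (Fin (d + 1))) :
    MvPolynomial (CoordIdx I) K →ₐ[K] Laurent K (Fin (d + 1)) :=
  MvPolynomial.aeval fun p => AddMonoidAlgebra.single (Pi.single p.1.1 1 - Pi.single p.1.2 1) 1

/-- The regular functions on `U_I` as Laurent polynomials. -/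
def twistAlg (I : Finset (Fin (d + 1))) : Subalgebra K (Laurent K (Fin (d + 1))) :=
  (twist K 0 I).toSubalgebra (one_mem_twist I) fun f g hf hg => by
    have := mul_mem_twist hf hg
    rwa [add_zero, Finset.union_self] at this

variable {K} {I : Finset (Fin (d + 1))}

theorem chi_monomial (μ : CoordIdx I →₀ ℕ) (a : K) :
    chi K I (MvPolynomial.monomial μ a) = AddMonoidAlgebra.single (weight μ) a := by
  rw [chi, MvPolynomial.aeval_monomial, Finsupp.prod_fintype _ _ fun _ => pow_zero _]
  simp only [AddMonoidAlgebra.single_pow, one_pow]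
  rw [AddMonoidAlgebra.prod_single, Finset.prod_const_one, AddMonoidAlgebra.coe_algebraMap,
    Function.comp_apply, AddMonoidAlgebra.single_mul_single, zero_add, mul_one]
  rfl

theorem chi_X_mem (p : CoordIdx I) :
    (AddMonoidAlgebra.single (Pi.single p.1.1 1 - Pi.single p.1.2 1) 1 :
      Laurent K (Fin (d + 1))) ∈ twist K 0 I := by
  refine single_mem_twist (by simp) (fun j hj => ?_) 1
  have hj' : j ≠ p.1.2 := fun h => hj (h ▸ p.2.1)
  rw [Pi.sub_apply, Pi.single_eq_of_ne hj', sub_zero, Pi.single_apply]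
  split_ifs <;> simp

theorem chi_mem (p : MvPolynomial (CoordIdx I) K) : chi K I p ∈ twist K 0 I := by
  have h : (chi K I).range ≤ twistAlg K I := by
    rw [chi, ← Algebra.adjoin_range_eq_range_aeval, Algebra.adjoin_le_iff]
    rintro _ ⟨p, rfl⟩
    exact chi_X_mem p
  exact h ⟨p, rfl⟩

variable (K I) in
/-- The homomorphism `chi`, with values in the functions on `U_I`. -/
def chiRes : MvPolynomial (CoordIdx I) K →ₐ[K] twistAlg K I :=
  (chi K I).codRestrict (twistAlg K I) chi_mem

variable (K I) in
/-- The structure of a module over the polynomial ring on the functions on `U_I`. -/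
@[reducible] def twistAlgModule : Module (MvPolynomial (CoordIdx I) K) (twistAlg K I) :=
  Module.compHom _ (chiRes K I).toRingHom

end Coordinates

section CoordinateTopology

open Filter

variable {d : ℕ} {K : Type u} [NontriviallyNormedField K] [IsUltrametricDist K] {ρ : ℝ≥0}
variable {I : Finset (Fin (d + 1))}

/-- By the ultrametric inequality `chi` is norm-decreasing, as the degree of a monomial is at least
the order of the poles of its image. -/
theorem chi_mem_laurentBall (hρ : 1 ≤ ρ) {δ : ℝ} (hδ : 0 < δ) {p : MvPolynomial (CoordIdx I) K}
    (hp : p ∈ gaussBall ρ δ) : chi K I p ∈ laurentBall K ρ δ := by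
  classical
  have hρ' : (1 : ℝ) ≤ ρ := by exact_mod_cast hρ
  intro ν
  have h1 : (chi K I p).coeff ν = ∑ μ ∈ p.support with weight μ = ν, p.coeff μ := by
    conv_lhs => rw [p.as_sum]
    rw [map_sum, AddMonoidAlgebra.coeff_sum, Finset.sum_filter, Finsupp.finsetSum_apply]
    refine Finset.sum_congr rfl fun μ _ => ?_
    rw [chi_monomial, AddMonoidAlgebra.coeff_single, Finsupp.single_apply]
  rw [h1]
  have h2 : ‖∑ μ ∈ p.support with weight μ = ν, p.coeff μ‖ ≤ 0 ∨
      ∃ μ, weight μ = ν ∧ ‖∑ μ ∈ p.support with weight μ = ν, p.coeff μ‖ ≤ ‖p.coeff μ‖ := by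
    rcases (p.support.filter fun μ => weight μ = ν).eq_empty_or_nonempty with h | h
    · left
      simp [h]
    · obtain ⟨μ, hμ, h⟩ := IsUltrametricDist.exists_norm_finsetSum_le_of_nonempty h
        fun μ => p.coeff μ
      exact Or.inr ⟨μ, (Finset.mem_filter.1 hμ).2, h⟩
  rcases h2 with h2 | ⟨μ, rfl, h2⟩
  · rw [le_antisymm h2 (norm_nonneg _), zero_mul]
    exact hδ
  · refine lt_of_le_of_lt ?_ (hp μ)
    exact mul_le_mul h2 (pow_le_pow_right₀ hρ' (poleDeg_weight_le μ)) (by positivity)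
      (norm_nonneg _)

/-- A Laurent polynomial lifts to a polynomial of the same norm. -/
theorem exists_chi_eq {δ : ℝ} (hδ : 0 < δ) {f : Laurent K (Fin (d + 1))}
    (hf : f ∈ twist K 0 I) (hf' : f ∈ laurentBall K ρ δ) :
    ∃ p ∈ gaussBall (ι := CoordIdx I) ρ δ, chi K I p = f := by
  classical
  have h1 : ∀ ν : f.coeff.support, ∃ μ : CoordIdx I →₀ ℕ, weight μ = ν ∧ μ.degree = poleDeg ν.1 :=
    fun ν => exists_weight_eq _ _ rfl (hf ν (Finsupp.mem_support_iff.1 ν.2)).1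
      (hf ν (Finsupp.mem_support_iff.1 ν.2)).2
  choose m hm hm' using h1
  refine ⟨∑ ν, MvPolynomial.monomial (m ν) (f.coeff ν), fun μ => ?_, ?_⟩
  · by_cases h : ∃ ν, m ν = μ
    · obtain ⟨ν, rfl⟩ := h
      rw [MvPolynomial.coeff_sum, Finset.sum_eq_single ν]
      · rw [MvPolynomial.coeff_monomial, if_pos rfl, hm']
        exact hf' ν
      · intro κ _ hκ
        rw [MvPolynomial.coeff_monomial, if_neg]
        intro h
        exact hκ (Subtype.ext (by rw [← hm, ← hm, h]))
      · exact fun h => absurd (Finset.mem_univ _) h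
    · rw [MvPolynomial.coeff_sum, Finset.sum_eq_zero]
      · simpa using hδ
      · intro ν _
        rw [MvPolynomial.coeff_monomial, if_neg fun h' => h ⟨ν, h'⟩]
  · rw [map_sum]
    simp only [chi_monomial, hm]
    rw [Finset.sum_coe_sort f.coeff.support fun ν => AddMonoidAlgebra.single ν (f.coeff ν)]
    exact AddMonoidAlgebra.sum_coeff_single f

theorem exists_chi_eq_of_mem {f : Laurent K (Fin (d + 1))} (hf : f ∈ twist K 0 I) :
    ∃ p, chi K I p = f := by
  obtain ⟨δ, hδ, h⟩ : ∃ δ : ℝ, 0 < δ ∧ f ∈ laurentBall K 1 δ := by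
    refine ⟨f.coeff.support.sum (fun ν => ‖f.coeff ν‖) + 1, by positivity, fun ν => ?_⟩
    rw [NNReal.coe_one, one_pow, mul_one]
    refine lt_add_of_le_of_pos ?_ one_pos
    by_cases h : f.coeff ν = 0
    · rw [h, norm_zero]
      positivity
    · exact Finset.single_le_sum (f := fun ν => ‖f.coeff ν‖) (fun _ _ => norm_nonneg _)
        (Finsupp.mem_support_iff.2 h)
  obtain ⟨p, -, hp⟩ := exists_chi_eq hδ hf h
  exact ⟨p, hp⟩

attribute [local instance] twistAlgModule in
/-- The canonical topology on the functions on `U_I` is given by the norm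
`max_ν |a_ν| ρ^{poleDeg ν}` on Laurent polynomials, for every `I`. -/
theorem canNhd_twistAlg (hρ : 1 ≤ ρ) :
    canNhd K (CoordIdx I) ρ (twistAlg K I) =
      comap (fun f : twistAlg K I => (f : Laurent K (Fin (d + 1)))) (laurentNhd K _ ρ) := by
  have hs : ∀ p : MvPolynomial (CoordIdx I) K, ((p • (1 : twistAlg K I) : twistAlg K I) :
      Laurent K (Fin (d + 1))) = chi K I p := fun p => by
    change ((chiRes K I p • (1 : twistAlg K I) : twistAlg K I) : Laurent K (Fin (d + 1))) = _
    rw [smul_eq_mul, mul_one]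
    rfl
  ext U
  rw [mem_canNhd_iff_of_surjective (1 : twistAlg K I) (fun f => by
      obtain ⟨p, hp⟩ := exists_chi_eq_of_mem f.2
      exact ⟨p, Subtype.ext (by rw [hs, hp])⟩),
    ((laurentNhd_hasBasis K ρ).comap _).mem_iff]
  constructor
  · rintro ⟨δ, hδ, h⟩
    refine ⟨δ, hδ, fun f hf => ?_⟩
    obtain ⟨p, hp, hpf⟩ := exists_chi_eq hδ f.2 hf
    have h1 := h p hp
    rwa [show p • (1 : twistAlg K I) = f from Subtype.ext (by rw [hs, hpf])] at h1
  · rintro ⟨δ, hδ, h⟩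
    refine ⟨δ, hδ, fun p hp => h ?_⟩
    rw [Set.mem_preimage, hs]
    exact chi_mem_laurentBall hρ hδ hp

end CoordinateTopology

/-! ### Vector bundles as modules over Laurent polynomials -/

section Admissible

open Filter

variable {K : Type u} [Field K] {σ : Type} [Fintype σ] [DecidableEq σ]

/-- The properties of the filter of neighbourhoods of zero on Laurent polynomials used below. The
trivial filter has them as well, so that a statement about admissible filters covers both the
continuity of a map and the stability of spaces of sections under it. -/
structure IsAdmissible (T : Filter (Laurent K σ)) : Prop where
  add : Tendsto (fun p : Laurent K σ × Laurent K σ => p.1 + p.2) (T ×ˢ T) T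
  neg : Tendsto (fun f : Laurent K σ => -f) T T
  pure_le : pure 0 ≤ T
  mul : ∀ g : Laurent K σ, Tendsto (fun f : Laurent K σ => f * g) T T
  part : ∀ s : Set (σ → ℤ), Tendsto (monomialPart s) T T

theorem isAdmissible_top : IsAdmissible (⊤ : Filter (Laurent K σ)) :=
  ⟨tendsto_top, tendsto_top, le_top, fun _ => tendsto_top, fun _ => tendsto_top⟩

theorem isAdmissible_laurentNhd {K : Type u} [NormedField K] [IsUltrametricDist K] {ρ : ℝ≥0}
    (hρ : 1 ≤ ρ) : IsAdmissible (laurentNhd K σ ρ) :=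
  ⟨tendsto_add_laurentNhd, tendsto_neg_laurentNhd, pure_le_laurentNhd,
    fun g => tendsto_mul_laurentNhd hρ g, fun s => tendsto_monomialPart s⟩

/-- The trace of a filter on the sections of `𝒪(N)` on `U_J`. -/
def twistNhd (T : Filter (Laurent K σ)) (N : ℤ) (J : Finset σ) : Filter (Laurent K σ) :=
  T ⊓ 𝓟 (twist K N J)

variable {T : Filter (Laurent K σ)} {N N' : ℤ} {J J' : Finset σ}

theorem tendsto_twistNhd {X : Type*} {F : Filter X} {f : X → Laurent K σ} :
    Tendsto f F (twistNhd T N J) ↔ Tendsto f F T ∧ ∀ᶠ x in F, f x ∈ twist K N J := by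
  rw [twistNhd, tendsto_inf, tendsto_principal]
  rfl

theorem twistNhd_mono (h : J ⊆ J') : twistNhd T N J ≤ twistNhd T N J' :=
  inf_le_inf_left T (principal_mono.2 (twist_mono h))

theorem eventually_mem_twist : ∀ᶠ f in twistNhd T N J, f ∈ twist K N J :=
  (tendsto_twistNhd.1 tendsto_id).2

namespace IsAdmissible

variable (hT : IsAdmissible T)
include hT

theorem pure_le_twistNhd : pure 0 ≤ twistNhd T N J :=
  le_inf hT.pure_le (by simp)

theorem tendsto_zero {X : Type*} {F : Filter X} :
    Tendsto (fun _ : X => (0 : Laurent K σ)) F (twistNhd T N J) :=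
  tendsto_const_pure.mono_right hT.pure_le_twistNhd

theorem tendsto_add {X : Type*} {F : Filter X} {f g : X → Laurent K σ}
    (hf : Tendsto f F (twistNhd T N J)) (hg : Tendsto g F (twistNhd T N J)) :
    Tendsto (fun x => f x + g x) F (twistNhd T N J) := by
  rw [tendsto_twistNhd] at hf hg ⊢
  refine ⟨Tendsto.comp (f := fun x => (f x, g x))
    (g := fun p : Laurent K σ × Laurent K σ => p.1 + p.2) hT.add (hf.1.prodMk hg.1), ?_⟩
  filter_upwards [hf.2, hg.2] with x h1 h2 using add_mem h1 h2

theorem tendsto_neg {X : Type*} {F : Filter X} {f : X → Laurent K σ}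
    (hf : Tendsto f F (twistNhd T N J)) : Tendsto (fun x => -f x) F (twistNhd T N J) := by
  rw [tendsto_twistNhd] at hf ⊢
  refine ⟨Tendsto.comp (f := f) (g := fun p : Laurent K σ => -p) hT.neg hf.1, ?_⟩
  filter_upwards [hf.2] with x h1 using neg_mem h1

theorem tendsto_sum {X ι : Type*} {F : Filter X} (s : Finset ι) {f : ι → X → Laurent K σ}
    (hf : ∀ i ∈ s, Tendsto (f i) F (twistNhd T N J)) :
    Tendsto (fun x => ∑ i ∈ s, f i x) F (twistNhd T N J) := by
  classical
  induction s using Finset.induction_on with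
  | empty => simpa using hT.tendsto_zero
  | insert i s hi ih =>
    simp only [Finset.sum_insert hi]
    exact hT.tendsto_add (hf i (Finset.mem_insert_self _ _))
      (ih fun j hj => hf j (Finset.mem_insert_of_mem hj))

theorem tendsto_mul {X : Type*} {F : Filter X} {f : X → Laurent K σ} {g : Laurent K σ}
    (hf : Tendsto f F (twistNhd T N J)) (hg : g ∈ twist K N' J') (hJ : J' ⊆ J) {N'' : ℤ}
    (hN : N + N' = N'') : Tendsto (fun x => f x * g) F (twistNhd T N'' J) := by
  rw [tendsto_twistNhd] at hf ⊢
  refine ⟨Tendsto.comp (f := f) (g := fun p : Laurent K σ => p * g) (hT.mul g) hf.1, ?_⟩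
  filter_upwards [hf.2] with x h1
  have h2 := mul_mem_twist h1 hg
  rwa [hN, Finset.union_eq_left.2 hJ] at h2

end IsAdmissible

end Admissible

section Systems

open Filter

variable (K : Type u) [Field K] {σ : Type} [Fintype σ] [DecidableEq σ]
variable (P : σ → Prop) [DecidablePred P]

/-- The underlying set of coordinates. -/
abbrev vals {P : σ → Prop} (I : Finset {i // P i}) : Finset σ := I.image Subtype.val

/-- A module over the Laurent polynomials with, for each `i`, a finite dual basis, such that the
transition functions from `i` to `j` are regular on `U_{ij}`. It encodes a vector bundle on the
union of the `U_i`; the module is that of its sections on the torus. -/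
structure LaurentSystem (V : Type*) [AddCommGroup V] [Module (Laurent K σ) V]
    (ix : Type) [Fintype ix] where
  gen : {i // P i} → ix → V
  coord : {i // P i} → ix → V →ₗ[Laurent K σ] Laurent K σ
  sum_coord : ∀ i v, ∑ a, coord i a v • gen i a = v
  coord_gen : ∀ i j a b, coord j b (gen i a) ∈ twist K 0 (insert j.1 {i.1})

variable {K P}

/-- The neighbourhoods of zero in the sections of the free module `𝒪(N)^β`. -/
def freeNbhd {T : Filter (Laurent K σ)} (hT : IsAdmissible T) (N : ℤ) (β : Type) :
    NbhdSys {i // P i} (β → Laurent K σ) where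
  nhd I := ⨅ b, comap (fun u => u b) (twistNhd T N (vals I))
  tendsto_add I := by
    refine tendsto_iInf.2 fun b => tendsto_comap_iff.2 ?_
    have h : Tendsto (fun u : β → Laurent K σ => u b)
        (⨅ b, comap (fun u => u b) (twistNhd T N (vals I))) (twistNhd T N (vals I)) :=
      tendsto_iff_comap.2 (iInf_le _ b)
    exact hT.tendsto_add (h.comp tendsto_fst) (h.comp tendsto_snd)
  tendsto_neg I := tendsto_iInf.2 fun b => tendsto_comap_iff.2 <|
    hT.tendsto_neg (f := fun p : β → Laurent K σ => p b) (tendsto_iff_comap.2 (iInf_le _ b))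
  pure_le I := le_iInf fun b => by
    rw [← tendsto_iff_comap]
    exact tendsto_pure_left.2 fun s hs => hT.pure_le_twistNhd hs
  mono h := iInf_mono fun b => comap_mono (twistNhd_mono (Finset.image_subset_image h))

section free

variable {T : Filter (Laurent K σ)} (hT : IsAdmissible T) {N : ℤ} {β : Type}
  {I : Finset {i // P i}}

theorem tendsto_freeNbhd {X : Type*} {F : Filter X} {f : X → β → Laurent K σ} :
    Tendsto f F ((freeNbhd hT N β).nhd I) ↔
      ∀ b, Tendsto (fun x => f x b) F (twistNhd T N (vals I)) := by
  simp only [freeNbhd, tendsto_iInf, tendsto_comap_iff]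
  rfl

theorem tendsto_freeNbhd_apply (b : β) : Tendsto (fun u : β → Laurent K σ => u b)
    ((freeNbhd hT N β).nhd I) (twistNhd T N (vals I)) :=
  (tendsto_freeNbhd hT).1 tendsto_id b

end free

namespace LaurentSystem

variable {V : Type*} [AddCommGroup V] [Module (Laurent K σ) V] {ix : Type} [Fintype ix]
variable (A : LaurentSystem K P V ix) {T : Filter (Laurent K σ)} (hT : IsAdmissible T)

/-- The sections on `U_I`, for non-empty `I`; one chart suffices to test regularity. For `I = ∅`
the condition is void. -/
def sec (I : Finset {i // P i}) : Set V :=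
  {v | ∀ i ∈ I, ∀ a, A.coord i a v ∈ twist K 0 (vals I)}

theorem coord_eq (i j : {i // P i}) (a : ix) (v : V) :
    A.coord i a v = ∑ b, A.coord j b v * A.coord i a (A.gen j b) := by
  conv_lhs => rw [← A.sum_coord j v]
  simp only [map_sum, map_smul, smul_eq_mul]

theorem tendsto_coord {X : Type*} {F : Filter X} {g : X → V} {I J : Finset {i // P i}}
    (hIJ : I ⊆ J) {j : {i // P i}} (hj : j ∈ I) (hT : IsAdmissible T)
    (h : ∀ b, Tendsto (fun x => A.coord j b (g x)) F (twistNhd T 0 (vals I))) {i : {i // P i}}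
    (hi : i ∈ J) (a : ix) : Tendsto (fun x => A.coord i a (g x)) F (twistNhd T 0 (vals J)) := by
  refine Tendsto.congr (fun x => (A.coord_eq i j a (g x)).symm) ?_
  refine hT.tendsto_sum _ fun b _ => hT.tendsto_mul
    ((h b).mono_right (twistNhd_mono (Finset.image_subset_image hIJ))) (A.coord_gen j i b a)
    ?_ (zero_add 0)
  intro k hk
  rw [Finset.mem_insert, Finset.mem_singleton] at hk
  rcases hk with rfl | rfl
  · exact Finset.mem_image_of_mem _ hi
  · exact Finset.mem_image_of_mem _ (hIJ hj)

/-- The neighbourhoods of zero in the sections on `U_I`. For `I = ∅`, where there is no chart,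
the discrete topology is used to keep the family increasing. -/
def nbhd : NbhdSys {i // P i} V where
  nhd I := if I = ∅ then pure 0 else
    ⨅ i : I, ⨅ a, comap (fun v => A.coord i.1 a v) (twistNhd T 0 (vals I))
  tendsto_add I := by
    split_ifs
    · rw [prod_pure_pure, tendsto_pure_left]
      intro s hs
      simpa using hs
    · refine tendsto_iInf.2 fun i => tendsto_iInf.2 fun a => tendsto_comap_iff.2 ?_
      have h := tendsto_iff_comap.2 ((iInf_le (fun i : I => ⨅ a, comap
        (fun v => A.coord i.1 a v) (twistNhd T 0 (vals I))) i).trans (iInf_le _ a))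
      simp only [Function.comp_def, map_add]
      exact hT.tendsto_add (h.comp tendsto_fst) (h.comp tendsto_snd)
  tendsto_neg I := by
    split_ifs
    · rw [tendsto_pure_left]
      intro s hs
      simpa using hs
    · refine tendsto_iInf.2 fun i => tendsto_iInf.2 fun a => tendsto_comap_iff.2 ?_
      have h := tendsto_iff_comap.2 ((iInf_le (fun i : I => ⨅ a, comap
        (fun v => A.coord i.1 a v) (twistNhd T 0 (vals I))) i).trans (iInf_le _ a))
      simp only [Function.comp_def, map_neg]
      exact hT.tendsto_neg h
  pure_le I := by
    split_ifs
    · exact le_rfl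
    · refine le_iInf fun i => le_iInf fun a => ?_
      rw [← tendsto_iff_comap, tendsto_pure_left]
      intro s hs
      rw [map_zero]
      exact hT.pure_le_twistNhd hs
  mono {I J} hIJ := by
    by_cases hI : I = ∅
    · rw [if_pos hI]
      split_ifs
      · exact le_rfl
      · refine le_iInf fun i => le_iInf fun a => ?_
        rw [← tendsto_iff_comap, tendsto_pure_left]
        intro s hs
        rw [map_zero]
        exact hT.pure_le_twistNhd hs
    · obtain ⟨j, hj⟩ := Finset.nonempty_iff_ne_empty.2 hI
      rw [if_neg hI, if_neg (Finset.ne_empty_of_mem (hIJ hj))]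
      refine le_iInf fun i => le_iInf fun a => ?_
      rw [← tendsto_iff_comap]
      exact A.tendsto_coord hIJ hj hT (fun b => tendsto_iff_comap.2
        ((iInf_le (fun i : I => ⨅ a, comap (fun v => A.coord i.1 a v)
          (twistNhd T 0 (vals I))) ⟨j, hj⟩).trans (iInf_le _ b))) i.2 a

theorem tendsto_nbhd_coord {I : Finset {i // P i}} {i : {i // P i}} (hi : i ∈ I) (a : ix) :
    Tendsto (fun v => A.coord i a v) ((A.nbhd hT).nhd I) (twistNhd T 0 (vals I)) := by
  simp only [nbhd, if_neg (Finset.ne_empty_of_mem hi)]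
  exact tendsto_iff_comap.2 ((iInf_le (fun i : I => ⨅ a, comap (fun v => A.coord i.1 a v)
    (twistNhd T 0 (vals I))) ⟨i, hi⟩).trans (iInf_le _ a))

/-- The topology on the sections can be read off in a single chart. -/
theorem tendsto_nbhd {X : Type*} {F : Filter X} {g : X → V} {I : Finset {i // P i}}
    {i : {i // P i}} (hi : i ∈ I)
    (h : ∀ a, Tendsto (fun x => A.coord i a (g x)) F (twistNhd T 0 (vals I))) :
    Tendsto g F ((A.nbhd hT).nhd I) := by
  simp only [nbhd, if_neg (Finset.ne_empty_of_mem hi)]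
  exact tendsto_iInf.2 fun j => tendsto_iInf.2 fun a => tendsto_comap_iff.2
    (A.tendsto_coord subset_rfl hi hT h j.2 a)

theorem nbhd_top {I : Finset {i // P i}} (hI : I.Nonempty) :
    (A.nbhd isAdmissible_top).nhd I = 𝓟 (A.sec I) := by
  simp only [nbhd, if_neg hI.ne_empty, twistNhd, top_inf_eq, comap_principal]
  have : A.sec I = ⋂ i : I, ⋂ a, (fun v => A.coord i.1 a v) ⁻¹' twist K 0 (vals I) := by
    ext v
    simp [sec]
  rw [this]
  simp only [iInf_principal]

/-- There is a twist making the coordinates of all charts regular on each `U_j`. -/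
theorem exists_twist [Finite {i // P i}] : ∃ N : ℕ, ∀ i j a b,
    xpow K i.1 N * A.coord i a (A.gen j b) ∈ twist K N {j.1} := by
  have := Fintype.ofFinite {i // P i}
  choose N₀ hN₀ using fun p : ({i // P i} × {i // P i}) × ix × ix =>
    exists_xpow_mul_mem_twist p.1.1.1 (A.coord_gen p.1.2 p.1.1 p.2.1 p.2.2)
  refine ⟨Finset.univ.sup N₀, fun i j a b => ?_⟩
  exact hN₀ ((i, j), b, a) _ (Finset.le_sup (f := N₀) (Finset.mem_univ _))

variable (N : ℤ)

/-- The embedding into a free module given by all coordinates, twisted. -/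
def emb : V →ₗ[Laurent K σ] (({i // P i} × ix) → Laurent K σ) :=
  LinearMap.pi fun p => xpow K p.1.1 N • A.coord p.1 p.2

/-- The retraction of `emb` given by the chart `i`. -/
def retr (i : {i // P i}) : (({i // P i} × ix) → Laurent K σ) →ₗ[Laurent K σ] V :=
  ∑ a, (xpow K i.1 (-N) • LinearMap.proj (i, a)).smulRight (A.gen i a)

theorem emb_apply (v : V) (p : {i // P i} × ix) :
    A.emb N v p = xpow K p.1.1 N * A.coord p.1 p.2 v := rfl

theorem retr_apply (i : {i // P i}) (u : ({i // P i} × ix) → Laurent K σ) :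
    A.retr N i u = ∑ a, (xpow K i.1 (-N) * u (i, a)) • A.gen i a := by
  simp [retr]

theorem retr_emb (i : {i // P i}) (v : V) : A.retr N i (A.emb N v) = v := by
  simp only [retr_apply, emb_apply, ← mul_assoc, xpow_neg_mul_xpow, one_mul, A.sum_coord]

theorem emb_injective [Nonempty {i // P i}] : Function.Injective (A.emb N) :=
  Function.LeftInverse.injective (A.retr_emb N (Classical.arbitrary _))

theorem tendsto_emb {N : ℤ} (hN : ∀ i j a b,
      xpow K i.1 N * A.coord i a (A.gen j b) ∈ twist K N {j.1})
    {I : Finset {i // P i}} (hI : I.Nonempty) :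
    Tendsto (A.emb N) ((A.nbhd hT).nhd I) ((freeNbhd hT N _).nhd I) := by
  obtain ⟨j, hj⟩ := hI
  rw [tendsto_freeNbhd]
  rintro ⟨i, a⟩
  have h : ∀ v, A.emb N v (i, a) =
      ∑ b, A.coord j b v * (xpow K i.1 N * A.coord i a (A.gen j b)) := fun v => by
    rw [emb_apply, A.coord_eq i j a v, Finset.mul_sum]
    exact Finset.sum_congr rfl fun b _ => mul_left_comm _ _ _
  simp only [h]
  refine hT.tendsto_sum _ fun b _ => hT.tendsto_mul (A.tendsto_nbhd_coord hT hj b) (hN i j a b)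
    ?_ (zero_add N)
  rw [Finset.singleton_subset_iff]
  exact Finset.mem_image_of_mem _ hj

theorem tendsto_retr {I : Finset {i // P i}} {i : {i // P i}} (hi : i ∈ I) :
    Tendsto (A.retr N i) ((freeNbhd hT N _).nhd I) ((A.nbhd hT).nhd I) := by
  refine A.tendsto_nbhd hT hi fun b => ?_
  have h : ∀ u, A.coord i b (A.retr N i u) =
      ∑ a, u (i, a) * xpow K i.1 (-N) * A.coord i b (A.gen i a) := fun u => by
    rw [retr_apply, map_sum]
    refine Finset.sum_congr rfl fun a _ => ?_
    rw [map_smul, smul_eq_mul, mul_comm (u (i, a))]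
  have hi' : i.1 ∈ vals I := Finset.mem_image_of_mem _ hi
  simp only [h]
  refine hT.tendsto_sum _ fun a _ => hT.tendsto_mul (hT.tendsto_mul
    (tendsto_freeNbhd_apply hT (i, a)) (xpow_mem_twist i.1 (-N) (Finset.mem_singleton_self _))
    (Finset.singleton_subset_iff.2 hi') (add_neg_cancel N)) (A.coord_gen i i a b) ?_ (zero_add 0)
  simpa using hi'

/-- The cokernel of `emb`. -/
abbrev Coker : Type _ := (({i // P i} × ix) → Laurent K σ) ⧸ LinearMap.range (A.emb N)

/-- The section of the projection to the cokernel given by the chart `i`. -/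
def sect (i : {i // P i}) : A.Coker N →ₗ[Laurent K σ] (({i // P i} × ix) → Laurent K σ) :=
  (LinearMap.range (A.emb N)).liftQ (LinearMap.id - A.emb N ∘ₗ A.retr N i) (by
    rintro _ ⟨v, rfl⟩
    simp [A.retr_emb])

theorem sect_mk (i : {i // P i}) (u : ({i // P i} × ix) → Laurent K σ) :
    A.sect N i (Submodule.Quotient.mk u) = u - A.emb N (A.retr N i u) := rfl

theorem mk_sect (i : {i // P i}) (q : A.Coker N) : Submodule.Quotient.mk (A.sect N i q) = q := by
  obtain ⟨u, rfl⟩ := Submodule.Quotient.mk_surjective _ q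
  rw [sect_mk, Submodule.Quotient.mk_sub, sub_eq_self, Submodule.Quotient.mk_eq_zero]
  exact ⟨_, rfl⟩

theorem tendsto_sub_emb_retr {N : ℤ} (hN : ∀ i j a b,
      xpow K i.1 N * A.coord i a (A.gen j b) ∈ twist K N {j.1})
    {I : Finset {i // P i}} {i : {i // P i}} (hi : i ∈ I) :
    Tendsto (fun u => u - A.emb N (A.retr N i u)) ((freeNbhd hT N _).nhd I)
      ((freeNbhd hT N _).nhd I) :=
  NbhdSys.tendsto_sub' tendsto_id ((A.tendsto_emb hT hN ⟨i, hi⟩).comp (A.tendsto_retr hT N hi))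

variable [DecidableEq ix]

/-- The cokernel of `emb` is again a Laurent system: in the chart `i` it is a direct summand of the
free module, with the coordinates of the section `sect`. -/
def cokerSystem {N : ℤ} (hN : ∀ i j a b,
      xpow K i.1 N * A.coord i a (A.gen j b) ∈ twist K N {j.1}) [Fintype {i // P i}] :
    LaurentSystem K P (A.Coker N) ({i // P i} × ix) where
  gen i b := Submodule.Quotient.mk (xpow K i.1 N • Pi.single b 1)
  coord i b := xpow K i.1 (-N) • (LinearMap.proj b ∘ₗ A.sect N i)
  sum_coord i q := by
    conv_rhs => rw [← A.mk_sect N i q]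
    rw [← Submodule.mkQ_apply]
    conv_rhs => rw [← Finset.univ_sum_single (A.sect N i q), map_sum]
    refine Finset.sum_congr rfl fun b _ => ?_
    rw [← Submodule.Quotient.mk_smul, Submodule.mkQ_apply, smul_smul, LinearMap.smul_apply,
      smul_eq_mul, mul_right_comm, xpow_neg_mul_xpow, one_mul, LinearMap.comp_apply,
      LinearMap.proj_apply, ← Pi.single_smul, smul_eq_mul, mul_one]
  coord_gen i j a b := by
    let I : Finset {i // P i} := insert j {i}
    have hvI : vals I = insert j.1 {i.1} := by simp [vals, I, Finset.image_insert]
    have hj : j.1 ∈ vals I := by simp [hvI]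
    have h1 : Tendsto (fun _ : Unit => xpow K i.1 N • (Pi.single a 1 :
        ({i // P i} × ix) → Laurent K σ)) ⊤ ((freeNbhd isAdmissible_top N _).nhd I) := by
      rw [tendsto_freeNbhd]
      intro c
      rw [tendsto_twistNhd]
      refine ⟨tendsto_top, Eventually.of_forall fun _ => ?_⟩
      rw [Pi.smul_apply, Pi.single_apply]
      split_ifs
      · rw [smul_eq_mul, mul_one]
        exact xpow_mem_twist i.1 N (by simp [hvI])
      · rw [smul_zero]
        exact zero_mem _
    have h2 := (tendsto_freeNbhd _).1 ((A.tendsto_sub_emb_retr isAdmissible_top hN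
      (Finset.mem_insert_self j {i})).comp h1) b
    have h3 := (tendsto_twistNhd.1 (isAdmissible_top.tendsto_mul h2
      (xpow_mem_twist j.1 (-N) (Finset.mem_singleton_self _))
      (Finset.singleton_subset_iff.2 hj) (add_neg_cancel N))).2
    rw [hvI] at h3
    have h4 := h3.exists.choose_spec
    rw [mul_comm] at h4
    exact h4

variable [Fintype {i // P i}] {N}

theorem tendsto_mk (hN : ∀ i j a b,
      xpow K i.1 N * A.coord i a (A.gen j b) ∈ twist K N {j.1})
    {I : Finset {i // P i}} (hI : I.Nonempty) :
    Tendsto (Submodule.Quotient.mk : _ → A.Coker N) ((freeNbhd hT N _).nhd I)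
      (((A.cokerSystem hN).nbhd hT).nhd I) := by
  obtain ⟨i, hi⟩ := hI
  refine (A.cokerSystem hN).tendsto_nbhd hT hi fun b => ?_
  have h1 := hT.tendsto_mul ((tendsto_freeNbhd _).1 (A.tendsto_sub_emb_retr hT hN hi) b)
    (xpow_mem_twist (K := K) i.1 (-N) (Finset.mem_singleton_self _))
    (Finset.singleton_subset_iff.2 (Finset.mem_image_of_mem Subtype.val hi)) (add_neg_cancel N)
  refine h1.congr fun u => ?_
  rw [mul_comm]
  rfl

theorem tendsto_sect (hN : ∀ i j a b,
      xpow K i.1 N * A.coord i a (A.gen j b) ∈ twist K N {j.1})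
    {I : Finset {i // P i}} {i : {i // P i}} (hi : i ∈ I) :
    Tendsto (A.sect N i) (((A.cokerSystem hN).nbhd hT).nhd I) ((freeNbhd hT N _).nhd I) := by
  rw [tendsto_freeNbhd]
  intro b
  have h1 := hT.tendsto_mul ((A.cokerSystem hN).tendsto_nbhd_coord hT hi b)
    (xpow_mem_twist (K := K) i.1 N (Finset.mem_singleton_self _))
    (Finset.singleton_subset_iff.2 (Finset.mem_image_of_mem Subtype.val hi)) (zero_add N)
  refine h1.congr fun q => ?_
  change (xpow K i.1 (-N) * A.sect N i q b) * _ = _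
  rw [mul_comm, ← mul_assoc, xpow_mul_xpow_neg, one_mul]

end LaurentSystem

end Systems

/-! ### Strictness of the differentials -/

section Homotopy

open Filter

variable {K : Type u} [Field K] {σ : Type} [Fintype σ] [DecidableEq σ]
variable {P : σ → Prop} [DecidablePred P] {β : Type}

open Classical in
/-- A choice of an index `j` such that `x^ν` has no pole along `x_j = 0`, if there is one. -/
def regularIdx (P : σ → Prop) (ν : σ → ℤ) : Option {i // P i} :=
  if h : ∃ j : {i // P i}, 0 ≤ ν j.1 then some h.choose else none

theorem regularIdx_nonneg {ν : σ → ℤ} {j : {i // P i}} (h : regularIdx P ν = some j) :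
    0 ≤ ν j.1 := by
  unfold regularIdx at h
  split_ifs at h with h'
  · rw [← Option.some.inj h]
    exact h'.choose_spec

theorem exists_regularIdx {ν : σ → ℤ} (h : ∃ j : {i // P i}, 0 ≤ ν j.1) :
    ∃ j, regularIdx P ν = some j := ⟨h.choose, dif_pos h⟩

/-- The projection of the free module to the monomials with chosen index `j`. -/
def regularPart (j : {i // P i}) : (β → Laurent K σ) →+ (β → Laurent K σ) where
  toFun u b := monomialPart {ν | regularIdx P ν = some j} (u b)
  map_zero' := by
    ext1 b
    exact map_zero _
  map_add' u v := by
    ext1 b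
    exact map_add _ _ _

/-- A chosen regular part has no pole along the chosen hyperplane. -/
theorem tendsto_regularPart {T : Filter (Laurent K σ)} (hT : IsAdmissible T) (N : ℤ)
    (j : {i // P i}) (I : Finset {i // P i}) :
    Tendsto (regularPart j) ((freeNbhd hT N β).nhd (insert j I)) ((freeNbhd hT N β).nhd I) := by
  classical
  rw [tendsto_freeNbhd]
  intro b
  have h1 := tendsto_twistNhd.1 (tendsto_freeNbhd_apply (β := β) hT (N := N) (I := insert j I) b)
  rw [tendsto_twistNhd]
  refine ⟨(hT.part _).comp h1.1, ?_⟩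
  filter_upwards [h1.2] with u hu ν hν
  have h2 : (monomialPart {ν | regularIdx P ν = some j} (u b)).coeff ν ≠ 0 := hν
  rw [coeff_monomialPart] at h2
  split_ifs at h2 with h3
  · refine ⟨(hu ν h2).1, fun k hk => ?_⟩
    by_cases hkj : k = j.1
    · rw [hkj]
      exact regularIdx_nonneg h3
    · refine (hu ν h2).2 k fun h4 => ?_
      rw [vals, Finset.image_insert, Finset.mem_insert] at h4
      exact h4.elim hkj hk
  · exact absurd rfl h2

variable [Fintype {i // P i}]

theorem sum_regularPart {N : ℤ} {I : Finset {i // P i}} (hI : I.card < Fintype.card {i // P i})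
    {u : β → Laurent K σ} (hu : ∀ b, u b ∈ twist K N (vals I)) :
    ∑ j : {i // P i}, regularPart j u = u := by
  classical
  obtain ⟨k, hk⟩ : ∃ k, k ∉ I := by
    by_contra! h
    rw [Finset.eq_univ_iff_forall.2 h, Finset.card_univ] at hI
    exact lt_irrefl _ hI
  ext b ν
  rw [Finset.sum_apply, AddMonoidAlgebra.coeff_sum, Finsupp.finsetSum_apply]
  have h1 : ∀ j : {i // P i}, (regularPart j u b).coeff ν =
      if regularIdx P ν = some j then (u b).coeff ν else 0 := fun j => coeff_monomialPart _ _ _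
  simp only [h1]
  by_cases h2 : (u b).coeff ν = 0
  · simp [h2]
  · obtain ⟨j, hj⟩ := exists_regularIdx (P := P) (ν := ν) ⟨k, (hu b ν h2).2 k.1 fun h => by
      obtain ⟨k', hk', hkk⟩ := Finset.mem_image.1 h
      exact hk (Subtype.ext hkk ▸ hk')⟩
    rw [hj, Finset.sum_eq_single j]
    · rw [if_pos rfl]
    · intro i _ hi
      rw [if_neg fun h => hi (Option.some.inj h).symm]
    · exact fun h => absurd (Finset.mem_univ j) h

/-- A homotopy on the Čech complex of a free module: a monomial of `f(j, τ)` without a pole along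
`x_j = 0` extends over `U_j`. -/
def homotopy {l : ℕ} (c : (Fin (l + 1) → {i // P i}) → β → Laurent K σ) :
    (Fin l → {i // P i}) → β → Laurent K σ :=
  fun t => ∑ j, regularPart j (c (tcons j t))

/-- A tuple of length `l + 1` omits one of the hyperplanes, along which no monomial of a section has
a pole. -/
theorem homotopy_cobd {l : ℕ} {c : (Fin (l + 1) → {i // P i}) → β → Laurent K σ} {N : ℤ}
    (hl : l + 1 < Fintype.card {i // P i})
    (hc : ∀ t b, c t b ∈ twist K N (vals (entries t))) :
    homotopy (cobd c) = c - cobd (homotopy c) := by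
  ext1 t
  rw [Pi.sub_apply, homotopy]
  simp only [cobd_tcons, map_sub, Finset.sum_sub_distrib]
  congr 1
  · refine sum_regularPart (lt_of_le_of_lt ?_ hl) (hc t)
    exact Finset.card_image_le.trans (by simp)
  · have h1 : ∀ j : {i // P i}, regularPart j (cobd (fun s => c (tcons j s)) t) =
        cobd (fun s => regularPart j (c (tcons j s))) t := fun j =>
      (congrFun (cobd_map (regularPart j) fun s => c (tcons j s)) t).symm
    rw [Finset.sum_congr rfl fun j _ => h1 j]
    simp only [cobd, homotopy, Finset.smul_sum]
    exact Finset.sum_comm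

theorem tendsto_homotopy {T : Filter (Laurent K σ)} (hT : IsAdmissible T) (N : ℤ) (l : ℕ) :
    Tendsto (homotopy (β := β)) ((freeNbhd hT N β).cochainNhd Finset.univ ∅ (l + 1))
      ((freeNbhd (P := P) hT N β).cochainNhd Finset.univ ∅ l) := by
  refine NbhdSys.tendsto_cochainNhd fun t _ => NbhdSys.tendsto_sum _ fun j _ => ?_
  refine (tendsto_regularPart hT N j _).comp ?_
  have h := NbhdSys.tendsto_eval (S := freeNbhd hT N β) (B := ∅)
    (Finset.subset_univ (entries (tcons j t)))
  rwa [entries_tcons, Finset.union_insert] at h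

end Homotopy

section FiniteDimensional

open Filter

variable {K : Type u} [Field K] {σ : Type} [Fintype σ] [DecidableEq σ] {β : Type} [Finite β]

theorem finite_twist_empty (N : ℤ) : Module.Finite K (twist K N (∅ : Finset σ)) := by
  have hS : (Set.Icc (0 : σ → ℤ) fun _ => N).Finite := Set.finite_Icc _ _
  have := hS.to_subtype
  let g : twist K N (∅ : Finset σ) →ₗ[K] (Set.Icc (0 : σ → ℤ) fun _ => N) → K :=
    { toFun := fun f ν => f.1.coeff ν.1
      map_add' := fun f g => rfl
      map_smul' := fun a f => rfl }
  refine Module.Finite.of_injective g ((injective_iff_map_eq_zero g).2 fun f hf => ?_)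
  ext ν
  by_contra h
  have h1 := f.2 ν h
  have h2 : ∀ j, 0 ≤ ν j := fun j => h1.2 j (Finset.notMem_empty j)
  refine h (congrFun hf ⟨ν, fun j => h2 j, fun j => ?_⟩)
  rw [← h1.1]
  exact Finset.single_le_sum (fun j _ => h2 j) (Finset.mem_univ j)

/-- A linear map from a finite-dimensional space to a free module over the Laurent polynomials has
a generalised inverse depending on finitely many coefficients only. -/
theorem exists_generalized_inverse {E : Type*} [AddCommGroup E] [Module K E] [Module.Finite K E]
    (D : E →ₗ[K] (β → Laurent K σ)) :
    ∃ (s : Finset (β × (σ → ℤ))) (e : s → E), ∀ x : E,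
      D (∑ k : s, (D x k.1.1).coeff k.1.2 • e k) = D x := by
  classical
  have := Fintype.ofFinite β
  obtain ⟨w, hw⟩ := Module.Finite.fg_top (R := K) (M := E)
  let s : Finset (β × (σ → ℤ)) := w.biUnion fun x => Finset.univ.biUnion fun b =>
    (D x b).coeff.support.image fun ν => (b, ν)
  let J : (β → Laurent K σ) →ₗ[K] s → K :=
    { toFun := fun u k => (u k.1.1).coeff k.1.2
      map_add' := fun u v => rfl
      map_smul' := fun a u => rfl }
  have hs : ∀ x : E, ∀ b ν, (b, ν) ∉ s → (D x b).coeff ν = 0 := by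
    intro x b ν hbν
    have hx : x ∈ Submodule.span K (w : Set E) := hw ▸ Submodule.mem_top
    induction hx using Submodule.span_induction with
    | mem x hx =>
      by_contra h
      exact hbν (Finset.mem_biUnion.2 ⟨x, hx, Finset.mem_biUnion.2 ⟨b, Finset.mem_univ b,
        Finset.mem_image.2 ⟨ν, Finsupp.mem_support_iff.2 h, rfl⟩⟩⟩)
    | zero => simp
    | add x y _ _ hx hy => simp [hx, hy]
    | smul a x _ hx => simp [hx]
  have hJ : ∀ x : E, J (D x) = 0 → D x = 0 := by
    intro x hx
    ext b ν
    by_cases h : (b, ν) ∈ s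
    · exact congrFun hx ⟨(b, ν), h⟩
    · exact hs x b ν h
  let R := J ∘ₗ D
  obtain ⟨q, hq⟩ := (LinearMap.range R).subtype.exists_leftInverse_of_injective
    (Submodule.ker_subtype _)
  obtain ⟨p, hp⟩ := R.rangeRestrict.exists_rightInverse_of_surjective R.range_rangeRestrict
  refine ⟨s, fun k => p (q (Pi.single k 1)), fun x => ?_⟩
  have h1 : ∑ k : s, (D x k.1.1).coeff k.1.2 • p (q (Pi.single k 1)) = p (q (R x)) := by
    conv_rhs => rw [← Finset.univ_sum_single (R x), map_sum, map_sum]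
    refine Finset.sum_congr rfl fun k _ => ?_
    have h2 : (Pi.single k (R x k) : s → K) = R x k • Pi.single k 1 := by
      rw [← Pi.single_smul, smul_eq_mul, mul_one]
    rw [h2, map_smul, map_smul]
    rfl
  rw [h1, ← sub_eq_zero, ← map_sub]
  refine hJ _ ?_
  have h3 : q (R x) = R.rangeRestrict x := LinearMap.congr_fun hq (R.rangeRestrict x)
  have h4 : R (p (q (R x))) = R x := by
    rw [h3]
    exact congrArg Subtype.val (LinearMap.congr_fun hp (R.rangeRestrict x))
  change R _ = 0
  rw [map_sub, h4, sub_self]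

end FiniteDimensional

section Strictness

open Filter

variable {K : Type u} [NormedField K] [IsUltrametricDist K] {ρ : ℝ≥0} (hρ : 1 ≤ ρ)
variable {σ : Type} [Fintype σ] [DecidableEq σ]
variable {P : σ → Prop} [DecidablePred P] [Fintype {i // P i}]

section

variable {V : Type*} [AddCommGroup V] [Module (Laurent K σ) V] {ix : Type} [Fintype ix]
variable (A : LaurentSystem K P V ix)

/-- The cochains with regular values. -/
def LaurentSystem.legal (l : ℕ) : Set ((Fin l → {i // P i}) → V) :=
  {c | ∀ t, c t ∈ A.sec (entries t)}

/-- The neighbourhoods of zero in the space of cochains. -/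
abbrev LaurentSystem.cochainNhd (l : ℕ) : Filter ((Fin l → {i // P i}) → V) :=
  (A.nbhd (isAdmissible_laurentNhd hρ)).cochainNhd Finset.univ ∅ l

/-- Strictness of the differential on cochains on `l`-tuples: small coboundaries are coboundaries
of small cochains, given by an operator `b`. -/
def LaurentSystem.StrictAt (l : ℕ) : Prop :=
  ∃ b : ((Fin (l + 1) → {i // P i}) → V) → ((Fin l → {i // P i}) → V),
    Tendsto b (A.cochainNhd hρ (l + 1) ⊓ 𝓟 (cobd '' A.legal l)) (A.cochainNhd hρ l) ∧
      ∀ c ∈ A.legal l, cobd (b (cobd c)) = cobd c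

/-- On long tuples the contraction of the complex serves. -/
theorem LaurentSystem.strictAt_of_card_le {l : ℕ} (hl : Fintype.card {i // P i} ≤ l) :
    A.StrictAt hρ l := by
  obtain ⟨b, hb, hb'⟩ := (A.nbhd (isAdmissible_laurentNhd hρ)).exists_contraction
    Finset.univ ∅ l (by rwa [Finset.card_univ])
  refine ⟨b, hb.mono_left inf_le_left, fun c _ => ?_⟩
  ext1 t
  exact hb' (cobd c) (fun t _ => by rw [cobd_cobd, Pi.zero_apply]) t (Finset.subset_univ _)

end

section

variable {V : Type*} [AddCommGroup V] [Module (Laurent K σ) V] {ix : Type} [Fintype ix]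
variable [DecidableEq ix] (A : LaurentSystem K P V ix)

theorem entries_nonempty {l : ℕ} (t : Fin (l + 1) → {i // P i}) : (entries t).Nonempty :=
  ⟨t 0, Finset.mem_image_of_mem _ (Finset.mem_univ 0)⟩

theorem LaurentSystem.mem_sec_of_tendsto {V' : Type*} [AddCommGroup V'] [Module (Laurent K σ) V']
    {ix' : Type} [Fintype ix'] (A' : LaurentSystem K P V' ix') {I : Finset {i // P i}}
    (hI : I.Nonempty) {S : Set V} {g : V → V'}
    (h : Tendsto g (𝓟 S) ((A'.nbhd isAdmissible_top).nhd I)) {v : V} (hv : v ∈ S) :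
    g v ∈ A'.sec I := by
  rw [A'.nbhd_top hI, tendsto_principal_principal] at h
  exact h v hv

/-- Strictness follows from an operator that lifts small coboundaries in the cokernel of the
embedding into a free module to small cochains. -/
theorem LaurentSystem.strictAt_of_lift [Nonempty {i // P i}] {N : ℤ} (hN : ∀ i j a b,
      xpow K i.1 N * A.coord i a (A.gen j b) ∈ twist K N {j.1}) {m : ℕ}
    (hm : m + 1 < Fintype.card {i // P i})
    (G : ((Fin (m + 1) → {i // P i}) → ({i // P i} × ix) → Laurent K σ) →
      ((Fin m → {i // P i}) → ({i // P i} × ix) → Laurent K σ))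
    (Z : Set ((Fin (m + 1) → {i // P i}) → ({i // P i} × ix) → Laurent K σ))
    (hZ : ∀ c, (∃ g : (Fin m → {i // P i}) → ({i // P i} × ix) → Laurent K σ,
      (∀ t b, g t b ∈ twist K N (vals (entries t))) ∧ ∀ t,
        (Submodule.Quotient.mk (c t) : A.Coker N) = Submodule.Quotient.mk (cobd g t)) → c ∈ Z)
    (hG : Tendsto G ((freeNbhd (isAdmissible_laurentNhd hρ) N _).cochainNhd Finset.univ ∅ (m + 1) ⊓
      𝓟 Z) ((freeNbhd (isAdmissible_laurentNhd hρ) N _).cochainNhd Finset.univ ∅ m))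
    (hG' : ∀ c ∈ Z, ∀ t,
      (Submodule.Quotient.mk (c t) : A.Coker N) = Submodule.Quotient.mk (cobd (G c) t)) :
    A.StrictAt hρ (m + 1) := by
  have hT := isAdmissible_laurentNhd (K := K) (σ := σ) hρ
  -- `H (cobd c)` differs from `c` by a coboundary of the free module
  let H : ((Fin (m + 2) → {i // P i}) → V) →
      ((Fin (m + 1) → {i // P i}) → ({i // P i} × ix) → Laurent K σ) :=
    fun η => homotopy fun t => A.emb N (η t)
  have hH : ∀ c ∈ A.legal (m + 1), H (cobd c) = (fun t => A.emb N (c t)) -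
      cobd (homotopy fun t => A.emb N (c t)) := by
    intro c hc
    have h1 : (fun t => A.emb N (cobd c t)) = cobd fun t => A.emb N (c t) :=
      (cobd_map (A.emb N).toAddMonoidHom c).symm
    simp only [H, h1]
    refine homotopy_cobd (N := N) hm fun t b => ?_
    have h2 := A.tendsto_emb isAdmissible_top hN (entries_nonempty t)
    rw [A.nbhd_top (entries_nonempty t), tendsto_freeNbhd] at h2
    exact eventually_principal.1 (tendsto_twistNhd.1 (h2 b)).2 _ (hc t)
  have hHZ : ∀ c ∈ A.legal (m + 1), H (cobd c) ∈ Z := by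
    intro c hc
    refine hZ _ ⟨-(homotopy fun t => A.emb N (c t)), fun t b => ?_, fun t => ?_⟩
    · have h2 : ∀ᶠ c in (freeNbhd isAdmissible_top N _).cochainNhd Finset.univ ∅ (m + 1),
          homotopy c t b ∈ twist K N (vals (∅ ∪ entries t)) :=
        (tendsto_twistNhd.1 ((tendsto_freeNbhd_apply (K := K) isAdmissible_top b).comp
          ((NbhdSys.tendsto_eval (Finset.subset_univ (entries t))).comp
            (tendsto_homotopy isAdmissible_top N m)))).2
      have h3 : pure (fun t => A.emb N (c t)) ≤
          (freeNbhd isAdmissible_top N _).cochainNhd Finset.univ ∅ (m + 1) := by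
        rw [← map_pure (fun c : (Fin (m + 1) → {i // P i}) → V => fun t => A.emb N (c t)) c]
        refine NbhdSys.tendsto_cochainNhd fun s _ => ?_
        have h4 := A.tendsto_emb isAdmissible_top hN (entries_nonempty s)
        rw [A.nbhd_top (entries_nonempty s)] at h4
        rw [Finset.empty_union]
        refine Tendsto.comp (g := A.emb N) (f := fun c : (Fin (m + 1) → {i // P i}) → V => c s)
          h4 ?_
        rw [tendsto_pure_left]
        intro S hS
        exact hS (hc s)
      have h5 := neg_mem (eventually_pure.1 (h2.filter_mono h3))
      rwa [Finset.empty_union] at h5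
    · rw [hH c hc, Pi.sub_apply, Submodule.Quotient.mk_sub, cobd_neg, Pi.neg_apply,
        Submodule.Quotient.mk_neg,
        (Submodule.Quotient.mk_eq_zero _).2 (LinearMap.mem_range_self _ _), zero_sub]
  -- the corrected cochain vanishes in the cokernel; its preimage is found in the chart `t 0`
  refine ⟨fun η t => A.retr N (t 0) ((H η - cobd (G (H η))) t), ?_, ?_⟩
  · have h1 : Tendsto H (A.cochainNhd hρ (m + 2))
        ((freeNbhd hT N _).cochainNhd Finset.univ ∅ (m + 1)) := by
      refine (tendsto_homotopy hT N (m + 1)).comp (NbhdSys.tendsto_cochainNhd fun t _ => ?_)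
      refine Tendsto.comp (g := A.emb N) (f := fun c : (Fin (m + 2) → {i // P i}) → V => c t)
        (A.tendsto_emb hT hN ?_) (NbhdSys.tendsto_eval (Finset.subset_univ _))
      rw [Finset.empty_union]
      exact entries_nonempty t
    have h2 : Tendsto H (A.cochainNhd hρ (m + 2) ⊓ 𝓟 (cobd '' A.legal (m + 1)))
        ((freeNbhd hT N _).cochainNhd Finset.univ ∅ (m + 1) ⊓ 𝓟 Z) := by
      refine tendsto_inf.2 ⟨h1.mono_left inf_le_left, tendsto_principal.2 ?_⟩
      refine Eventually.filter_mono inf_le_right (eventually_principal.2 ?_)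
      rintro _ ⟨c, hc, rfl⟩
      exact hHZ c hc
    refine NbhdSys.tendsto_cochainNhd fun t ht => ?_
    refine (A.tendsto_retr hT N (i := t 0) ?_).comp ?_
    · rw [Finset.empty_union]
      exact Finset.mem_image_of_mem _ (Finset.mem_univ 0)
    · exact NbhdSys.tendsto_sub' ((NbhdSys.tendsto_eval ht).comp (h1.mono_left inf_le_left))
        ((NbhdSys.tendsto_eval ht).comp ((NbhdSys.tendsto_cobd m).comp (hG.comp h2)))
  · intro c hc
    have h1 : ∀ t, A.emb N (A.retr N (t 0) ((H (cobd c) - cobd (G (H (cobd c)))) t)) =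
        (H (cobd c) - cobd (G (H (cobd c)))) t := by
      intro t
      have h2 := hG' _ (hHZ c hc) t
      rw [← sub_eq_zero, ← Submodule.Quotient.mk_sub, Submodule.Quotient.mk_eq_zero] at h2
      obtain ⟨v, hv⟩ := h2
      rw [Pi.sub_apply, ← hv, A.retr_emb]
    have h3 : cobd (H (cobd c) - cobd (G (H (cobd c)))) = cobd fun t => A.emb N (c t) := by
      rw [cobd_sub, cobd_cobd, sub_zero, hH c hc, cobd_sub, cobd_cobd, sub_zero]
    ext1 t
    refine A.emb_injective N ?_
    have h4 := congrFun (cobd_map (A.emb N).toAddMonoidHom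
      fun t => A.retr N (t 0) ((H (cobd c) - cobd (G (H (cobd c)))) t)) t
    refine h4.symm.trans (Eq.trans ?_ (congrFun (cobd_map (A.emb N).toAddMonoidHom c) t))
    exact (congrArg (fun F => cobd F t) (funext h1)).trans (congrFun h3 t)

/-- Strictness on `1`-tuples: the lift of constants is a continuous operator since the space of
global sections of the free module is finite-dimensional. -/
theorem LaurentSystem.strictAt_one (h1 : 1 < Fintype.card {i // P i}) : A.StrictAt hρ 1 := by
  have hT := isAdmissible_laurentNhd (K := K) (σ := σ) hρ
  have : Nonempty {i // P i} := Fintype.card_pos_iff.1 (zero_lt_one.trans h1)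
  obtain ⟨N, hN⟩ := A.exists_twist
  let i₀ : {i // P i} := Classical.arbitrary _
  -- `D u` depends only on the class of `u` in the cokernel
  let D : (({i // P i} × ix) → Laurent K σ) →ₗ[Laurent K σ] (({i // P i} × ix) → Laurent K σ) :=
    LinearMap.id - A.emb N ∘ₗ A.retr N i₀
  have hD : ∀ u, (Submodule.Quotient.mk (D u) : A.Coker N) = Submodule.Quotient.mk u := fun u =>
    A.mk_sect N i₀ (Submodule.Quotient.mk u)
  have hD' : ∀ u u', (Submodule.Quotient.mk u : A.Coker N) = Submodule.Quotient.mk u' →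
      D u = D u' := fun u u' h => congrArg (A.sect N i₀) h
  have := finite_twist_empty (K := K) (σ := σ) N
  let inc : (({i // P i} × ix) → twist K N (∅ : Finset σ)) →ₗ[K]
      (({i // P i} × ix) → Laurent K σ) :=
    LinearMap.pi fun b => (twist K N ∅).subtype ∘ₗ LinearMap.proj b
  obtain ⟨s, e, he⟩ := exists_generalized_inverse ((D.restrictScalars K) ∘ₗ inc)
  have hDt : Tendsto D ((freeNbhd hT N _).nhd {i₀}) ((freeNbhd hT N _).nhd {i₀}) :=
    A.tendsto_sub_emb_retr hT hN (Finset.mem_singleton_self i₀)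
  -- cochains that are, in the cokernel, the class of a global section of the free module
  let Z : Set ((Fin 1 → {i // P i}) → ({i // P i} × ix) → Laurent K σ) :=
    {c | ∃ x, ∀ t, (Submodule.Quotient.mk (c t) : A.Coker N) = Submodule.Quotient.mk (inc x)}
  refine A.strictAt_of_lift hρ hN h1
    (fun c _ => ∑ k : s, (D (c fun _ => i₀) k.1.1).coeff k.1.2 • inc (e k)) Z ?_ ?_ ?_
  · rintro c ⟨g, hg, hgc⟩
    refine ⟨fun b => ⟨g Fin.elim0 b, ?_⟩, fun t => ?_⟩
    · have h2 : vals (entries (Fin.elim0 : Fin 0 → {i // P i})) = ∅ := by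
        rw [vals, entries, Finset.univ_eq_empty, Finset.image_empty, Finset.image_empty]
      exact h2 ▸ hg Fin.elim0 b
    · rw [hgc t]
      congr 1
      simp [cobd, inc, Subsingleton.elim _ (Fin.elim0 : Fin 0 → {i // P i})]
      rfl
  · refine NbhdSys.tendsto_cochainNhd fun t _ => NbhdSys.tendsto_sum _ fun k _ => ?_
    rw [tendsto_freeNbhd]
    intro b
    rw [tendsto_twistNhd]
    constructor
    · have h2 : Tendsto (fun c : (Fin 1 → {i // P i}) → ({i // P i} × ix) → Laurent K σ =>
          c fun _ => i₀) ((freeNbhd hT N _).cochainNhd Finset.univ ∅ 1 ⊓ 𝓟 Z)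
          ((freeNbhd hT N _).nhd {i₀}) := by
        have h3 := NbhdSys.tendsto_eval (S := freeNbhd hT N ({i // P i} × ix)) (B := ∅)
          (Finset.subset_univ (entries fun _ : Fin 1 => i₀))
        have h4 : ∅ ∪ entries (fun _ : Fin 1 => i₀) = {i₀} := by simp [entries]
        rw [h4] at h3
        exact h3.mono_left inf_le_left
      have h3 := (tendsto_twistNhd.1 ((tendsto_freeNbhd _).1 (hDt.comp h2) k.1.1)).1
      exact (tendsto_smul_laurentNhd hρ _).comp ((tendsto_coeff hρ k.1.2).comp h3)
    · exact Eventually.of_forall fun c => Submodule.smul_mem _ _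
        (twist_mono (Finset.empty_subset _) (e k b).2)
  · rintro c ⟨x, hx⟩ t
    have h2 : D (c fun _ => i₀) = D (inc x) := hD' _ _ (hx _)
    have h3 := he x
    rw [hx t, ← hD (inc x)]
    have h4 : cobd (fun _ : Fin 0 → {i // P i} =>
        ∑ k : s, (D (c fun _ => i₀) k.1.1).coeff k.1.2 • inc (e k)) t =
        inc (∑ k : s, (D (inc x) k.1.1).coeff k.1.2 • e k) := by
      rw [h2, map_sum]
      simp [cobd]
    rw [h4, ← hD (inc (∑ k : s, (D (inc x) k.1.1).coeff k.1.2 • e k))]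
    exact congrArg _ h3.symm

end

/-- The differentials of the Čech complex of a Laurent system are strict, by induction on the degree
for all systems simultaneously: the step passes to the cokernel of an embedding into a free
module. -/
theorem LaurentSystem.strictAt (m : ℕ) : ∀ {V : Type u} [AddCommGroup V] [Module (Laurent K σ) V]
    {ix : Type} [Fintype ix] [DecidableEq ix] (A : LaurentSystem K P V ix),
    A.StrictAt hρ (m + 1) := by
  have hT := isAdmissible_laurentNhd (K := K) (σ := σ) hρ
  induction m with
  | zero =>
    intro V _ _ ix _ _ A
    rcases Nat.lt_or_ge 1 (Fintype.card {i // P i}) with h | h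
    · exact A.strictAt_one hρ h
    · exact A.strictAt_of_card_le hρ h
  | succ m ih =>
    intro V _ _ ix _ _ A
    rcases Nat.lt_or_ge (m + 2) (Fintype.card {i // P i}) with h | h
    · have : Nonempty {i // P i} := Fintype.card_pos_iff.1 ((Nat.zero_lt_succ _).trans h)
      obtain ⟨N, hN⟩ := A.exists_twist
      obtain ⟨b, hb, hb'⟩ := ih (A.cokerSystem hN)
      refine A.strictAt_of_lift hρ hN h
        (fun c t => A.sect N (t 0) (b (fun t => Submodule.Quotient.mk (c t)) t))
        {c | (fun t => (Submodule.Quotient.mk (c t) : A.Coker N)) ∈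
          cobd '' (A.cokerSystem hN).legal (m + 1)} ?_ ?_ ?_
      · rintro c ⟨g, hg, hgc⟩
        refine ⟨fun t => Submodule.Quotient.mk (g t), fun t => ?_, ?_⟩
        · have h2 := A.tendsto_mk isAdmissible_top hN (entries_nonempty t)
          have h3 : 𝓟 {g t} ≤ (freeNbhd isAdmissible_top (N : ℤ) _).nhd (entries t) := by
            rw [principal_singleton]
            exact tendsto_id'.1 ((tendsto_freeNbhd _).2 fun b => tendsto_twistNhd.2
              ⟨tendsto_top, eventually_pure.2 (hg t b)⟩)
          exact LaurentSystem.mem_sec_of_tendsto (A.cokerSystem hN) (entries_nonempty t)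
            (h2.mono_left h3) rfl
        · ext1 t
          rw [hgc t]
          exact congrFun (cobd_map (LinearMap.range (A.emb N)).mkQ.toAddMonoidHom g) t
      · refine NbhdSys.tendsto_cochainNhd fun t ht => ?_
        refine Tendsto.comp (A.tendsto_sect hT hN (i := t 0) ?_)
          ((NbhdSys.tendsto_eval ht).comp (hb.comp ?_))
        · rw [Finset.empty_union]
          exact Finset.mem_image_of_mem _ (Finset.mem_univ 0)
        · refine tendsto_inf.2 ⟨Tendsto.mono_left ?_ inf_le_left, ?_⟩
          · refine NbhdSys.tendsto_cochainNhd fun t ht => ?_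
            refine Tendsto.comp (A.tendsto_mk hT hN ?_) (NbhdSys.tendsto_eval ht)
            rw [Finset.empty_union]
            exact entries_nonempty t
          · exact tendsto_principal.2 (Eventually.filter_mono inf_le_right
              (eventually_principal.2 fun c hc => hc))
      · rintro c ⟨g, hg, hgc⟩ t
        have h2 := hb' g hg
        rw [hgc] at h2
        refine (congrFun h2 t).symm.trans ?_
        have h3 := congrFun (cobd_map (LinearMap.range (A.emb N)).mkQ.toAddMonoidHom
          fun t => A.sect N (t 0) (b (fun t => Submodule.Quotient.mk (c t)) t)) t
        refine Eq.trans ?_ h3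
        refine congrArg (fun F => cobd F t) (funext fun t => ?_)
        exact (A.mk_sect N (t 0) _).symm
    · exact A.strictAt_of_card_le hρ h

end Strictness

/-! ### Regular functions as Laurent polynomials -/

section Functions

variable (K : Type u) [Field K] {d : ℕ}

/-- Polynomials as Laurent polynomials. -/
def toLaurent : MvPolynomial (Fin (d + 1)) K →ₐ[K] Laurent K (Fin (d + 1)) :=
  MvPolynomial.aeval fun i => xpow K i 1

variable {K}

theorem toLaurent_monomial (μ : Fin (d + 1) →₀ ℕ) (a : K) :
    toLaurent K (MvPolynomial.monomial μ a) = AddMonoidAlgebra.single (fun j => (μ j : ℤ)) a := by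
  have h : ∀ i, xpow K i 1 ^ μ i = AddMonoidAlgebra.single (Pi.single i (μ i : ℤ)) 1 := by
    intro i
    rw [xpow, AddMonoidAlgebra.single_pow, one_pow, ← Pi.single_smul, nsmul_eq_mul, mul_one]
  rw [toLaurent, MvPolynomial.aeval_monomial, Finsupp.prod_fintype _ _ fun _ => pow_zero _]
  simp only [h]
  rw [AddMonoidAlgebra.prod_single, Finset.prod_const_one, AddMonoidAlgebra.coe_algebraMap,
    Function.comp_apply, AddMonoidAlgebra.single_mul_single, zero_add, mul_one,
    Finset.univ_sum_single fun i => (μ i : ℤ)]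
  rfl

theorem coeff_toLaurent (p : MvPolynomial (Fin (d + 1)) K) (ν : Fin (d + 1) → ℤ) :
    (toLaurent K p).coeff ν =
      ∑ μ ∈ p.support, if (fun j => (μ j : ℤ)) = ν then p.coeff μ else 0 := by
  conv_lhs => rw [p.as_sum]
  rw [map_sum, AddMonoidAlgebra.coeff_sum, Finsupp.finsetSum_apply]
  refine Finset.sum_congr rfl fun μ _ => ?_
  rw [toLaurent_monomial, AddMonoidAlgebra.coeff_single, Finsupp.single_apply]

theorem toLaurent_injective : Function.Injective (toLaurent (d := d) K) := by
  refine (injective_iff_map_eq_zero _).2 fun p hp => ?_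
  ext μ
  have h := coeff_toLaurent p fun j => (μ j : ℤ)
  rw [hp] at h
  by_contra hμ
  rw [Finset.sum_eq_single μ] at h
  · rw [if_pos rfl] at h
    exact hμ h.symm
  · intro κ _ hκ
    refine if_neg fun h' => hκ ?_
    ext j
    exact_mod_cast congrFun h' j
  · intro h'
    exact absurd (MvPolynomial.mem_support_iff.2 hμ) h'

theorem toLaurent_mem_twist {n : ℕ} {p : MvPolynomial (Fin (d + 1)) K} (hp : p ∈ grading d K n) :
    toLaurent K p ∈ twist K n ∅ := by
  intro ν hν
  rw [coeff_toLaurent] at hν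
  obtain ⟨μ, hμ, h⟩ := Finset.exists_ne_zero_of_sum_ne_zero hν
  split_ifs at h with h'
  · subst h'
    refine ⟨?_, fun j _ => Int.natCast_nonneg _⟩
    have h1 := ((MvPolynomial.mem_homogeneousSubmodule _ _).1 hp) h
    rw [← h1, Finsupp.weight_apply, Finsupp.sum_fintype _ _ (by simp)]
    simp
  · exact absurd rfl h

/-- The homomorphism from the degree-zero part of a localization to Laurent polynomials. -/
def awayToLaurent {f : MvPolynomial (Fin (d + 1)) K} (hf : IsUnit (toLaurent K f)) :
    HomogeneousLocalization.Away (grading d K) f →+* Laurent K (Fin (d + 1)) :=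
  (IsLocalization.Away.lift (S := Localization.Away f) f
      (g := (toLaurent (d := d) K).toRingHom) hf).comp
    (algebraMap (HomogeneousLocalization.Away (grading d K) f) (Localization.Away f))

theorem awayToLaurent_injective {f : MvPolynomial (Fin (d + 1)) K} (hf : IsUnit (toLaurent K f)) :
    Function.Injective (awayToLaurent hf) := by
  rw [awayToLaurent, RingHom.coe_comp]
  refine Function.Injective.comp ?_ (HomogeneousLocalization.val_injective (Submonoid.powers f))
  exact (IsLocalization.lift_injective_iff _).2 fun a b => by
    rw [(IsLocalization.injective (Localization.Away f) (M := Submonoid.powers f) ?_).eq_iff]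
    · exact toLaurent_injective.eq_iff.symm
    · refine Submonoid.powers_le.2 (mem_nonZeroDivisors_of_ne_zero ?_)
      rintro rfl
      rw [map_zero] at hf
      exact not_isUnit_zero hf

theorem awayToLaurent_mk {f : MvPolynomial (Fin (d + 1)) K} (hf : IsUnit (toLaurent K f)) {m : ℕ}
    (hm : f ∈ grading d K m) (n : ℕ) (a : MvPolynomial (Fin (d + 1)) K)
    (ha : a ∈ grading d K (n • m)) :
    awayToLaurent hf (HomogeneousLocalization.Away.mk (grading d K) hm n a ha) *
      toLaurent K f ^ n = toLaurent K a := by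
  let L := IsLocalization.Away.lift (S := Localization.Away f) f
    (g := (toLaurent (d := d) K).toRingHom) hf
  have h0 : ∀ p, L (algebraMap _ _ p) = toLaurent K p := IsLocalization.Away.lift_eq f hf
  have h1 := congrArg L (IsLocalization.mk'_spec (Localization.Away f) a
    (⟨f ^ n, n, rfl⟩ : Submonoid.powers f))
  rw [map_mul, h0, h0, map_pow] at h1
  rw [awayToLaurent, RingHom.comp_apply, HomogeneousLocalization.algebraMap_apply,
    HomogeneousLocalization.Away.val_mk, Localization.mk_eq_mk']
  exact h1

theorem awayToLaurent_algebraMap {f : MvPolynomial (Fin (d + 1)) K} (hf : IsUnit (toLaurent K f))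
    (a : K) : awayToLaurent hf (algebraMap (grading d K 0)
      (HomogeneousLocalization.Away (grading d K) f) (algebraMap K (grading d K 0) a)) =
      algebraMap K _ a := by
  rw [awayToLaurent, RingHom.comp_apply, ← IsScalarTower.algebraMap_apply (grading d K 0)
    (HomogeneousLocalization.Away (grading d K) f) (Localization.Away f)]
  refine (IsLocalization.Away.lift_eq (S := Localization.Away f) f hf _).trans ?_
  exact (toLaurent K).commutes a

theorem awayToLaurent_awayMap {f g x : MvPolynomial (Fin (d + 1)) K}
    (hf : IsUnit (toLaurent K f)) (hx : IsUnit (toLaurent K x)) {m m' : ℕ}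
    (hm : f ∈ grading d K m) (hg : g ∈ grading d K m') (h : x = f * g)
    (z : HomogeneousLocalization.Away (grading d K) f) :
    awayToLaurent hx (HomogeneousLocalization.awayMap (grading d K) hg h z) =
      awayToLaurent hf z := by
  obtain ⟨n, a, ha, rfl⟩ := HomogeneousLocalization.Away.mk_surjective (grading d K) hm z
  rw [HomogeneousLocalization.awayMap_mk]
  have h1 := awayToLaurent_mk hf hm n a ha
  have h2 := awayToLaurent_mk hx (h ▸ SetLike.mul_mem_graded hm hg) n (a * g ^ n)
    (by rw [smul_add]; exact SetLike.mul_mem_graded ha (SetLike.pow_mem_graded n hg))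
  refine (hx.pow n).mul_left_injective ?_
  refine h2.trans ?_
  change _ = _ * toLaurent K x ^ n
  conv_rhs => rw [h]
  rw [map_mul, map_mul, map_pow, mul_pow, ← mul_assoc, h1]

variable (K) in
/-- The product of the variables `X_i`, `i ∈ I`. -/
def prodX (I : Finset (Fin (d + 1))) : MvPolynomial (Fin (d + 1)) K := ∏ i ∈ I, MvPolynomial.X i

theorem prodX_mem (I : Finset (Fin (d + 1))) : prodX K I ∈ grading d K I.card := by
  rw [MvPolynomial.mem_homogeneousSubmodule]
  have h := MvPolynomial.IsHomogeneous.prod I (fun i => (MvPolynomial.X i :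
    MvPolynomial (Fin (d + 1)) K)) (fun _ => 1) fun i _ => MvPolynomial.isHomogeneous_X K i
  simpa [prodX] using h

theorem isUnit_xpow (i : Fin (d + 1)) (N : ℤ) : IsUnit (xpow K i N) :=
  IsUnit.of_mul_eq_one _ (xpow_mul_xpow_neg i N)

theorem toLaurent_X (i : Fin (d + 1)) : toLaurent K (MvPolynomial.X i) = xpow K i 1 :=
  MvPolynomial.aeval_X _ _

theorem isUnit_prodX (I : Finset (Fin (d + 1))) : IsUnit (toLaurent K (prodX K I)) := by
  rw [prodX, map_prod]
  refine Finset.prod_induction _ IsUnit (fun _ _ => IsUnit.mul) isUnit_one fun i _ => ?_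
  rw [toLaurent_X]
  exact isUnit_xpow i 1

theorem stdInter_eq (I : Finset (Fin (d + 1))) :
    stdInter K I = Proj.basicOpen (grading d K) (prodX K I) := by
  induction I using Finset.induction_on with
  | empty => exact (Proj.basicOpen_one _).symm
  | insert i I hi ih =>
    rw [prodX, Finset.prod_insert hi, Proj.basicOpen_mul, stdInter, Finset.inf_insert]
    exact congrArg (stdOpen K i ⊓ ·) ih

theorem X_mem (i : Fin (d + 1)) :
    (MvPolynomial.X i : MvPolynomial (Fin (d + 1)) K) ∈ grading d K 1 :=
  (MvPolynomial.mem_homogeneousSubmodule _ _).2 (MvPolynomial.isHomogeneous_X K i)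

theorem awayToSection_bijective {f : MvPolynomial (Fin (d + 1)) K} {m : ℕ}
    (hf : f ∈ grading d K m) (hm : 0 < m) :
    Function.Bijective (Proj.awayToSection (grading d K) f).hom :=
  ConcreteCategory.bijective_of_isIso (Proj.basicOpenIsoAway (grading d K) f hf hm).hom

theorem awayToSection_awayMap {f g x : MvPolynomial (Fin (d + 1)) K} {m : ℕ}
    (hg : g ∈ grading d K m) (hx : x = f * g)
    (h : Proj.basicOpen (grading d K) x ≤ Proj.basicOpen (grading d K) f)
    (z : HomogeneousLocalization.Away (grading d K) f) :
    (Proj.awayToSection (grading d K) x).hom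
      (HomogeneousLocalization.awayMap (grading d K) hg hx z) =
      resO h ((Proj.awayToSection (grading d K) f).hom z) :=
  congrArg (fun F => F.hom z) (Proj.awayMap_awayToSection (grading d K) hg hx)

theorem stdInter_affine {I : Finset (Fin (d + 1))} (hI : I.Nonempty) :
    IsAffineOpen (stdInter K I) := by
  rw [stdInter_eq]
  exact Proj.isAffineOpen_basicOpen _ _ (prodX_mem I) (Finset.card_pos.2 hI)

variable (K d) in
/-- Functions on the torus as Laurent polynomials. -/
def torusToLaurent : Γ(PSpace d K, stdInter K Finset.univ) →+* Laurent K (Fin (d + 1)) :=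
  (awayToLaurent (isUnit_prodX Finset.univ)).comp <|
    (RingEquiv.ofBijective (Proj.awayToSection (grading d K) (prodX K Finset.univ)).hom
      (awayToSection_bijective (prodX_mem _) (by simp))).symm.toRingHom.comp
      (resO (stdInter_eq Finset.univ).ge)

/-- Functions on an open set containing the torus as Laurent polynomials. -/
def openToLaurent {U : (PSpace d K).Opens} (hU : stdInter K Finset.univ ≤ U) :
    Γ(PSpace d K, U) →+* Laurent K (Fin (d + 1)) :=
  (torusToLaurent K d).comp (resO hU)

theorem openToLaurent_res {U V : (PSpace d K).Opens} (hV : stdInter K Finset.univ ≤ V)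
    (h : V ≤ U) (s : Γ(PSpace d K, U)) :
    openToLaurent hV (resO h s) = openToLaurent (hV.trans h) s := by
  rw [openToLaurent, openToLaurent, RingHom.comp_apply, RingHom.comp_apply, resO_resO]

theorem openToLaurent_awayToSection {f g : MvPolynomial (Fin (d + 1)) K} {m m' : ℕ}
    (hf : f ∈ grading d K m) (hg : g ∈ grading d K m') (hfg : prodX K Finset.univ = f * g)
    (hf' : IsUnit (toLaurent K f)) {U : (PSpace d K).Opens} (hU : stdInter K Finset.univ ≤ U)
    (h : U ≤ Proj.basicOpen (grading d K) f) (z : HomogeneousLocalization.Away (grading d K) f) :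
    openToLaurent hU (resO h ((Proj.awayToSection (grading d K) f).hom z)) =
      awayToLaurent hf' z := by
  rw [openToLaurent, RingHom.comp_apply, resO_resO, torusToLaurent, RingHom.comp_apply,
    RingHom.comp_apply, resO_resO, ← awayToSection_awayMap hg hfg]
  refine (congrArg (awayToLaurent _) (RingEquiv.symm_apply_apply _ _)).trans ?_
  exact awayToLaurent_awayMap hf' _ hf hg hfg z

theorem openToLaurent_constHom {U : (PSpace d K).Opens} (hU : stdInter K Finset.univ ≤ U) (a : K) :
    openToLaurent hU (constHom K U a) = algebraMap K _ a := by
  have h1 : (1 : MvPolynomial (Fin (d + 1)) K) ∈ grading d K 0 :=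
    (MvPolynomial.mem_homogeneousSubmodule _ _).2 (MvPolynomial.isHomogeneous_one _ _)
  have h2 : IsUnit (toLaurent (d := d) K 1) := by
    rw [map_one]
    exact isUnit_one
  exact (openToLaurent_awayToSection h1 (prodX_mem _) (one_mul _).symm h2 hU _ _).trans
    (awayToLaurent_algebraMap h2 a)

theorem awayToLaurent_X (i j : Fin (d + 1)) (h : IsUnit (toLaurent K (MvPolynomial.X i))) :
    awayToLaurent h (HomogeneousLocalization.Away.mk (grading d K) (X_mem i) 1
      (MvPolynomial.X j) (X_mem j)) =
        AddMonoidAlgebra.single (Pi.single j 1 - Pi.single i 1) 1 := by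
  have h1 := awayToLaurent_mk h (X_mem i) 1 (MvPolynomial.X j) (X_mem j)
  refine h.mul_left_injective ?_
  rw [pow_one] at h1
  refine h1.trans ?_
  rw [toLaurent_X, toLaurent_X]
  change _ = _ * xpow K i 1
  rw [xpow, xpow, AddMonoidAlgebra.single_mul_single, sub_add_cancel, mul_one]

theorem openToLaurent_coordHom {I : Finset (Fin (d + 1))} (p : MvPolynomial (CoordIdx I) K) :
    openToLaurent (stdInter_anti K (Finset.subset_univ I)) (coordHom K I p) = chi K I p := by
  have h : (openToLaurent (stdInter_anti K (Finset.subset_univ I))).comp (coordHom K I) =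
      (chi K I).toRingHom := by
    refine MvPolynomial.ringHom_ext (fun a => ?_) fun p => ?_
    · rw [RingHom.comp_apply, coordHom, MvPolynomial.coe_eval₂Hom, MvPolynomial.eval₂_C,
        openToLaurent_constHom]
      exact ((chi K I).commutes a).symm
    · rw [RingHom.comp_apply, coordHom, MvPolynomial.coe_eval₂Hom, MvPolynomial.eval₂_X]
      have h1 : IsUnit (toLaurent K (MvPolynomial.X p.1.2)) := by
        rw [toLaurent_X]
        exact isUnit_xpow _ _
      have h2 : prodX K Finset.univ = MvPolynomial.X p.1.2 * prodX K (Finset.univ.erase p.1.2) :=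
        (Finset.mul_prod_erase _ _ (Finset.mem_univ _)).symm
      have h3 := openToLaurent_awayToSection (X_mem p.1.2) (prodX_mem _) h2 h1
        (stdInter_anti K (Finset.subset_univ I)) (stdInter_le K p.2.1)
        (HomogeneousLocalization.Away.mk (grading d K) (X_mem p.1.2) 1
          (MvPolynomial.X p.1.1) (X_mem p.1.1))
      rw [awayToLaurent_X p.1.2 p.1.1 h1] at h3
      have h4 : (chi K I).toRingHom (MvPolynomial.X p) =
          AddMonoidAlgebra.single (Pi.single p.1.1 1 - Pi.single p.1.2 1) 1 :=
        MvPolynomial.aeval_X _ _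
      rw [h4]
      exact h3
  exact congrArg (fun F => F p) h

section nonempty

variable {I : Finset (Fin (d + 1))} (hI : I.Nonempty)

theorem openToLaurent_std (z : HomogeneousLocalization.Away (grading d K) (prodX K I)) :
    openToLaurent (stdInter_anti K (Finset.subset_univ I))
      (resO (stdInter_eq I).le ((Proj.awayToSection (grading d K) (prodX K I)).hom z)) =
      awayToLaurent (isUnit_prodX I) z := by
  refine openToLaurent_awayToSection (prodX_mem I) (prodX_mem (Finset.univ \ I)) ?_ _ _ _ z
  rw [prodX, prodX, prodX, mul_comm, Finset.prod_sdiff (Finset.subset_univ I)]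

include hI

theorem exists_awayToSection_eq (s : Γ(PSpace d K, stdInter K I)) :
    ∃ z, resO (stdInter_eq I).le ((Proj.awayToSection (grading d K) (prodX K I)).hom z) = s := by
  obtain ⟨z, hz⟩ := (awayToSection_bijective (prodX_mem (K := K) I) (Finset.card_pos.2 hI)).2
    (resO (stdInter_eq I).ge s)
  refine ⟨z, ?_⟩
  rw [hz, resO_resO]
  exact congrArg (fun F => F.hom s) ((PSpace d K).presheaf.map_id _)

theorem openToLaurent_injective :
    Function.Injective (openToLaurent (K := K) (stdInter_anti K (Finset.subset_univ I))) := by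
  refine (injective_iff_map_eq_zero _).2 fun s hs => ?_
  obtain ⟨z, rfl⟩ := exists_awayToSection_eq hI s
  rw [openToLaurent_std] at hs
  rw [(injective_iff_map_eq_zero _).1 (awayToLaurent_injective _) z hs, map_zero, map_zero]

/-- A function on `U_I` has poles along `x_i = 0`, `i ∈ I`, only. -/
theorem openToLaurent_mem (s : Γ(PSpace d K, stdInter K I)) :
    openToLaurent (stdInter_anti K (Finset.subset_univ I)) s ∈ twist K 0 I := by
  obtain ⟨z, rfl⟩ := exists_awayToSection_eq hI s
  rw [openToLaurent_std]
  obtain ⟨n, a, ha, rfl⟩ := HomogeneousLocalization.Away.mk_surjective (grading d K)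
    (prodX_mem I) z
  have h1 := awayToLaurent_mk (isUnit_prodX I) (prodX_mem I) n a ha
  have h2 : (∏ i ∈ I, xpow K i (-1)) ∈ twist K (-I.card) I := by
    clear h1 ha a n hI
    induction I using Finset.induction_on with
    | empty => simpa using one_mem_twist ∅
    | insert i I hi ih =>
      rw [Finset.prod_insert hi, Finset.card_insert_of_notMem hi]
      have h3 := mul_mem_twist (xpow_mem_twist (K := K) i (-1) (Finset.mem_singleton_self i)) ih
      rw [Finset.insert_eq]
      convert h3 using 2
      push_cast
      ring
  have h3 : (∏ i ∈ I, xpow K i (-1)) * toLaurent K (prodX K I) = 1 := by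
    rw [prodX, map_prod, ← Finset.prod_mul_distrib]
    refine Finset.prod_eq_one fun i _ => ?_
    rw [toLaurent_X, xpow_neg_mul_xpow]
  have h4 : awayToLaurent (isUnit_prodX I) (HomogeneousLocalization.Away.mk (grading d K)
      (prodX_mem I) n a ha) = toLaurent K a * (∏ i ∈ I, xpow K i (-1)) ^ n := by
    rw [← h1, mul_assoc, ← mul_pow, mul_comm (toLaurent K (prodX K I)), h3, one_pow, mul_one]
  have h5 : ∀ n : ℕ, (∏ i ∈ I, xpow K i (-1)) ^ n ∈ twist K (n * -I.card) I := by
    intro n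
    induction n with
    | zero => simpa using one_mem_twist I
    | succ n ih =>
      rw [pow_succ]
      have h6 := mul_mem_twist ih h2
      rw [Finset.union_self] at h6
      convert h6 using 2
      push_cast
      ring
  rw [h4]
  have h6 := mul_mem_twist (toLaurent_mem_twist ha) (h5 n)
  rw [Finset.empty_union] at h6
  convert h6 using 2
  push_cast [smul_eq_mul]
  ring

end nonempty

end Functions

/-! ### Generators of the rings of functions -/

section Functions

variable {K : Type u} [Field K] {d : ℕ}

theorem basicOpen_awayToSection {f : MvPolynomial (Fin (d + 1)) K} {m : ℕ}
    (hf : f ∈ grading d K m) (n : ℕ) (a : MvPolynomial (Fin (d + 1)) K)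
    (ha : a ∈ grading d K (n • m)) :
    (PSpace d K).basicOpen ((Proj.awayToSection (grading d K) f).hom
      (HomogeneousLocalization.Away.mk (grading d K) hf n a ha)) =
      Proj.basicOpen (grading d K) f ⊓ Proj.basicOpen (grading d K) a := by
  have key : ∀ (x : PSpace d K) (hx : x ∈ Proj.basicOpen (grading d K) f),
      IsUnit ((PSpace d K).presheaf.germ _ x hx ((Proj.awayToSection (grading d K) f).hom
        (HomogeneousLocalization.Away.mk (grading d K) hf n a ha))) ↔
        x ∈ Proj.basicOpen (grading d K) a := by
    intro x hx
    have h1 := congrArg (fun F => F.hom (HomogeneousLocalization.Away.mk (grading d K) hf n a ha))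
      (ProjectiveSpectrum.Proj.awayToSection_germ (grading d K) f x hx)
    refine (iff_of_eq (congrArg IsUnit h1)).trans ?_
    rw [CommRingCat.comp_apply]
    refine (MulEquiv.isUnit_map (Proj.stalkIso' (grading d K) x).symm).trans ?_
    have hp : (HomogeneousIdeal.toIdeal (ProjectiveSpectrum.asHomogeneousIdeal x)).IsPrime :=
      ProjectiveSpectrum.isPrime x
    refine (HomogeneousLocalization.isUnit_iff_isUnit_val (grading d K)
      (HomogeneousIdeal.toIdeal (ProjectiveSpectrum.asHomogeneousIdeal x)) _).symm.trans ?_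
    refine Iff.trans ?_ (IsLocalization.AtPrime.isUnit_mk'_iff
      (Localization.AtPrime (HomogeneousIdeal.toIdeal (ProjectiveSpectrum.asHomogeneousIdeal x)))
        (HomogeneousIdeal.toIdeal (ProjectiveSpectrum.asHomogeneousIdeal x)) a
        ⟨f ^ n, (Submonoid.powers_le.2 hx) ⟨n, rfl⟩⟩)
    rw [← Localization.mk_eq_mk']
    rfl
  ext x
  rw [SetLike.mem_coe, SetLike.mem_coe, TopologicalSpace.Opens.mem_inf]
  constructor
  · intro hx
    have hx' := (PSpace d K).basicOpen_le _ hx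
    exact ⟨hx', (key x hx').1 (((PSpace d K).mem_basicOpen _ x hx').1 hx)⟩
  · rintro ⟨hx, hx'⟩
    exact ((PSpace d K).mem_basicOpen _ x hx).2 ((key x hx).2 hx')

variable {I : Finset (Fin (d + 1))}

/-- Each `U_I` with `i ∈ I` is a basic open subset of the affine scheme `U_i`. -/
theorem exists_basicOpen_eq {i : Fin (d + 1)} (hi : i ∈ I) :
    ∃ g : Γ(PSpace d K, stdInter K {i}), stdInter K I = (PSpace d K).basicOpen g := by
  have ha : prodX K I ∈ grading d K (I.card • 1) := by
    rw [smul_eq_mul, mul_one]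
    exact prodX_mem I
  have h1 : stdInter K {i} ≤ Proj.basicOpen (grading d K) (MvPolynomial.X i) :=
    stdInter_le K (Finset.mem_singleton_self i)
  refine ⟨resO h1 ((Proj.awayToSection (grading d K) (MvPolynomial.X i)).hom
    (HomogeneousLocalization.Away.mk (grading d K) (X_mem i) I.card (prodX K I) ha)), ?_⟩
  rw [Scheme.basicOpen_res, basicOpen_awayToSection, ← stdInter_eq]
  have h2 : stdInter K I ≤ stdInter K {i} := stdInter_anti K (Finset.singleton_subset_iff.2 hi)
  exact le_antisymm (le_inf h2 (le_inf (h2.trans h1) le_rfl)) (inf_le_right.trans inf_le_right)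

end Functions

section Noetherian

variable {K : Type u} [NontriviallyNormedField K] [IsUltrametricDist K] {d : ℕ}
variable {I : Finset (Fin (d + 1))}

theorem coordHom_surjective (hI : I.Nonempty) : Function.Surjective (coordHom K I) := by
  intro s
  obtain ⟨p, hp⟩ := exists_chi_eq_of_mem (openToLaurent_mem hI s)
  exact ⟨p, openToLaurent_injective hI ((openToLaurent_coordHom p).trans hp)⟩

/-- Each Laurent polynomial of degree zero with poles along `x_i = 0`, `i ∈ I`, only is a function
on `U_I`. -/
theorem exists_openToLaurent_eq {f : Laurent K (Fin (d + 1))}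
    (hf : f ∈ twist K 0 I) :
    ∃ s, openToLaurent (K := K) (stdInter_anti K (Finset.subset_univ I)) s = f := by
  obtain ⟨p, rfl⟩ := exists_chi_eq_of_mem hf
  exact ⟨_, openToLaurent_coordHom p⟩

theorem isNoetherianRing_stdInter (hI : I.Nonempty) :
    IsNoetherianRing Γ(PSpace d K, stdInter K I) :=
  isNoetherianRing_of_surjective _ _ (coordHom K I) (coordHom_surjective hI)

end Noetherian

/-! ### Charts of a vector bundle -/

/-- A finite projective module has dual bases with any sufficiently large number of elements. -/
theorem exists_dualBasis (R N : Type*) [CommRing R] [AddCommGroup N] [Module R N]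
    [Module.Finite R N] [Module.Projective R N] : ∃ n₀, ∀ n, n₀ ≤ n →
      ∃ (m : Fin n → N) (l : Fin n → N →ₗ[R] R), ∀ s, ∑ a, l a s • m a = s := by
  obtain ⟨n₀, f, hf⟩ := Module.Finite.exists_fin' R N
  refine ⟨n₀, fun n hn => ?_⟩
  let f' := f ∘ₗ LinearMap.funLeft R R (Fin.castLE hn)
  have hf' : Function.Surjective f' :=
    hf.comp (LinearMap.funLeft_surjective_of_injective R R _ (Fin.castLE_injective hn))
  obtain ⟨h, hh⟩ := Module.projective_lifting_property f' LinearMap.id hf'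
  refine ⟨fun a => f' (Pi.single a 1), fun a => LinearMap.proj a ∘ₗ h, fun s => ?_⟩
  conv_rhs => rw [← LinearMap.id_apply (R := R) s, ← hh]
  rw [LinearMap.comp_apply, ← Finset.univ_sum_single (h s), map_sum]
  refine Finset.sum_congr rfl fun a _ => ?_
  rw [← map_smul, ← Pi.single_smul, smul_eq_mul, mul_one]
  rfl

/-- A functional on the sections over an affine open set extends to a basic open subset. -/
theorem exists_extend {X : Scheme.{u}} (M : X.Modules) [M.IsQuasicoherent] {U V : X.Opens}
    (hU : IsAffineOpen U) (g : Γ(X, U)) (hV : V = X.basicOpen g) (h : V ≤ U)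
    (l : Γ(M, U) →ₗ[Γ(X, U)] Γ(X, U)) :
    ∃ l' : Γ(M, V) →ₗ[Γ(X, V)] Γ(X, V), ∀ t, l' (resM M h t) = resO h (l t) := by
  let _ := moduleRes M h
  let _ := (resO h).toAlgebra
  have : IsScalarTower Γ(X, U) Γ(X, V) Γ(M, V) := IsScalarTower.of_compHom _ _ _
  have h1 := isLocalizedModule_res M h hU g hV
  have h2 : IsLocalization.Away g Γ(X, V) := by
    subst hV
    exact hU.isLocalization_basicOpen g
  refine ⟨IsLocalizedModule.mapExtendScalars (Submonoid.powers g)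
    ({ resM M h with map_smul' := resM_smul M h } : Γ(M, U) →ₗ[Γ(X, U)] Γ(M, V))
    (Algebra.linearMap Γ(X, U) Γ(X, V)) Γ(X, V) l, fun t => ?_⟩
  exact IsLocalizedModule.map_apply (Submonoid.powers g)
    ({ resM M h with map_smul' := resM_smul M h } : Γ(M, U) →ₗ[Γ(X, U)] Γ(M, V))
    (Algebra.linearMap Γ(X, U) Γ(X, V)) l t

section Charts

variable {K : Type u} [NontriviallyNormedField K] [IsUltrametricDist K] {d : ℕ}
variable (M : (PSpace d K).Modules) (P : Fin (d + 1) → Prop)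

/-- Dual bases of the sections of `M` on the `U_i`, together with the extensions of the functionals
to the torus. The numbers of generators are made equal to the same `n` for all `i`. -/
structure Charts (n : ℕ) where
  gen : ∀ i : {i // P i}, Fin n → Γ(M, stdInter K {i.1})
  func : ∀ i : {i // P i}, Fin n → Γ(M, stdInter K {i.1}) →ₗ[Γ(PSpace d K, stdInter K {i.1})]
    Γ(PSpace d K, stdInter K {i.1})
  ext : {i // P i} → Fin n → Γ(M, stdInter K Finset.univ) →ₗ[Γ(PSpace d K, stdInter K Finset.univ)]
    Γ(PSpace d K, stdInter K Finset.univ)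
  sum_func : ∀ i s, ∑ a, func i a s • gen i a = s
  ext_res : ∀ i a t, ext i a (resM M (stdInter_anti K (Finset.subset_univ _)) t) =
    resO (stdInter_anti K (Finset.subset_univ _)) (func i a t)

variable {M}

theorem exists_charts (hM : IsVectorBundle M) : ∃ n, Nonempty (Charts M P n) := by
  have := hM.isQuasicoherent
  have hN : ∀ i : {i // P i}, ∃ n₀, ∀ n, n₀ ≤ n → ∃ (m : Fin n → Γ(M, stdInter K {i.1}))
      (l : Fin n → Γ(M, stdInter K {i.1}) →ₗ[Γ(PSpace d K, stdInter K {i.1})]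
        Γ(PSpace d K, stdInter K {i.1})), ∀ s, ∑ a, l a s • m a = s := by
    intro i
    have := isNoetherianRing_stdInter (K := K) (Finset.singleton_nonempty i.1)
    obtain ⟨h1, h2⟩ := finite_projective_sections hM
      (stdInter_affine (K := K) (Finset.singleton_nonempty i.1))
    exact exists_dualBasis _ _
  choose n₀ hn₀ using hN
  have := Fintype.ofFinite {i // P i}
  choose m l hml using fun i => hn₀ i (Finset.univ.sup n₀) (Finset.le_sup (Finset.mem_univ i))
  have hE : ∀ (i : {i // P i}) (a : Fin (Finset.univ.sup n₀)),
      ∃ l' : Γ(M, stdInter K Finset.univ) →ₗ[Γ(PSpace d K, stdInter K Finset.univ)]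
        Γ(PSpace d K, stdInter K Finset.univ),
      ∀ t, l' (resM M (stdInter_anti K (Finset.subset_univ _)) t) =
        resO (stdInter_anti K (Finset.subset_univ _)) (l i a t) := by
    intro i a
    obtain ⟨g, hg⟩ := exists_basicOpen_eq (K := K) (Finset.mem_univ i.1)
    exact exists_extend M (stdInter_affine (Finset.singleton_nonempty i.1)) g hg _ (l i a)
  choose e he using hE
  exact ⟨_, ⟨m, l, e, hml, he⟩⟩

namespace Charts

variable {P} {n : ℕ} (C : Charts M P n)

section

variable {I : Finset (Fin (d + 1))}

/-- Restriction of sections to the torus. -/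
abbrev toTorus (M : (PSpace d K).Modules) (I : Finset (Fin (d + 1))) :
    Γ(M, stdInter K I) →+ Γ(M, stdInter K Finset.univ) :=
  resM M (stdInter_anti K (Finset.subset_univ I))

/-- A section on `U_I` is, up to a unit on `U_I`, the restriction of a section on `U_i`. -/
theorem exists_clear_denominator [M.IsQuasicoherent] {i : Fin (d + 1)} (hi : i ∈ I)
    (s : Γ(M, stdInter K I)) : ∃ (u : Γ(PSpace d K, stdInter K I)) (t : Γ(M, stdInter K {i})),
      IsUnit u ∧ resM M (stdInter_anti K (Finset.singleton_subset_iff.2 hi)) t = u • s := by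
  obtain ⟨g, hg⟩ := exists_basicOpen_eq (K := K) hi
  obtain ⟨N, t, ht⟩ := exists_res_eq_pow_smul M (stdInter_affine (Finset.singleton_nonempty i)) g hg
    (stdInter_anti K (Finset.singleton_subset_iff.2 hi)) s
  refine ⟨_, t, IsUnit.pow N ?_, ht⟩
  have h1 : stdInter K I ≤ (PSpace d K).basicOpen g := hg.le
  have h2 := (RingedSpace.isUnit_res_basicOpen (PSpace d K).toRingedSpace g).map (resO h1)
  have h3 := resO_resO ((PSpace d K).basicOpen_le g) h1 g
  rw [← h3]
  exact h2

variable [M.IsQuasicoherent]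

/-- The coordinates of a section on `U_I` are regular on `U_I`. -/
theorem ext_mem {i : {i // P i}} (hi : i.1 ∈ I) (a : Fin n) (s : Γ(M, stdInter K I)) :
    openToLaurent le_rfl (C.ext i a (toTorus M I s)) ∈ twist K 0 I := by
  obtain ⟨u, t, ⟨u, rfl⟩, ht⟩ := exists_clear_denominator hi s
  have h1 : s = (↑u⁻¹ : Γ(PSpace d K, stdInter K I)) •
      resM M (stdInter_anti K (Finset.singleton_subset_iff.2 hi)) t := by
    rw [ht, smul_smul, Units.inv_mul, one_smul]
  rw [h1, resM_smul, resM_resM, map_smul, C.ext_res, smul_eq_mul, map_mul, openToLaurent_res,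
    openToLaurent_res]
  have h2 := mul_mem_twist (openToLaurent_mem ⟨i.1, hi⟩ (↑u⁻¹ : Γ(PSpace d K, stdInter K I)))
    (openToLaurent_mem (Finset.singleton_nonempty i.1) (C.func i a t))
  rwa [add_zero, Finset.union_eq_left.2 (Finset.singleton_subset_iff.2 hi)] at h2

theorem sum_ext_smul {i : {i // P i}} (hi : i.1 ∈ I) (s : Γ(M, stdInter K I)) :
    ∑ a, C.ext i a (toTorus M I s) • toTorus M {i.1} (C.gen i a) = toTorus M I s := by
  obtain ⟨u, t, ⟨u, rfl⟩, ht⟩ := exists_clear_denominator hi s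
  have h1 : s = (↑u⁻¹ : Γ(PSpace d K, stdInter K I)) •
      resM M (stdInter_anti K (Finset.singleton_subset_iff.2 hi)) t := by
    rw [ht, smul_smul, Units.inv_mul, one_smul]
  rw [h1, resM_smul, resM_resM]
  simp only [map_smul, C.ext_res, smul_assoc]
  rw [← Finset.smul_sum]
  congr 1
  conv_rhs => rw [← C.sum_func i t, map_sum]
  exact Finset.sum_congr rfl fun a _ => (resM_smul M _ _ _).symm

include C in
theorem toTorus_injective {i : {i // P i}} (hi : i.1 ∈ I) :
    Function.Injective (toTorus M I) := by
  refine (injective_iff_map_eq_zero _).2 fun s hs => ?_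
  obtain ⟨u, t, ⟨u, rfl⟩, ht⟩ := exists_clear_denominator hi s
  have h1 : s = (↑u⁻¹ : Γ(PSpace d K, stdInter K I)) •
      resM M (stdInter_anti K (Finset.singleton_subset_iff.2 hi)) t := by
    rw [ht, smul_smul, Units.inv_mul, one_smul]
  have h2 : toTorus M {i.1} t = 0 := by
    have h3 := congrArg (toTorus M I) ht
    rw [resM_resM, resM_smul, hs, smul_zero] at h3
    exact h3
  have h4 : t = 0 := by
    rw [← C.sum_func i t]
    refine Finset.sum_eq_zero fun a _ => ?_
    have h5 : C.func i a t = 0 := by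
      refine (injective_iff_map_eq_zero _).1
        (openToLaurent_injective (K := K) (Finset.singleton_nonempty i.1)) _ ?_
      rw [← openToLaurent_res le_rfl (stdInter_anti K (Finset.subset_univ _)), ← C.ext_res, h2,
        map_zero, map_zero]
    rw [h5, zero_smul]
  rw [h1, h4, map_zero, smul_zero]

end

end Charts

end Charts

/-! ### The module of a vector bundle -/

section BaseChange

variable {R L N : Type*} [CommRing R] [CommRing L] [Algebra R L] [AddCommGroup N] [Module R N]

variable (L) in
/-- The base change of a functional. -/
def extendFunctional (f : N →ₗ[R] R) : L ⊗[R] N →ₗ[L] L :=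
  (Algebra.TensorProduct.rid R L L).toLinearMap ∘ₗ f.baseChange L

theorem extendFunctional_tmul (f : N →ₗ[R] R) (l : L) (w : N) :
    extendFunctional L f (l ⊗ₜ w) = algebraMap R L (f w) * l := by
  simp [extendFunctional, Algebra.smul_def]

end BaseChange

section System

variable {K : Type u} [NontriviallyNormedField K] [IsUltrametricDist K] {d : ℕ}
variable (M : (PSpace d K).Modules) {P : Fin (d + 1) → Prop}

/-- Laurent polynomials as an algebra over the functions on the torus; the latter are the Laurent
polynomials of degree zero. -/
@[reducible] def torusAlgebra :
    Algebra Γ(PSpace d K, stdInter K Finset.univ) (Laurent K (Fin (d + 1))) :=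
  (openToLaurent le_rfl).toAlgebra

attribute [local instance] torusAlgebra

/-- The sections on the torus, base changed to all Laurent polynomials. -/
abbrev TorusModule : Type u :=
  Laurent K (Fin (d + 1)) ⊗[Γ(PSpace d K, stdInter K Finset.univ)] Γ(M, stdInter K Finset.univ)

/-- The restriction of a section on `U_I` to the torus. -/
def torusSec (I : Finset (Fin (d + 1))) : Γ(M, stdInter K I) →+ TorusModule M :=
  (TensorProduct.mk Γ(PSpace d K, stdInter K Finset.univ) (Laurent K (Fin (d + 1)))
    Γ(M, stdInter K Finset.univ) 1).toAddMonoidHom.comp (Charts.toTorus M I)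

theorem torusSec_apply (I : Finset (Fin (d + 1))) (s : Γ(M, stdInter K I)) :
    torusSec M I s = 1 ⊗ₜ Charts.toTorus M I s := rfl

theorem torusSec_res {I J : Finset (Fin (d + 1))} (h : I ⊆ J) (s : Γ(M, stdInter K I)) :
    torusSec M J (resM M (stdInter_anti K h) s) = torusSec M I s := by
  rw [torusSec_apply, torusSec_apply, resM_resM]

theorem torusSec_smul (I : Finset (Fin (d + 1))) (f : Γ(PSpace d K, stdInter K I))
    (s : Γ(M, stdInter K I)) : torusSec M I (f • s) =
      openToLaurent (stdInter_anti K (Finset.subset_univ I)) f • torusSec M I s := by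
  rw [torusSec_apply, torusSec_apply, resM_smul, TensorProduct.tmul_smul,
    TensorProduct.smul_tmul', TensorProduct.smul_tmul', Algebra.smul_def, smul_eq_mul]
  congr 2

variable {M}
variable {n : ℕ} (C : Charts M P n) [M.IsQuasicoherent]

namespace Charts

/-- The Laurent system given by the charts of a vector bundle. -/
def system : LaurentSystem K P (TorusModule M) (Fin n) where
  gen i a := torusSec M {i.1} (C.gen i a)
  coord i a := extendFunctional _ (C.ext i a)
  sum_coord i v := by
    induction v using TensorProduct.induction_on with
    | zero => simp
    | add x y hx hy =>
      simp only [map_add, add_smul, Finset.sum_add_distrib, hx, hy]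
    | tmul l w =>
      have h0 : toTorus M Finset.univ w = w :=
        congrArg (fun F => F.hom w) (M.presheaf.map_id _)
      have h := C.sum_ext_smul (Finset.mem_univ i.1) w
      rw [h0] at h
      conv_rhs => rw [← h, TensorProduct.tmul_sum]
      refine Finset.sum_congr rfl fun a _ => ?_
      rw [extendFunctional_tmul, torusSec_apply, TensorProduct.smul_tmul', TensorProduct.tmul_smul,
        TensorProduct.smul_tmul', smul_eq_mul, mul_one, Algebra.smul_def]
  coord_gen i j a b := by
    rw [torusSec_apply, extendFunctional_tmul, mul_one]
    have h := C.ext_mem (Finset.mem_insert_self j.1 {i.1}) b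
      (resM M (stdInter_anti K (Finset.subset_insert j.1 {i.1})) (C.gen i a))
    rwa [resM_resM] at h

theorem system_coord_torusSec (i : {i // P i}) (a : Fin n) {I : Finset (Fin (d + 1))}
    (s : Γ(M, stdInter K I)) : C.system.coord i a (torusSec M I s) =
      openToLaurent le_rfl (C.ext i a (toTorus M I s)) := by
  change extendFunctional _ (C.ext i a) (torusSec M I s) = _
  rw [torusSec_apply, extendFunctional_tmul, mul_one]
  rfl

include C in
theorem torusSec_injective {i : {i // P i}} {I : Finset (Fin (d + 1))} (hi : i.1 ∈ I) :
    Function.Injective (torusSec M I) := by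
  refine (injective_iff_map_eq_zero _).2 fun s hs => ?_
  refine (injective_iff_map_eq_zero _).1 (C.toTorus_injective hi) s ?_
  rw [← C.sum_ext_smul hi s]
  refine Finset.sum_eq_zero fun a _ => ?_
  have h1 : openToLaurent le_rfl (C.ext i a (toTorus M I s)) = 0 := by
    rw [← C.system_coord_torusSec, hs, map_zero]
  rw [(injective_iff_map_eq_zero _).1
    (openToLaurent_injective (K := K) ⟨i.1, Finset.mem_univ i.1⟩) _ h1, zero_smul]

/-- The elements of the Laurent system regular on `U_I` are the sections on `U_I`. -/
theorem mem_sec_iff {I : Finset {i // P i}} (hI : I.Nonempty) {v : TorusModule M} :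
    v ∈ C.system.sec I ↔ ∃ s : Γ(M, stdInter K (vals I)), torusSec M (vals I) s = v := by
  constructor
  · intro hv
    obtain ⟨i, hi⟩ := hI
    have hi' : i.1 ∈ vals I := Finset.mem_image_of_mem _ hi
    choose f hf using fun a => exists_openToLaurent_eq (hv i hi a)
    refine ⟨∑ a, f a • resM M (stdInter_anti K (Finset.singleton_subset_iff.2 hi'))
      (C.gen i a), ?_⟩
    rw [map_sum]
    conv_rhs => rw [← C.system.sum_coord i v]
    refine Finset.sum_congr rfl fun a _ => ?_
    rw [torusSec_smul, hf, torusSec_res M (Finset.singleton_subset_iff.2 hi')]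
    rfl
  · rintro ⟨s, rfl⟩ i hi a
    rw [system_coord_torusSec]
    exact C.ext_mem (Finset.mem_image_of_mem _ hi) a s

end Charts

end System

/-! ### The topology on sections -/

section SectionTopology

open Filter

variable {K : Type u} [NontriviallyNormedField K] [IsUltrametricDist K] {d : ℕ}
variable (M : (PSpace d K).Modules) (ε : ℝ≥0)

instance (I : Finset (Fin (d + 1))) : IsTopologicalAddGroup (AlgSec M ε I) :=
  isTopologicalAddGroup_canTop K (CoordIdx I) ε⁻¹ (AlgSec M ε I)

attribute [local instance] twistAlgModule

/-- Functions on `U_I`, for non-empty `I`, as Laurent polynomials. -/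
def functionsEquiv {I : Finset (Fin (d + 1))} (hI : I.Nonempty) :
    Γ(PSpace d K, stdInter K I) ≃+* twistAlg K I :=
  RingEquiv.ofBijective ((openToLaurent (stdInter_anti K (Finset.subset_univ I))).codRestrict
    (twistAlg K I) (openToLaurent_mem hI)) ⟨fun _ _ h =>
      openToLaurent_injective hI (congrArg Subtype.val h), fun f =>
      (exists_openToLaurent_eq f.2).imp fun _ h => Subtype.ext h⟩

theorem functionsEquiv_coordHom {I : Finset (Fin (d + 1))} (hI : I.Nonempty)
    (p : MvPolynomial (CoordIdx I) K) : functionsEquiv hI (coordHom K I p) = chiRes K I p :=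
  Subtype.ext (openToLaurent_coordHom p)

variable {M}

/-- The multiples of a section, as a linear map over the coordinate functions. -/
def mulSec {I : Finset (Fin (d + 1))} (hI : I.Nonempty) (g : Γ(M, stdInter K I)) :
    twistAlg K I →ₗ[MvPolynomial (CoordIdx I) K] AlgSec M ε I where
  toFun f := ((functionsEquiv hI).symm f • g : Γ(M, stdInter K I))
  map_add' f f' := by
    rw [map_add, add_smul]
    rfl
  map_smul' p f := by
    change ((functionsEquiv hI).symm (chiRes K I p * f) • g : Γ(M, stdInter K I)) =
      (coordHom K I p • ((functionsEquiv hI).symm f • g) : Γ(M, stdInter K I))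
    rw [map_mul, ← functionsEquiv_coordHom hI, RingEquiv.symm_apply_apply, smul_smul]

variable {P : Fin (d + 1) → Prop} {n : ℕ} (C : Charts M P n) [M.IsQuasicoherent]

namespace Charts

theorem ext_toTorus_add {I : Finset (Fin (d + 1))} (i : {i // P i}) (a : Fin n)
    (s t : Γ(M, stdInter K I)) : C.ext i a (toTorus M I (s + t)) =
      C.ext i a (toTorus M I s) + C.ext i a (toTorus M I t) := by
  rw [map_add, map_add]

theorem ext_toTorus_smul {I : Finset (Fin (d + 1))} (i : {i // P i}) (a : Fin n)
    (f : Γ(PSpace d K, stdInter K I)) (s : Γ(M, stdInter K I)) :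
    openToLaurent le_rfl (C.ext i a (toTorus M I (f • s))) =
      openToLaurent (stdInter_anti K (Finset.subset_univ I)) f *
        openToLaurent le_rfl (C.ext i a (toTorus M I s)) := by
  rw [resM_smul, map_smul, smul_eq_mul, map_mul, openToLaurent_res]

/-- The coordinates of sections on `U_I`, as linear maps over the coordinate functions. -/
def coordSec {I : Finset (Fin (d + 1))} {i : {i // P i}} (hi : i.1 ∈ I) (a : Fin n) :
    AlgSec M ε I →ₗ[MvPolynomial (CoordIdx I) K] twistAlg K I where
  toFun s := ⟨openToLaurent le_rfl (C.ext i a (toTorus M I s)), C.ext_mem hi a s⟩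
  map_add' s t := Subtype.ext <|
    (congrArg (openToLaurent le_rfl) (C.ext_toTorus_add i a s t)).trans (map_add _ _ _)
  map_smul' p s := Subtype.ext <| (C.ext_toTorus_smul i a (coordHom K I p) s).trans <|
    congrArg (· * openToLaurent le_rfl (C.ext i a (toTorus M I s))) (openToLaurent_coordHom p)

theorem sum_mulSec_coordSec {I : Finset (Fin (d + 1))} {i : {i // P i}} (hi : i.1 ∈ I)
    (s : AlgSec M ε I) : ∑ a, mulSec ε ⟨i.1, hi⟩
      (resM M (stdInter_anti K (Finset.singleton_subset_iff.2 hi)) (C.gen i a))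
      (C.coordSec ε hi a s) = s := by
  refine C.toTorus_injective hi ?_
  refine (map_sum (toTorus M I) (fun a => ((functionsEquiv ⟨i.1, hi⟩).symm (C.coordSec ε hi a s) •
    resM M (stdInter_anti K (Finset.singleton_subset_iff.2 hi)) (C.gen i a) :
      Γ(M, stdInter K I))) Finset.univ).trans ?_
  refine Eq.trans (Finset.sum_congr rfl fun a _ => ?_) (C.sum_ext_smul hi s)
  rw [resM_smul, resM_resM]
  congr 1
  refine openToLaurent_injective (K := K) (I := Finset.univ) ⟨i.1, Finset.mem_univ _⟩ ?_
  rw [openToLaurent_res]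
  exact congrArg Subtype.val ((functionsEquiv ⟨i.1, hi⟩).apply_symm_apply (C.coordSec ε hi a s))

/-- The topology on the sections on `U_I` defined by the affinoid `U_{I,ε}` is that given by the
coordinates in the charts and the norms on Laurent polynomials. -/
theorem tendsto_nhds_zero_iff [DecidablePred P] (hρ : 1 ≤ ε⁻¹) {I : Finset {i // P i}}
    (hI : I.Nonempty) {X : Type*} {F : Filter X} {g : X → AlgSec M ε (vals I)} : Tendsto g F (𝓝 0) ↔
      Tendsto (fun x => torusSec M (vals I) (g x)) F
        ((C.system.nbhd (isAdmissible_laurentNhd hρ)).nhd I) := by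
  obtain ⟨i, hi⟩ := hI
  have hi' : i.1 ∈ vals I := Finset.mem_image_of_mem _ hi
  constructor
  · intro h
    refine C.system.tendsto_nbhd _ hi fun a => ?_
    have h1 := (tendsto_canNhd K _ ε⁻¹ (C.coordSec ε hi' a)).comp h
    rw [canNhd_twistAlg hρ, tendsto_comap_iff] at h1
    exact (tendsto_twistNhd.2 ⟨h1, Eventually.of_forall fun x => C.ext_mem hi' a (g x)⟩).congr
      fun x => (C.system_coord_torusSec i a _).symm
  · intro h
    have h1 : ∀ a, Tendsto (fun x => mulSec ε ⟨i.1, hi'⟩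
        (resM M (stdInter_anti K (Finset.singleton_subset_iff.2 hi')) (C.gen i a))
        (C.coordSec ε hi' a (g x))) F (𝓝 0) := by
      intro a
      have h2 : Tendsto (fun x => C.coordSec ε hi' a (g x)) F
          (canNhd K (CoordIdx (vals I)) ε⁻¹ (twistAlg K (vals I))) := by
        rw [canNhd_twistAlg hρ, tendsto_comap_iff]
        have h3 := (tendsto_twistNhd.1 ((C.system.tendsto_nbhd_coord _ hi a).comp h)).1
        refine h3.congr fun x => ?_
        exact C.system_coord_torusSec i a _
      exact (tendsto_canNhd K _ ε⁻¹ (mulSec ε ⟨i.1, hi'⟩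
        (resM M (stdInter_anti K (Finset.singleton_subset_iff.2 hi')) (C.gen i a)))).comp h2
    have h2 := tendsto_finsetSum Finset.univ fun a _ => h1 a
    rw [Finset.sum_const_zero] at h2
    exact h2.congr fun x => C.sum_mulSec_coordSec ε hi' (g x)

end Charts

end SectionTopology

/-! ### The Čech complex -/

section Strict

open Filter

/-- A continuous homomorphism is strict if it has a section on its image which is continuous at
zero; the section need not be a homomorphism. -/
theorem isStrictMap_of_section {G H : Type*} [AddCommGroup G] [TopologicalSpace G]
    [IsTopologicalAddGroup G] [AddCommGroup H] [TopologicalSpace H] [IsTopologicalAddGroup H]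
    {f : G →+ H} (hf : Continuous f) (b : f.range → G) (hb : Tendsto b (𝓝 0) (𝓝 0))
    (hfb : ∀ y, f (b y) = y) : Topology.IsStrictMap f := by
  refine f.isStrictMap_iff_isOpenQuotientMap_rangeRestrict.2
    ⟨f.rangeRestrict_surjective, hf.subtype_mk _, ?_⟩
  refine IsTopologicalAddGroup.isOpenMap_iff_nhds_zero.2 ?_
  calc 𝓝 (0 : f.range) = map f.rangeRestrict (map b (𝓝 0)) := by
        rw [map_map, show f.rangeRestrict ∘ b = id from funext fun y => Subtype.ext (hfb y), map_id]
    _ ≤ map f.rangeRestrict (𝓝 0) := map_mono hb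

end Strict

section CechSections

open Filter

variable {K : Type u} [NontriviallyNormedField K] [IsUltrametricDist K] {d : ℕ}
variable (M : (PSpace d K).Modules) (ε : ℝ≥0)

/-- `torusSec` on the group of sections with its topology. -/
def secHom (I : Finset (Fin (d + 1))) : AlgSec M ε I →+ TorusModule M := torusSec M I

theorem secHom_resHom {I J : Finset (Fin (d + 1))} (h : I ⊆ J) (s : AlgSec M ε I) :
    secHom M ε J (resHom M ε h s) = secHom M ε I s := torusSec_res M h s

variable (r : ℕ)

/-- A cochain as a cochain with values in the sections on the torus. -/
def cochainHom (q : ℕ) : Cochain M ε r q →+ ((Fin (q + 1) → CoverIdx d r) → TorusModule M) where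
  toFun f t := secHom M ε (tupleSet r t) (f t)
  map_zero' := funext fun _ => map_zero _
  map_add' _ _ := funext fun _ => map_add _ _ _

theorem cochainHom_apply (q : ℕ) (f : Cochain M ε r q) (t : Fin (q + 1) → CoverIdx d r) :
    cochainHom M ε r q f t = secHom M ε (tupleSet r t) (f t) := rfl

theorem cobd_cochainHom (q : ℕ) (f : Cochain M ε r q) :
    cobd (cochainHom M ε r q f) = cochainHom M ε r (q + 1) (cechDiff M ε r q f) := by
  ext1 t
  simp only [cobd, cochainHom_apply, cechDiff, LinearMap.pi_apply, LinearMap.sum_apply,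
    LinearMap.smul_apply, LinearMap.comp_apply, LinearMap.proj_apply, map_sum]
  refine Finset.sum_congr rfl fun k _ => ?_
  have h : ((-1 : K) ^ (k : ℕ)) = (((-1 : ℤ) ^ (k : ℕ) : ℤ) : K) := by push_cast; rfl
  rw [h, Int.cast_smul_eq_zsmul, map_zsmul, secHom_resHom]

theorem tupleSet_eq_vals {q : ℕ} (t : Fin (q + 1) → CoverIdx d r) :
    tupleSet r t = vals (entries t) := Finset.image_image.symm

variable {M r} {n : ℕ} (C : Charts M (fun i : Fin (d + 1) => r < (i : ℕ)) n) [M.IsQuasicoherent]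

namespace Charts

include C in
theorem cochainHom_injective (q : ℕ) : Function.Injective (cochainHom M ε r q) := by
  intro f g h
  ext1 t
  refine C.torusSec_injective (i := t 0) ?_ (congrFun h t)
  exact Finset.mem_image_of_mem _ (Finset.mem_univ 0)

/-- The cochains with regular values are the Čech cochains. -/
theorem mem_legal_iff {q : ℕ} {c : (Fin (q + 1) → CoverIdx d r) → TorusModule M} :
    c ∈ C.system.legal (q + 1) ↔ ∃ f, cochainHom M ε r q f = c := by
  have h : ∀ t, c t ∈ C.system.sec (entries t) ↔
      ∃ s : AlgSec M ε (tupleSet r t), secHom M ε (tupleSet r t) s = c t := fun t => by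
    rw [tupleSet_eq_vals]
    exact C.mem_sec_iff (entries_nonempty t)
  constructor
  · intro hc
    choose f hf using fun t => (h t).1 (hc t)
    exact ⟨f, funext hf⟩
  · rintro ⟨f, rfl⟩ t
    exact (h t).2 ⟨f t, rfl⟩

theorem tendsto_cochain_iff (hρ : 1 ≤ ε⁻¹) {q : ℕ} {X : Type*} {F : Filter X}
    {g : X → Cochain M ε r q} : Tendsto g F (𝓝 0) ↔
      Tendsto (fun x => cochainHom M ε r q (g x)) F (C.system.cochainNhd hρ (q + 1)) := by
  have h : ∀ (t : Fin (q + 1) → CoverIdx d r) (J : Finset (Fin (d + 1)))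
      (_ : J = vals (entries t)) (g : X → AlgSec M ε J), Tendsto g F (𝓝 0) ↔
      Tendsto (fun x => secHom M ε J (g x)) F
        ((C.system.nbhd (isAdmissible_laurentNhd hρ)).nhd (∅ ∪ entries t)) := by
    rintro t _ rfl g
    rw [Finset.empty_union]
    exact C.tendsto_nhds_zero_iff ε hρ (entries_nonempty t)
  constructor
  · intro hg
    exact NbhdSys.tendsto_cochainNhd fun t _ => (h t _ (tupleSet_eq_vals r t) _).1
      (tendsto_pi_nhds.1 hg t)
  · intro hg
    refine tendsto_pi_nhds.2 fun t => (h t _ (tupleSet_eq_vals r t) _).2 ?_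
    have h1 : Tendsto (fun c : (Fin (q + 1) → CoverIdx d r) → TorusModule M => c t)
        (C.system.cochainNhd hρ (q + 1))
        ((C.system.nbhd (isAdmissible_laurentNhd hρ)).nhd (∅ ∪ entries t)) :=
      NbhdSys.tendsto_eval (Finset.subset_univ _)
    exact h1.comp (f := fun x => cochainHom M ε r q (g x)) hg

/-- Cochains close to zero have regular values: the filter of neighbourhoods of zero lives on them. -/
theorem eventually_mem_legal (hρ : 1 ≤ ε⁻¹) (l : ℕ) :
    ∀ᶠ c in C.system.cochainNhd hρ (l + 1), c ∈ C.system.legal (l + 1) := by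
  refine eventually_all.2 fun t => ?_
  refine (NbhdSys.tendsto_eval (Finset.subset_univ _)).eventually
    (p := fun v => v ∈ C.system.sec (entries t)) ?_
  rw [Finset.empty_union]
  refine (eventually_all_finset _).2 fun i hi => eventually_all.2 fun a => ?_
  exact (C.system.tendsto_nbhd_coord _ hi a).eventually eventually_mem_twist

include C in
theorem continuous_cechDiff (hρ : 1 ≤ ε⁻¹) (q : ℕ) : Continuous (cechDiff M ε r q) := by
  refine continuous_of_continuousAt_zero (cechDiff M ε r q).toAddMonoidHom ?_
  rw [ContinuousAt, map_zero]
  refine (C.tendsto_cochain_iff ε hρ).2 ?_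
  have h := (NbhdSys.tendsto_cobd (q + 1)).comp
    ((C.tendsto_cochain_iff ε hρ (F := 𝓝 0) (g := id)).1 tendsto_id)
  exact h.congr fun f => cobd_cochainHom M ε r q f

include C in
/-- The Čech differentials of a bundle with charts are strict. -/
theorem isStrictMap_cechDiff (hρ : 1 ≤ ε⁻¹) (q : ℕ) :
    Topology.IsStrictMap (cechDiff M ε r q) := by
  classical
  obtain ⟨b, hb, hb'⟩ := LaurentSystem.strictAt hρ q C.system
  let D := (cechDiff M ε r q).toAddMonoidHom
  let e := cochainHom M ε r q
  let e' := cochainHom M ε r (q + 1)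
  -- `b` takes values in sections near zero only; elsewhere any preimage will do
  have hs : ∀ y : D.range, ∃ f, D f = y ∧
      (b (e' y) ∈ C.system.legal (q + 1) → e f = b (e' y)) := by
    rintro ⟨_, f, rfl⟩
    by_cases h : b (e' (D f)) ∈ C.system.legal (q + 1)
    · obtain ⟨g, hg⟩ := (C.mem_legal_iff ε).1 h
      refine ⟨g, C.cochainHom_injective ε (q + 1) ?_, fun _ => hg⟩
      have h1 := hb' (e f) ((C.mem_legal_iff ε).2 ⟨f, rfl⟩)
      have h2 : cobd (e f) = e' (D f) := cobd_cochainHom M ε r q f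
      have h3 : cobd (e g) = e' (D g) := cobd_cochainHom M ε r q g
      rw [h2, ← hg, h3] at h1
      exact h1
    · exact ⟨f, rfl, fun h' => absurd h' h⟩
  choose s hs hs' using hs
  refine isStrictMap_of_section (f := D) (C.continuous_cechDiff ε hρ q) s ?_ hs
  refine (C.tendsto_cochain_iff ε hρ).2 ?_
  have h1 : Tendsto (fun y : D.range => e' y) (𝓝 0)
      (C.system.cochainNhd hρ (q + 1 + 1) ⊓ 𝓟 (cobd '' C.system.legal (q + 1))) := by
    refine tendsto_inf.2 ⟨(C.tendsto_cochain_iff ε hρ).1 continuous_subtype_val.continuousAt,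
      tendsto_principal.2 (Eventually.of_forall ?_)⟩
    rintro ⟨_, f, rfl⟩
    exact ⟨e f, (C.mem_legal_iff ε).2 ⟨f, rfl⟩, cobd_cochainHom M ε r q f⟩
  have h2 := hb.comp h1
  refine h2.congr' ?_
  filter_upwards [h2.eventually (C.eventually_mem_legal ε hρ q)] with y hy
  exact (hs' y hy).symm

end Charts

end CechSections

end

end EquivCech

theorem mainTheorem4 {K : Type u} [NontriviallyNormedField K] [IsUltrametricDist K]
    [LocallyCompactSpace K] (d r : ℕ) (hr : r < d)
    (E : EquivCech.EquivariantVectorBundle K d)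
    (ε : ℝ≥0) (hε0 : 0 < ε) (hε1 : ε < 1)
    (hε : (ε : ℝ) ∈ Set.range (spectralNorm K (AlgebraicClosure K))) (q : ℕ) :
    Continuous (EquivCech.cechDiff E.sheaf ε r q) ∧
      Topology.IsStrictMap (EquivCech.cechDiff E.sheaf ε r q) := by
  obtain ⟨n, ⟨C⟩⟩ := EquivCech.exists_charts (fun i : Fin (d + 1) => r < (i : ℕ)) E.isVectorBundle
  have := E.isVectorBundle.isQuasicoherent
  have hρ : 1 ≤ ε⁻¹ := (one_le_inv₀ hε0).2 hε1.le
  exact ⟨C.continuous_cechDiff ε hρ q, C.isStrictMap_cechDiff ε hρ q⟩
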